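/- **Setting.** Let $n\ge 1$, let $U,V\subset\mathbf R^n$ and $c:\overline U\times\overline V\to\mathbf R$ satisfy: * **(B0)** $U,V$ are open and bounded, and $c\in C^4(\overline U\times\overline V)$ (i.e. $c\in C(\overline U\times\overline V)\cap C^4(U\times V)$ and all derivatives of order $\le 4$ extend continuously to $\overline U\times\overline V$; derivatives at boundary points are these extensions); * **(B1)** for all $(x_0,y_0)\in\overline U\times\overline V$ the maps $x\in\overline U\mapsto -D_yc(x,y_0)$ and $y\in\overline V\mapsto -D_xc(x_0,y)$ are diffeomorphisms onto their ranges (injective, with $D^2_{xy}c$ invertible on $\overline U\times\overline V$); * **(B2)** $U_{y_0}:=-D_yc(U,y_0)$ and $V_{x_0}:=-D_xc(x_0,V)$ are convex for all $(x_0,y_0)\in\overline U\times\overline V$; * **(B3)** $-\frac{\partial^4}{\partial s^2\partial t^2}\big|_{(s,t)=(0,0)}c(x(s),y(t))\ge 0$ for all curves $x:[-1,1]\to\overline U$, $y:[-1,1]\to\overline V$ such that $t\in[-1,1]\mapsto (D_yc(x(t),y(0)),D_xc(x(0),y(t)))\in\mathbf R^{2n}$ is an affinely parameterized line segment. Set $\beta^\pm_c=\|(D^2_{xy}c)^{\pm1}\|_{L^\infty(U\times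 V)}$ (operator norms) and define $\varepsilon_c\in(0,\infty]$ by $$\varepsilon_c^{-1}=2(\beta_c^+)^4(\beta_c^-)^6\,\|D^3_{xxy}c\|_{L^\infty(U\times V)} .$$ For $\tilde y\in\overline V$ let $q\in\overline{U_{\tilde y}}\mapsto x(q)\in\overline U$ be the inverse of $x\mapsto q=-D_yc(x,\tilde y)$, and let $\tilde c(q,y)=c(x(q),y)-c(x(q),\tilde y)$ on $\overline{U_{\tilde y}}\times\overline V$ be the modified cost. For $\tilde u:\overline{U_{\tilde y}}\to\mathbf R$ put $\tilde u^{\tilde c^*}(y)=\sup_{q\in\overline{U_{\tilde y}}}\left(-\tilde c(q,y)-\tilde u(q)\right)$ for $y\in\overline V$. The function $\tilde u$ is called $\tilde c$-convex if $\tilde u(q)=\sup_{y\in\overline V}\left(-\tilde c(q,y)-\tilde u^{\tilde c^*}(y)\right)$ for all $q\in\overline{U_{\tilde y}}$ (under B0–B3 such a $\tilde u$ is automatically convex). For a set $Z\subset\overline{U_{\tilde y}}$ let $$|\partial^{\tilde c}\tilde u|(Z)=\mathrm{Leb}\big\{y\in\overline V:\ \tilde u(q)+\tilde u^{\tilde c^*}(y)+\tilde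 c(q,y)=0\text{ for some }q\in Z\big\},\qquad \gamma^+_{\tilde c}(Z\times V)=\|\det D^2_{qy}\tilde c\|_{L^\infty(Z\times V)} .$$ **Lemma 6.5 (Alexandrov type estimate and lower barrier).** For every $n\geq 1$ there are constants $C_0(n),C(n)\in(0,\infty)$ depending only on $n$ such that the following holds for all $U,V,c$ satisfying (B0)–(B3). The number $\varepsilon_c'(n):=\varepsilon_c/C_0(n)$, which depends only on $n$ and the cost, is positive. Let $\tilde y\in\overline V$, let $\tilde u:\overline{U_{\tilde y}}\to\mathbf R$ be a $\tilde c$-convex function, let $Z=\{q\in\overline{U_{\tilde y}}:\tilde u(q)\le 0\}$, and assume that $\tilde u=0$ on $\partial Z$. Let $\tilde q\in\operatorname{int}Z$, and let $\Pi^+,\Pi^-$ be two parallel hyperplanes supporting $Z$ from two opposite sides (each meets $Z$, and $Z$ lies between them). If $\operatorname{diam}(Z)\le\varepsilon_c'(n)$, then $$|\tilde u(\tilde q)|^n\le C(n)\,\gamma^+_{\tilde c}(Z\times V)\,\frac{\min\{\operatorname{dist}(\tilde q,\Pi^+),\operatorname{dist}(\tilde q,\Pi^-)\}}{\ell_{\Pi^+}}\;|\partial^{\tilde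 c}\tilde u|(Z)\;\mathrm{Leb}(Z),$$ where $\ell_{\Pi^+}$ is the maximal length among the segments obtained by intersecting $Z$ with a line orthogonal to $\Pi^+$. -/

import Mathlib

open Set Filter Topology MeasureTheory
open scoped ENNReal NNReal

noncomputable section

namespace OptTransport

/-- Euclidean space of dimension `n`. -/
abbrev Euc (n : ℕ) := EuclideanSpace ℝ (Fin n)

variable {n : ℕ}

/-! ### Regularity up to the boundary and derivatives of the cost -/

/-- `f` is of class `C^k` on the closure of the open set `Ω`: `f` is continuous on the closure,
`C^k` in `Ω`, and all derivatives of order at most `k` extend continuously to the closure. -/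
def ContDiffUpTo {F : Type*} [NormedAddCommGroup F] [NormedSpace ℝ F]
    (k : ℕ) (f : F → ℝ) (Ω : Set F) : Prop :=
  ContinuousOn f (closure Ω) ∧ ContDiffOn ℝ k f Ω ∧
    ∀ m ≤ k, ∀ p ∈ closure Ω, ∃ L, Tendsto (iteratedFDeriv ℝ m f) (𝓝[Ω] p) (𝓝 L)

/-- `D_x c(x,y)` for `(x,y)` in the closure of `U × V`: the gradient in the first variable,
extended by continuity from `U × V`. -/
def gradX (c : Euc n → Euc n → ℝ) (U V : Set (Euc n)) (x y : Euc n) : Euc n :=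
  extendFrom (U ×ˢ V) (fun p : Euc n × Euc n => gradient (fun x' => c x' p.2) p.1) (x, y)

/-- `D_y c(x,y)` for `(x,y)` in the closure of `U × V`: the gradient in the second variable,
extended by continuity from `U × V`. -/
def gradY (c : Euc n → Euc n → ℝ) (U V : Set (Euc n)) (x y : Euc n) : Euc n :=
  extendFrom (U ×ˢ V) (fun p : Euc n × Euc n => gradient (fun y' => c p.1 y') p.2) (x, y)

/-- The mixed second derivative `D²_{xy} c(x,y)`, as the linear map `ξ ↦ ∂_ξ (D_y c)(x,y)`
(differentiate in `x` the gradient in `y`).  Meant for interior points. -/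
def mixedHess (c : Euc n → Euc n → ℝ) (x y : Euc n) : Euc n →L[ℝ] Euc n :=
  fderiv ℝ (fun x' => gradient (fun y' => c x' y') y) x

/-- `D²_{xy} c(x,y)` for `(x,y)` in the closure of `U × V`, extended by continuity. -/
def mixedHessBar (c : Euc n → Euc n → ℝ) (U V : Set (Euc n)) (x y : Euc n) :
    Euc n →L[ℝ] Euc n :=
  extendFrom (U ×ˢ V) (fun p : Euc n × Euc n => mixedHess c p.1 p.2) (x, y)

/-- The third derivative `D³_{xxy} c(x,y)`. -/
def thirdXXY (c : Euc n → Euc n → ℝ) (x y : Euc n) : Euc n →L[ℝ] Euc n →L[ℝ] Euc n :=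
  fderiv ℝ (fun x' => mixedHess c x' y) x

/-! ### The hypotheses on the cost -/

/-- `U`, `V` are bounded open sets and `c` is `C⁴` on the closure of `U × V`. -/
def B0 (c : Euc n → Euc n → ℝ) (U V : Set (Euc n)) : Prop :=
  IsOpen U ∧ IsOpen V ∧ Bornology.IsBounded U ∧ Bornology.IsBounded V ∧
    ContDiffUpTo 4 (fun p : Euc n × Euc n => c p.1 p.2) (U ×ˢ V)

/-- Bi-twist: for all `(x₀, y₀)` in the closure of `U × V`, the maps `x ↦ -D_y c(x, y₀)` and
`y ↦ -D_x c(x₀, y)` are diffeomorphisms of the closures of `U` and of `V` onto their ranges, that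
is, they are injective and their derivatives (up to sign `D²_{xy} c` and its transpose) are
invertible up to the boundary. -/
def B1 (c : Euc n → Euc n → ℝ) (U V : Set (Euc n)) : Prop :=
  (∀ y₀ ∈ closure V, InjOn (fun x => -gradY c U V x y₀) (closure U)) ∧
  (∀ x₀ ∈ closure U, InjOn (fun y => -gradX c U V x₀ y) (closure V)) ∧
  ∀ x₀ ∈ closure U, ∀ y₀ ∈ closure V, (mixedHessBar c U V x₀ y₀).IsInvertible

/-- The domain `U_{y₀} = -D_y c(U, y₀)`. -/
def expDomain (c : Euc n → Euc n → ℝ) (U V : Set (Euc n)) (y₀ : Euc n) : Set (Euc n) :=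
  (fun x => -gradY c U V x y₀) '' U

/-- Bi-convexity: `-D_y c(U, y₀)` and `-D_x c(x₀, V)` are convex for all `(x₀, y₀)` in the
closure of `U × V`. -/
def B2 (c : Euc n → Euc n → ℝ) (U V : Set (Euc n)) : Prop :=
  (∀ y₀ ∈ closure V, Convex ℝ (expDomain c U V y₀)) ∧
  ∀ x₀ ∈ closure U, Convex ℝ ((fun y => -gradX c U V x₀ y) '' V)

/-- Non-negative cross-curvature: `-∂⁴/∂s²∂t² c(x(s), y(t)) ≥ 0` at `(s,t) = (0,0)` for every
curve in the closure of `U × V` along which `t ↦ (D_y c(x(t), y(0)), D_x c(x(0), y(t)))`,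
`t ∈ [-1,1]`, is an affinely parameterized line segment. -/
def B3 (c : Euc n → Euc n → ℝ) (U V : Set (Euc n)) : Prop :=
  ∀ x y : ℝ → Euc n,
    (∀ t ∈ Icc (-1 : ℝ) 1, x t ∈ closure U ∧ y t ∈ closure V) →
    (∃ a b : Euc n × Euc n, ∀ t ∈ Icc (-1 : ℝ) 1,
      (gradY c U V (x t) (y 0), gradX c U V (x 0) (y t)) = a + t • b) →
    0 ≤ -iteratedDeriv 2 (fun s => iteratedDeriv 2 (fun t => c (x s) (y t)) 0) 0

/-! ### Bi-Lipschitz constants, Jacobian bound and the scale `ε_c` -/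

/-- `β⁺_c(U × V) = ‖D²_{xy} c‖_{L^∞(U × V)}`. -/
def betaPlus (c : Euc n → Euc n → ℝ) (U V : Set (Euc n)) : ℝ≥0∞ :=
  eLpNorm (fun p : Euc n × Euc n => mixedHess c p.1 p.2) ∞ (volume.restrict (U ×ˢ V))

/-- `β⁻_c(U × V) = ‖(D²_{xy} c)⁻¹‖_{L^∞(U × V)}`. -/
def betaMinus (c : Euc n → Euc n → ℝ) (U V : Set (Euc n)) : ℝ≥0∞ :=
  eLpNorm (fun p : Euc n × Euc n => (mixedHess c p.1 p.2).inverse) ∞ (volume.restrict (U ×ˢ V))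

/-- `γ⁺_c(Z × V) = ‖det D²_{xy} c‖_{L^∞(Z × V)}`. -/
def gammaPlus (c : Euc n → Euc n → ℝ) (Z V : Set (Euc n)) : ℝ≥0∞ :=
  eLpNorm (fun p : Euc n × Euc n => (mixedHess c p.1 p.2).det) ∞ (volume.restrict (Z ×ˢ V))

/-- `ε_c`, where `ε_c⁻¹ = 2 (β⁺_c)⁴ (β⁻_c)⁶ ‖D³_{xxy} c‖_{L^∞(U × V)}`; it is `∞` if the third
derivative vanishes. -/
def epsCost (c : Euc n → Euc n → ℝ) (U V : Set (Euc n)) : ℝ≥0∞ :=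
  (2 * betaPlus c U V ^ 4 * betaMinus c U V ^ 6 *
    eLpNorm (fun p : Euc n × Euc n => thirdXXY c p.1 p.2) ∞ (volume.restrict (U ×ˢ V)))⁻¹

/-! ### Cost-exponential coordinates and the modified cost -/

/-- The inverse `q ↦ x(q)` of the coordinate change `x ↦ q = -D_y c(x, y₀)` on the closure
of `U`. -/
def expInv (c : Euc n → Euc n → ℝ) (U V : Set (Euc n)) (y₀ q : Euc n) : Euc n :=
  Function.invFunOn (fun x => -gradY c U V x y₀) (closure U) q

/-- The modified cost at `y₀`: `c̃(q, y) = c(x(q), y) - c(x(q), y₀)`. -/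
def modCost (c : Euc n → Euc n → ℝ) (U V : Set (Euc n)) (y₀ q y : Euc n) : ℝ :=
  c (expInv c U V y₀ q) y - c (expInv c U V y₀ q) y₀

/-! ### `c`-convexity and the `c`-Monge-Ampère measure, for a cost on `X × Y` -/

/-- The transform `u^{c*}(y) = sup_{x ∈ X} -c(x,y) - u(x)`. -/
def cStar (c : Euc n → Euc n → ℝ) (X : Set (Euc n)) (u : Euc n → ℝ) (y : Euc n) : ℝ :=
  sSup ((fun x => -c x y - u x) '' X)

/-- `u : X → ℝ` is `c`-convex: `u = u^{c* c}` on `X`, i.e. `u(x) = sup_{y ∈ Y} -c(x,y) - u^{c*}(y)`,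
all suprema being finite. -/
def IsCConvex (c : Euc n → Euc n → ℝ) (X Y : Set (Euc n)) (u : Euc n → ℝ) : Prop :=
  (∀ y ∈ Y, BddAbove ((fun x => -c x y - u x) '' X)) ∧
  ∀ x ∈ X, IsLUB ((fun y => -c x y - cStar c X u y) '' Y) (u x)

/-- The image `∂^c u(A)` of `A` under the `c`-subdifferential
`∂^c u = {(x,y) ∈ X × Y | u(x) + u^{c*}(y) + c(x,y) = 0}`. -/
def cSubdiffImage (c : Euc n → Euc n → ℝ) (X Y : Set (Euc n)) (u : Euc n → ℝ)
    (A : Set (Euc n)) : Set (Euc n) :=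
  {y | y ∈ Y ∧ ∃ x ∈ A, x ∈ X ∧ u x + cStar c X u y + c x y = 0}

/-- The `c`-Monge-Ampère measure `|∂^c u|(A) = Leb(∂^c u(A))`. -/
def cMongeAmpere (c : Euc n → Euc n → ℝ) (X Y : Set (Euc n)) (u : Euc n → ℝ)
    (A : Set (Euc n)) : ℝ≥0∞ :=
  volume (cSubdiffImage c X Y u A)

/-! ### Hyperplanes and chords -/

/-- The hyperplane `{q | ⟨ν, q⟩ = a}`; `ν` will be a unit vector. -/
def hyperplane (ν : Euc n) (a : ℝ) : Set (Euc n) := {q | inner ℝ ν q = a}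

/-- `{⟨ν, ·⟩ = a}` and `{⟨ν, ·⟩ = b}` support `Z` from two opposite sides: both meet `Z`, and `Z`
lies between them. -/
def SupportFromOppositeSides (ν : Euc n) (a b : ℝ) (Z : Set (Euc n)) : Prop :=
  (hyperplane ν a ∩ Z).Nonempty ∧ (hyperplane ν b ∩ Z).Nonempty ∧
    ∀ q ∈ Z, b ≤ inner ℝ ν q ∧ inner ℝ ν q ≤ a

/-- The maximal length among the segments obtained by intersecting (the convex set) `Z` with a
line of direction `ν`, i.e. orthogonal to the hyperplanes `{⟨ν, ·⟩ = a}`. -/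
def maxChord (ν : Euc n) (Z : Set (Euc n)) : ℝ≥0∞ :=
  ⨆ p : Euc n, Metric.ediam (Z ∩ range (fun t : ℝ => p + t • ν))

end OptTransport

end

/-! Write P(q,y) = -D_q c̃(q,y), and call -c̃(·,y) plus a constant a mountain with focus y.
Everything convex in the argument comes from one consequence of (B3), `cross_difference_le`: the
cross-difference of c is at most its value for the bilinear cost with the same mixed derivative at
the base point. Based at (x, ỹ), it says that mountains are convex in q and lie above their tangents
P(q,y). Based at (x, y), it says that if P(q,y) is a convex combination of P(q,y₁) and P(q,y₂), then
the mountain with focus y, normalised to vanish at q, lies below the same combination of the other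
two. These facts are isolated in `CrossConvexCost`. They give Loeper's principle
`exists_supports_of_subgradient`: a local subgradient of ũ is the gradient of a mountain supporting
ũ globally.

Put δ = |ũ(q̃)|/2 and Z_δ = {ũ ≤ -δ}, which lies in the interior of Z when δ > 0. Let A be the set
of foci whose mountain of height -2δ at q̃ stays below -δ on Z_δ. Such a mountain can be slid until
it supports ũ at a point of Z_δ (`exists_supports_of_cone`), so A lies in the subdifferential image
of Z. Moreover P(q̃,A) is convex, and its volume is at most γ⁺ times that of A. To bound this volume
from below, maximise ⟨b,·⟩ over Z_δ for a unit vector b. At the maximiser q_b, a Lagrange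
multiplier, Loeper's principle and the intermediate value theorem give y in A with P(q_b,y) = l b
and δ ≤ l⟨b, q_b - q̃⟩ (`exists_cone_mountain`). The smallness of diam Z serves only to move these
gradients from q_b to q̃: by the relative Lipschitz bound `norm_coordGrad_sub_le`, P(q̃,y) is within
ρl of l b. For an orthonormal frame bᵢ the vectors P(q̃,yᵢ) therefore have determinant at least ∏ lᵢ
/ 2.

The frame is built greedily from Z - Z, starting with the normal ν of the hyperplanes, so that n⁻ⁿ s
∏_{i≠0} wᵢ ≤ |Z|, where s is the length of a chord parallel to ν and wᵢ bounds ⟨bᵢ, q - q̃⟩ on Z.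
Multiplying the inequalities δ ≤ lᵢ⟨bᵢ, qᵢ - q̃⟩, with the distance to the hyperplane as the bound
in direction ν, and comparing with the two volumes gives the estimate for each chord. The longest
chord follows by taking a supremum. -/

namespace OptTransport

variable {n : ℕ}

/-! ### Frames adapted to a convex body, and volumes of parallelotopes -/

/-- Each frame vector is selected in terms of all the earlier ones. Well-founded recursion turns
such a selection rule into a single function. -/
theorem exists_of_forall_initial {ι α : Type*} [LT ι] [WellFoundedLT ι]
    (R : ∀ i : ι, (∀ j, j < i → α) → α → Prop) (h : ∀ i p, ∃ a, R i p a) :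
    ∃ f : ι → α, ∀ i, R i (fun j _ => f j) (f i) := by
  choose F hF using h
  have wf : WellFounded (fun a b : ι => a < b) := wellFounded_lt
  refine ⟨wf.fix F, fun i => ?_⟩
  have := hF i (fun j _ => wf.fix F j)
  rwa [← wf.fix_eq F i] at this

/-- One greedy step. Take v in S with the longest projection onto W and let b be that projection,
normalised. Cauchy–Schwarz makes v a maximiser of ⟨b,·⟩. Vectors of W see only the projection of v,
a multiple of b, whence the orthogonality clause. -/
theorem exists_unit_maximizer {E : Type*} [NormedAddCommGroup E] [InnerProductSpace ℝ E]
    [FiniteDimensional ℝ E] {S : Set E} (hS : IsCompact S) (h0 : (0 : E) ∈ interior S)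
    (W : Submodule ℝ E) (hW : W ≠ ⊥) :
    ∃ b ∈ W, ∃ v ∈ S, ‖b‖ = 1 ∧ (∀ z ∈ S, inner ℝ b z ≤ inner ℝ b v) ∧
      ∀ w ∈ W, inner ℝ b w = 0 → inner ℝ w v = 0 := by
  have hsub : ∀ w ∈ W, ∀ z, inner ℝ w z = inner ℝ w (W.starProjection z) := by
    intro w hw z
    rw [← Submodule.inner_starProjection_left_eq_right, Submodule.starProjection_eq_self_iff.2 hw]
  obtain ⟨v, hvS, hv⟩ := hS.exists_isMaxOn ⟨0, interior_subset h0⟩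
    (f := fun z => ‖W.starProjection z‖) (by fun_prop)
  have hpos : 0 < ‖W.starProjection v‖ := by
    obtain ⟨w, hw, hw0⟩ := Submodule.exists_mem_ne_zero_of_ne_bot hW
    have : ∀ᶠ t : ℝ in 𝓝[>] 0, t • w ∈ S := by
      have h1 : Tendsto (fun t : ℝ => t • w) (𝓝 0) (𝓝 0) := by
        have : Continuous (fun t : ℝ => t • w) := by fun_prop
        simpa using this.tendsto 0
      exact (h1.mono_left nhdsWithin_le_nhds).eventually (mem_interior_iff_mem_nhds.1 h0)
    obtain ⟨t, ht, ht0⟩ := (this.and self_mem_nhdsWithin).exists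
    refine lt_of_lt_of_le ?_ (hv ht)
    simp only [map_smul, Submodule.starProjection_eq_self_iff.2 hw, norm_smul]
    have : (0:ℝ) < t := ht0
    exact mul_pos (norm_pos_iff.2 this.ne') (norm_pos_iff.2 hw0)
  refine ⟨‖W.starProjection v‖⁻¹ • W.starProjection v,
    W.smul_mem _ (Submodule.starProjection_apply_mem _ _), v, hvS, ?_, ?_, ?_⟩
  · rw [norm_smul, norm_inv, norm_norm, inv_mul_cancel₀ hpos.ne']
  · intro z hz
    rw [real_inner_smul_left, real_inner_smul_left]
    refine mul_le_mul_of_nonneg_left ?_ (by positivity)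
    rw [hsub _ (Submodule.starProjection_apply_mem _ _) z,
      hsub _ (Submodule.starProjection_apply_mem _ _) v, real_inner_self_eq_norm_mul_norm]
    exact (real_inner_le_norm _ _).trans (mul_le_mul_of_nonneg_left (hv hz) (norm_nonneg _))
  · intro w hw h
    rw [real_inner_smul_left] at h
    rw [hsub w hw, real_inner_comm]
    rcases mul_eq_zero.1 h with h | h
    · exact absurd h (inv_ne_zero hpos.ne')
    · exact h

/-- The first direction ν is imposed (v 0 need not lie in S); every later b i is the greedy choice
in the complement of its predecessors. The triangular pattern makes the determinant of v a product
of widths, so no inscribed ellipsoid is needed. -/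
theorem exists_adapted_frame [NeZero n] {S : Set (Euc n)} (hS : IsCompact S)
    (h0 : (0 : Euc n) ∈ interior S) {ν : Euc n} (hν : ‖ν‖ = 1) :
    ∃ (b : OrthonormalBasis (Fin n) ℝ (Euc n)) (v : Fin n → Euc n), b 0 = ν ∧ v 0 = ν ∧
      (∀ i, i ≠ 0 → v i ∈ S ∧ ∀ z ∈ S, inner ℝ (b i) z ≤ inner ℝ (b i) (v i)) ∧
      ∀ i j, i < j → inner ℝ (b j) (v i) = 0 := by
  obtain ⟨f, hf⟩ := exists_of_forall_initial (ι := Fin n) (α := Euc n × Euc n)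
    (fun i prev a => (i = 0 → a.1 = ν ∧ a.2 = ν) ∧ ‖a.1‖ = 1 ∧
      (∀ j (h : j < i), inner ℝ (prev j h).1 a.1 = 0) ∧
      (∀ w, (∀ j (h : j < i), inner ℝ (prev j h).1 w = 0) → inner ℝ a.1 w = 0 →
        inner ℝ w a.2 = 0) ∧
      (i ≠ 0 → a.2 ∈ S ∧ ∀ z ∈ S, inner ℝ a.1 z ≤ inner ℝ a.1 a.2)) (by
    intro i prev
    by_cases hi : i = 0
    · subst hi
      refine ⟨(ν, ν), by simp, hν, ?_, ?_, by simp⟩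
      · intro j hj; exact absurd hj (by simp)
      · intro w _ h; rwa [real_inner_comm]
    · set W : Submodule ℝ (Euc n) :=
        (Submodule.span ℝ (range fun j : Iio i => (prev j.1 j.2).1))ᗮ with hWdef
      have hWmem : ∀ w, w ∈ W ↔ ∀ j (h : j < i), inner ℝ (prev j h).1 w = 0 := by
        intro w
        rw [hWdef, Submodule.mem_orthogonal]
        constructor
        · intro h j hj
          exact h _ (Submodule.subset_span ⟨⟨j, hj⟩, rfl⟩)
        · intro h u hu
          induction hu using Submodule.span_induction with
          | mem x hx => obtain ⟨⟨j, hj⟩, rfl⟩ := hx; exact h j hj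
          | zero => simp
          | add x y _ _ hx hy => rw [inner_add_left, hx, hy, add_zero]
          | smul a x _ hx => rw [inner_smul_left, hx, mul_zero]
      -- Fewer than n previous vectors cannot span.
      have hW : W ≠ ⊥ := by
        rw [hWdef]
        intro h
        rw [Submodule.orthogonal_eq_bot_iff] at h
        have h1 := finrank_range_le_card (R := ℝ) (fun j : Iio i => (prev j.1 j.2).1)
        rw [Set.finrank, h] at h1
        simp at h1
        have := i.2
        omega
      obtain ⟨b, hb, v, hv, hb1, hmax, horth⟩ := exists_unit_maximizer hS h0 W hW
      exact ⟨(b, v), fun h => absurd h hi, hb1, (hWmem b).1 hb,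
        fun w hw h => horth w ((hWmem w).2 hw) h, fun _ => ⟨hv, hmax⟩⟩)
  have hlt : ∀ i j, i < j → inner ℝ (f i).1 (f j).1 = 0 := fun i j h => (hf j).2.2.1 i h
  have hon : Orthonormal ℝ (fun i => (f i).1) := by
    refine ⟨fun i => (hf i).2.1, fun i j hij => ?_⟩
    rcases lt_or_gt_of_ne hij with h | h
    · exact hlt i j h
    · rw [real_inner_comm]; exact hlt j i h
  have hspan : ⊤ ≤ Submodule.span ℝ (range fun i => (f i).1) := by
    rw [hon.linearIndependent.span_eq_top_of_card_eq_finrank' (by simp)]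
  refine ⟨OrthonormalBasis.mk hon hspan, fun i => (f i).2, ?_, ((hf 0).1 rfl).2, ?_, ?_⟩
  · simpa using ((hf 0).1 rfl).1
  · intro i hi
    simpa using (hf i).2.2.2.2 hi
  · intro i j hij
    simp only [OrthonormalBasis.coe_mk]
    exact (hf i).2.2.2.1 _ (fun k hk => hlt k j (hk.trans hij)) (hlt i j hij)

theorem det_eq_prod_of_triangular (b : OrthonormalBasis (Fin n) ℝ (Euc n)) (v : Fin n → Euc n)
    (h : ∀ i j, i < j → inner ℝ (b j) (v i) = 0) :
    b.toBasis.det v = ∏ i, inner ℝ (b i) (v i) := by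
  rw [Module.Basis.det_apply, Matrix.det_of_isUpperTriangular]
  · simp [Module.Basis.toMatrix_apply, OrthonormalBasis.repr_apply_apply]
  · intro i j hij
    simpa [Module.Basis.toMatrix_apply, OrthonormalBasis.repr_apply_apply] using h j i hij

/-- A convex set containing segments with direction vectors `v i` has volume at least
`n⁻ⁿ |det v|`. -/
theorem ofReal_det_le_volume [NeZero n] (b : OrthonormalBasis (Fin n) ℝ (Euc n))
    {Z : Set (Euc n)} (hZ : Convex ℝ Z) (α β : Fin n → Euc n) (hα : ∀ i, α i ∈ Z)
    (hβ : ∀ i, β i ∈ Z) :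
    ENNReal.ofReal (((n : ℝ)⁻¹) ^ n * |b.toBasis.det (fun i => β i - α i)|) ≤ volume Z := by
  have hn : (0 : ℝ) < n := by exact_mod_cast Nat.pos_of_ne_zero (NeZero.ne n)
  set w : Fin n → Euc n := fun i => (n : ℝ)⁻¹ • (β i - α i) with hw
  have hdet : |b.toBasis.det w| = ((n : ℝ)⁻¹) ^ n * |b.toBasis.det (fun i => β i - α i)| := by
    have := b.toBasis.det.map_smul_univ (fun _ => (n : ℝ)⁻¹) (fun i => β i - α i)
    rw [hw, this, Finset.prod_const, Finset.card_univ, Fintype.card_fin, smul_eq_mul, abs_mul,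
      abs_of_nonneg (by positivity : 0 ≤ ((n : ℝ)⁻¹) ^ n)]
  rw [← hdet, ← Measure.addHaar_parallelepiped, b.addHaar_eq_volume]
  -- Translated by ∑ α i / n, the parallelepiped with edges (β i - α i)/n consists of averages of
  -- one point from each of the n segments, hence lies in Z. The segments need no common endpoint.
  rw [← measure_preimage_add volume (∑ i, (n : ℝ)⁻¹ • α i) Z]
  refine measure_mono ?_
  intro z hz
  rw [mem_parallelepiped_iff] at hz
  obtain ⟨t, ht, rfl⟩ := hz
  have ht0 := fun i => ht.1 i
  have ht1 := fun i => ht.2 i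
  simp only [Pi.zero_apply, Pi.one_apply] at ht0 ht1
  have : ∑ i, (n : ℝ)⁻¹ • α i + ∑ i, t i • w i
      = ∑ i, (n : ℝ)⁻¹ • ((1 - t i) • α i + t i • β i) := by
    rw [← Finset.sum_add_distrib]
    refine Finset.sum_congr rfl fun i _ => ?_
    rw [hw]; module
  change ∑ i, (n : ℝ)⁻¹ • α i + ∑ i, t i • w i ∈ Z
  rw [this]
  refine hZ.sum_mem (fun _ _ => by positivity) ?_ ?_
  · simp [hn.ne']
  · intro i _
    exact hZ (hα i) (hβ i) (by linarith [ht1 i]) (ht0 i) (by ring)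

/-- Continuity of the determinant at the identity. This ρ depends on n alone, and its inverse
becomes the constant C₀. -/
theorem exists_det_lower_bound (n : ℕ) :
    ∃ ρ : ℝ, 0 < ρ ∧ ∀ A : Matrix (Fin n) (Fin n) ℝ, (∀ i j, |A i j| ≤ ρ) →
      1 / 2 ≤ (1 + A).det := by
  have hc : Continuous fun A : Fin n → Fin n → ℝ =>
      (1 + Matrix.of A : Matrix (Fin n) (Fin n) ℝ).det := by
    refine Continuous.matrix_det ?_
    exact continuous_const.add continuous_id
  have h1 : ∀ᶠ A : Fin n → Fin n → ℝ in 𝓝 0,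
      1 / 2 < (1 + Matrix.of A : Matrix (Fin n) (Fin n) ℝ).det := by
    refine hc.continuousAt.eventually (lt_mem_nhds ?_)
    have : (1 + Matrix.of (0 : Fin n → Fin n → ℝ) : Matrix (Fin n) (Fin n) ℝ) = 1 := by
      ext i j; simp
    change _ < (1 + Matrix.of (0 : Fin n → Fin n → ℝ) : Matrix (Fin n) (Fin n) ℝ).det
    rw [this]; norm_num
  obtain ⟨ε, hε, h⟩ := Metric.eventually_nhds_iff.1 h1
  refine ⟨ε / 2, by positivity, fun A hA => ?_⟩
  refine (h (y := fun i j => A i j) ?_).le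
  rw [dist_zero_right]
  refine lt_of_le_of_lt ?_ (half_lt_self hε)
  refine (pi_norm_le_iff_of_nonneg (by positivity)).2 fun i => ?_
  exact (pi_norm_le_iff_of_nonneg (by positivity)).2 fun j => hA i j

/-- Dividing p i by l i turns the coordinate matrix into 1 + A with entries of A at most ρ. The
error being relative to each l i, the different l i need not be comparable. -/
theorem half_prod_le_det {ρ : ℝ} (hρ : ∀ A : Matrix (Fin n) (Fin n) ℝ, (∀ i j, |A i j| ≤ ρ) →
      1 / 2 ≤ (1 + A).det) (b : OrthonormalBasis (Fin n) ℝ (Euc n)) (p : Fin n → Euc n)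
    (l : Fin n → ℝ) (hl : ∀ i, 0 < l i) (h : ∀ i, ‖p i - l i • b i‖ ≤ ρ * l i) :
    (∏ i, l i) / 2 ≤ |b.toBasis.det p| := by
  set e : Fin n → Euc n := fun i => (l i)⁻¹ • (p i - l i • b i) with he
  have hp : p = fun i => l i • (b i + e i) := by
    funext i
    simp only [he]
    rw [smul_add, smul_smul, mul_inv_cancel₀ (hl i).ne', one_smul]
    abel
  have hmat : b.toBasis.det (fun i => b i + e i)
      = (1 + Matrix.of fun i j => inner ℝ (b i) (e j)).det := by
    rw [Module.Basis.det_apply]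
    congr 1
    ext i j
    simp [Module.Basis.toMatrix_apply, OrthonormalBasis.repr_apply_apply, Matrix.one_apply]
  have hdet : 1 / 2 ≤ b.toBasis.det (fun i => b i + e i) := by
    rw [hmat]
    refine hρ _ fun i j => ?_
    refine (abs_real_inner_le_norm (b i) (e j)).trans ?_
    rw [b.norm_eq_one, one_mul, he, norm_smul, norm_inv, Real.norm_of_nonneg (hl j).le,
      inv_mul_le_iff₀ (hl j), mul_comm]
    exact h j
  rw [hp, b.toBasis.det.map_smul_univ, smul_eq_mul, abs_mul,
    abs_of_pos (Finset.prod_pos fun i _ => hl i), div_eq_mul_one_div]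
  exact mul_le_mul_of_nonneg_left (hdet.trans (le_abs_self _))
    (Finset.prod_pos fun i _ => hl i).le

end OptTransport

namespace OptTransport

variable {n : ℕ}

/-! ### Costs with the convexity properties of a modified cost -/

/-- The properties of a modified cost `c` with base point `y₀`, on `closure W × Y`, on which the
Alexandrov estimate relies; `P q y` plays the role of `-D_q c(q, y)`. -/
structure CrossConvexCost (W Y : Set (Euc n)) (c : Euc n → Euc n → ℝ)
    (P : Euc n → Euc n → Euc n) (y₀ : Euc n) (K : ℝ) : Prop where
  isOpen_left : IsOpen W
  convex_left : Convex ℝ W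
  isBounded_left : Bornology.IsBounded W
  isCompact_right : IsCompact Y
  base_mem : y₀ ∈ Y
  continuousOn_cost : ContinuousOn (fun p : Euc n × Euc n => c p.1 p.2) (closure W ×ˢ Y)
  cost_base : ∀ q ∈ closure W, c q y₀ = 0
  continuousOn_grad : ContinuousOn (fun p : Euc n × Euc n => P p.1 p.2) (W ×ˢ Y)
  grad_base : ∀ q ∈ W, P q y₀ = 0
  injOn_grad : ∀ q ∈ W, InjOn (P q) Y
  convex_image : ∀ q ∈ W, Convex ℝ (P q '' Y)
  inner_grad_le : ∀ q ∈ W, ∀ q' ∈ W, ∀ y ∈ Y, inner ℝ (P q y) (q' - q) ≤ c q y - c q' y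
  exists_dual : ∀ q ∈ W, ∀ q' ∈ W, ∀ y ∈ Y, ∃ w, ∀ y' ∈ Y,
    inner ℝ w (P q y' - P q y) ≤ (c q y' - c q' y') - (c q y - c q' y)
  norm_grad_sub_le : ∀ q ∈ W, ∀ q' ∈ W, ∀ y ∈ Y,
    ‖P q y - P q' y‖ ≤ K * ‖q - q'‖ * ‖P q' y‖

/-- The function `q' ↦ u(q) + c(q,y) - c(q',y)` supports `u` from below on `X`. -/
def Supports (c : Euc n → Euc n → ℝ) (X : Set (Euc n)) (u : Euc n → ℝ) (q y : Euc n) : Prop :=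
  ∀ q' ∈ X, u q + c q y - c q' y ≤ u q'

theorem Supports.mem_cSubdiffImage {c : Euc n → Euc n → ℝ} {X Y A : Set (Euc n)}
    {u : Euc n → ℝ} {q y : Euc n} (h : Supports c X u q y) (hq : q ∈ X) (hA : q ∈ A)
    (hy : y ∈ Y) : y ∈ cSubdiffImage c X Y u A := by
  refine ⟨hy, q, hA, hq, ?_⟩
  have : cStar c X u y = -c q y - u q := by
    refine IsGreatest.csSup_eq ⟨mem_image_of_mem _ hq, ?_⟩
    rintro _ ⟨q', hq', rfl⟩
    have := h q' hq'
    simp only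
    linarith
  rw [this]; ring

namespace CrossConvexCost

variable {W Y : Set (Euc n)} {c : Euc n → Euc n → ℝ} {P : Euc n → Euc n → Euc n} {y₀ : Euc n}
  {K : ℝ} {u : Euc n → ℝ}

theorem continuousOn_left (H : CrossConvexCost W Y c P y₀ K) {y : Euc n} (hy : y ∈ Y) :
    ContinuousOn (fun q => c q y) (closure W) :=
  H.continuousOn_cost.comp (f := fun q => (q, y)) (by fun_prop) fun _ hq => ⟨hq, hy⟩

theorem continuousOn_right (H : CrossConvexCost W Y c P y₀ K) {q : Euc n} (hq : q ∈ closure W) :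
    ContinuousOn (fun y => c q y) Y :=
  H.continuousOn_cost.comp (f := fun y => (q, y)) (by fun_prop) fun _ hy => ⟨hq, hy⟩

theorem continuousOn_grad_right (H : CrossConvexCost W Y c P y₀ K) {q : Euc n} (hq : q ∈ W) :
    ContinuousOn (P q) Y :=
  H.continuousOn_grad.comp (f := fun y => (q, y)) (by fun_prop) fun _ hy => ⟨hq, hy⟩

/-- Average the inequalities `exists_dual` at y₁ and y₂ with weights a and b: the linear terms
cancel because P q y is the corresponding average. Boundary points q' follow by continuity. -/
theorem sub_le_of_grad_eq (H : CrossConvexCost W Y c P y₀ K) {q q' y y₁ y₂ : Euc n} {a b : ℝ}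
    (hq : q ∈ W) (hq' : q' ∈ closure W) (hy : y ∈ Y) (hy₁ : y₁ ∈ Y) (hy₂ : y₂ ∈ Y)
    (ha : 0 ≤ a) (hb : 0 ≤ b) (hab : a + b = 1) (h : P q y = a • P q y₁ + b • P q y₂) :
    c q y - c q' y ≤ a * (c q y₁ - c q' y₁) + b * (c q y₂ - c q' y₂) := by
  refine le_on_closure (s := W) (f := fun q' => c q y - c q' y)
    (g := fun q' => a * (c q y₁ - c q' y₁) + b * (c q y₂ - c q' y₂)) ?_ ?_ ?_ hq'
  · intro z hz
    obtain ⟨w, hw⟩ := H.exists_dual q hq z hz y hy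
    have h1 := mul_le_mul_of_nonneg_left (hw y₁ hy₁) ha
    have h2 := mul_le_mul_of_nonneg_left (hw y₂ hy₂) hb
    have h3 : a * inner ℝ w (P q y₁ - P q y) + b * inner ℝ w (P q y₂ - P q y) = 0 := by
      rw [← real_inner_smul_right, ← real_inner_smul_right, ← inner_add_right]
      have : a • (P q y₁ - P q y) + b • (P q y₂ - P q y) = 0 := by
        have : a • (P q y₁ - P q y) + b • (P q y₂ - P q y)
          = (a • P q y₁ + b • P q y₂) - (a + b) • P q y := by module
        rw [this, ← h, hab, one_smul, sub_self]
      rw [this, inner_zero_right]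
    have h4 : (a + b) * (c q y - c z y) = c q y - c z y := by rw [hab, one_mul]
    nlinarith
  · exact continuousOn_const.sub (H.continuousOn_left hy)
  · exact ((continuousOn_const.sub (H.continuousOn_left hy₁)).const_smul a).add
      ((continuousOn_const.sub (H.continuousOn_left hy₂)).const_smul b)

/-- `inner_grad_le` at the intermediate point is a subgradient inequality towards both endpoints. It
is averaged in W and extended to the closure by continuity. -/
theorem neg_cost_convexOn (H : CrossConvexCost W Y c P y₀ K) {y : Euc n} (hy : y ∈ Y) :
    ConvexOn ℝ (closure W) (fun q => -c q y) := by
  refine ⟨H.convex_left.closure, fun q₁ hq₁ q₂ hq₂ a b ha hb hab => ?_⟩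
  have hmem : (q₁, q₂) ∈ closure (W ×ˢ W) := by rw [closure_prod_eq]; exact ⟨hq₁, hq₂⟩
  refine le_on_closure (s := W ×ˢ W) (f := fun z : Euc n × Euc n => -c (a • z.1 + b • z.2) y)
    (g := fun z => a • (-c z.1 y) + b • (-c z.2 y)) ?_ ?_ ?_ hmem
  · rintro ⟨z₁, z₂⟩ ⟨h₁, h₂⟩
    have hz := H.convex_left h₁ h₂ ha hb hab
    have e1 := mul_le_mul_of_nonneg_left (H.inner_grad_le _ hz _ h₁ y hy) ha
    have e2 := mul_le_mul_of_nonneg_left (H.inner_grad_le _ hz _ h₂ y hy) hb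
    set z := a • z₁ + b • z₂ with hzdef
    have h3 : a * inner ℝ (P z y) (z₁ - z) + b * inner ℝ (P z y) (z₂ - z) = 0 := by
      rw [← real_inner_smul_right, ← real_inner_smul_right, ← inner_add_right]
      have : a • (z₁ - z) + b • (z₂ - z) = (a • z₁ + b • z₂) - (a + b) • z := by module
      rw [this, ← hzdef, hab, one_smul, sub_self, inner_zero_right]
    simp only [smul_eq_mul]
    have h4 : (a + b) * c z y = c z y := by rw [hab, one_mul]
    nlinarith
  · rw [closure_prod_eq]
    refine ((H.continuousOn_left hy).comp (f := fun z : Euc n × Euc n => a • z.1 + b • z.2)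
      (by fun_prop) ?_).neg
    rintro ⟨z₁, z₂⟩ ⟨h₁, h₂⟩
    exact H.convex_left.closure h₁ h₂ ha hb hab
  · rw [closure_prod_eq]
    have h1 : ContinuousOn (fun z : Euc n × Euc n => c z.1 y) (closure W ×ˢ closure W) :=
      (H.continuousOn_left hy).comp continuousOn_fst fun z hz => hz.1
    have h2 : ContinuousOn (fun z : Euc n × Euc n => c z.2 y) (closure W ×ˢ closure W) :=
      (H.continuousOn_left hy).comp continuousOn_snd fun z hz => hz.2
    exact (h1.neg.const_smul a).add (h2.neg.const_smul b)

theorem convexOn (H : CrossConvexCost W Y c P y₀ K) (hu : IsCConvex c (closure W) Y u) :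
    ConvexOn ℝ (closure W) u := by
  refine ⟨H.convex_left.closure, fun q₁ hq₁ q₂ hq₂ a b ha hb hab => ?_⟩
  refine (hu.2 _ (H.convex_left.closure hq₁ hq₂ ha hb hab)).2 ?_
  rintro _ ⟨y, hy, rfl⟩
  have h := (H.neg_cost_convexOn hy).2 hq₁ hq₂ ha hb hab
  have h1 := mul_le_mul_of_nonneg_left ((hu.2 q₁ hq₁).1 (mem_image_of_mem _ hy)) ha
  have h2 := mul_le_mul_of_nonneg_left ((hu.2 q₂ hq₂).1 (mem_image_of_mem _ hy)) hb
  simp only [smul_eq_mul] at h h1 h2 ⊢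
  have h4 : (a + b) * cStar c (closure W) u y = cStar c (closure W) u y := by rw [hab, one_mul]
  nlinarith

/-- Compactness of the set of foci: a limit of almost optimal foci is optimal. Continuity of the
cost up to the boundary covers q outside W as well. -/
theorem exists_supports (H : CrossConvexCost W Y c P y₀ K) (hu : IsCConvex c (closure W) Y u)
    {q : Euc n} (hq : q ∈ closure W) : ∃ y ∈ Y, Supports c (closure W) u q y := by
  have h1 : ∀ k : ℕ, ∃ y ∈ Y, u q - 1 / ((k : ℝ) + 1) < -c q y - cStar c (closure W) u y := by
    intro k
    have : u q - 1 / ((k : ℝ) + 1) < u q := by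
      have : (0 : ℝ) < 1 / ((k : ℝ) + 1) := by positivity
      linarith
    obtain ⟨_, ⟨y, hy, rfl⟩, h⟩ := (lt_isLUB_iff (hu.2 q hq)).1 this
    exact ⟨y, hy, h⟩
  choose y hy hlt using h1
  obtain ⟨z, hz, φ, hφ, hlim⟩ := H.isCompact_right.tendsto_subseq hy
  refine ⟨z, hz, fun q' hq' => ?_⟩
  have hle : ∀ k, u q - 1 / ((φ k : ℝ) + 1) + c q (y (φ k)) - c q' (y (φ k)) ≤ u q' := by
    intro k
    have h2 : -c q' (y (φ k)) - u q' ≤ cStar c (closure W) u (y (φ k)) :=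
      le_csSup (hu.1 _ (hy _)) (mem_image_of_mem _ hq')
    have := hlt (φ k)
    linarith
  have hcont : ∀ r ∈ closure W, Tendsto (fun k => c r (y (φ k))) atTop (𝓝 (c r z)) := by
    intro r hr
    exact (H.continuousOn_right hr z hz).tendsto.comp
      (tendsto_nhdsWithin_iff.2 ⟨hlim, Eventually.of_forall fun k => hy _⟩)
  have h0 : Tendsto (fun k => 1 / ((φ k : ℝ) + 1)) atTop (𝓝 0) :=
    tendsto_one_div_add_atTop_nhds_zero_nat.comp hφ.tendsto_atTop
  have := le_of_tendsto' (((tendsto_const_nhds.sub h0).add (hcont q hq)).sub (hcont q' hq')) hle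
  simpa using this

/-- Lower semicontinuity of u: a mountain supporting u at the limit point is continuous and bounds u
from below nearby. -/
theorem isClosed_sublevel (H : CrossConvexCost W Y c P y₀ K) (hu : IsCConvex c (closure W) Y u)
    (t : ℝ) : IsClosed {q ∈ closure W | u q ≤ t} := by
  refine IsSeqClosed.isClosed fun x q hx hlim => ?_
  have hq : q ∈ closure W := isClosed_closure.mem_of_tendsto hlim
    (Eventually.of_forall fun k => (hx k).1)
  refine ⟨hq, ?_⟩
  obtain ⟨y, hy, hs⟩ := H.exists_supports hu hq
  have hcont : Tendsto (fun k => c (x k) y) atTop (𝓝 (c q y)) :=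
    (H.continuousOn_left hy q hq).tendsto.comp
      (tendsto_nhdsWithin_iff.2 ⟨hlim, Eventually.of_forall fun k => (hx k).1⟩)
  have h1 : ∀ k, u q + c q y - c (x k) y ≤ t := fun k => (hs _ (hx k).1).trans (hx k).2
  simpa using le_of_tendsto' (tendsto_const_nhds.sub hcont) h1

theorem continuousOn (H : CrossConvexCost W Y c P y₀ K) (hu : IsCConvex c (closure W) Y u) :
    ContinuousOn u W :=
  ((H.convexOn hu).subset subset_closure H.convex_left).continuousOn H.isOpen_left

theorem supports_of_tendsto (H : CrossConvexCost W Y c P y₀ K)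
    (hu : IsCConvex c (closure W) Y u) {x y : ℕ → Euc n} {q z : Euc n} (hq : q ∈ W)
    (hx : ∀ k, x k ∈ W) (hy : ∀ k, y k ∈ Y) (hs : ∀ k, Supports c (closure W) u (x k) (y k))
    (hxq : Tendsto x atTop (𝓝 q)) (hyz : Tendsto y atTop (𝓝 z)) (hz : z ∈ Y) :
    Supports c (closure W) u q z := by
  intro q' hq'
  have h1 : Tendsto (fun k => c (x k) (y k)) atTop (𝓝 (c q z)) :=
    (H.continuousOn_cost (q, z) ⟨subset_closure hq, hz⟩).tendsto.comp
      (tendsto_nhdsWithin_iff.2 ⟨hxq.prodMk_nhds hyz,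
        Eventually.of_forall fun k => ⟨subset_closure (hx k), hy k⟩⟩)
  have h2 : Tendsto (fun k => c q' (y k)) atTop (𝓝 (c q' z)) :=
    (H.continuousOn_right hq' z hz).tendsto.comp
      (tendsto_nhdsWithin_iff.2 ⟨hyz, Eventually.of_forall hy⟩)
  have h3 : Tendsto (fun k => u (x k)) atTop (𝓝 (u q)) :=
    ((H.continuousOn hu).continuousAt (H.isOpen_left.mem_nhds hq)).tendsto.comp hxq
  exact le_of_tendsto' ((h3.add h1).sub h2) fun k => hs k q' hq'

/-- Loeper's maximum principle: a local subgradient of a `c`-convex function is the gradient of a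
supporting mountain. -/
theorem exists_supports_of_subgradient (H : CrossConvexCost W Y c P y₀ K)
    (hu : IsCConvex c (closure W) Y u) {q p : Euc n} (hq : q ∈ W)
    (hp : ∀ᶠ q' in 𝓝 q, u q + inner ℝ p (q' - q) ≤ u q') :
    ∃ y ∈ Y, Supports c (closure W) u q y ∧ P q y = p := by
  set A : Set (Euc n) := {y ∈ Y | Supports c (closure W) u q y} with hA
  have hAclosed : IsClosed A := by
    refine IsSeqClosed.isClosed fun y z hy hlim => ?_
    have hz : z ∈ Y := H.isCompact_right.isClosed.mem_of_tendsto hlim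
      (Eventually.of_forall fun k => (hy k).1)
    exact ⟨hz, H.supports_of_tendsto hu (x := fun _ => q) hq (fun _ => hq) (fun k => (hy k).1)
      (fun k => (hy k).2) tendsto_const_nhds hlim hz⟩
  have hAcomp : IsCompact A := H.isCompact_right.of_isClosed_subset hAclosed fun _ h => h.1
  have hKclosed : IsClosed (P q '' A) :=
    (hAcomp.image_of_continuousOn ((H.continuousOn_grad_right hq).mono fun _ h => h.1)).isClosed
  -- Here cross-curvature enters: the gradients of the mountains supporting u at q form a convex
  -- set.
  have hKconv : Convex ℝ (P q '' A) := by
    rintro _ ⟨y₁, hy₁, rfl⟩ _ ⟨y₂, hy₂, rfl⟩ a b ha hb hab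
    obtain ⟨y, hy, he⟩ := H.convex_image q hq (mem_image_of_mem _ hy₁.1)
      (mem_image_of_mem _ hy₂.1) ha hb hab
    refine ⟨y, ⟨hy, fun q' hq' => ?_⟩, he⟩
    have h1 := H.sub_le_of_grad_eq hq hq' hy hy₁.1 hy₂.1 ha hb hab he
    have h2 := mul_le_mul_of_nonneg_left (hy₁.2 q' hq') ha
    have h3 := mul_le_mul_of_nonneg_left (hy₂.2 q' hq') hb
    have h4 : (a + b) * (u q' - u q) = u q' - u q := by rw [hab, one_mul]
    nlinarith
  by_contra hne
  have hpK : p ∉ P q '' A := by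
    rintro ⟨y, hy, he⟩
    exact hne ⟨y, hy.1, hy.2, he⟩
  obtain ⟨f, r, hfp, hfK⟩ := geometric_hahn_banach_point_closed hKconv hKclosed hpK
  -- Along τ, p is strictly steeper than every gradient of a mountain supporting u at q. Yet
  -- mountains supporting u at points q + sτ have slope at least ⟨p,τ⟩ in direction τ, and as s
  -- tends to 0 their foci accumulate at one supporting u at q, a contradiction.
  set τ : Euc n := -(InnerProductSpace.toDual ℝ (Euc n)).symm f with hτ
  have hf : ∀ z, inner ℝ z τ = -f z := by
    intro z
    rw [hτ, inner_neg_right, real_inner_comm, InnerProductSpace.toDual_symm_apply]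
  set s : ℕ → ℝ := fun k => 1 / ((k : ℝ) + 1) with hs
  have hspos : ∀ k, 0 < s k := fun k => by positivity
  have hlim : Tendsto (fun k => q + s k • τ) atTop (𝓝 q) := by
    have : Tendsto s atTop (𝓝 0) := tendsto_one_div_add_atTop_nhds_zero_nat
    simpa using tendsto_const_nhds.add (this.smul_const τ)
  obtain ⟨N, hN⟩ := ((hlim.eventually hp).and
    (hlim.eventually (H.isOpen_left.mem_nhds hq))).exists_forall_of_atTop
  have hex : ∀ k, ∃ y ∈ Y, Supports c (closure W) u (q + s (k + N) • τ) y := fun k =>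
    H.exists_supports hu (subset_closure (hN (k + N) (by omega)).2)
  choose y hy hsup using hex
  obtain ⟨z, hz, φ, hφ, hlimy⟩ := H.isCompact_right.tendsto_subseq hy
  have hxlim : Tendsto (fun k => q + s (φ k + N) • τ) atTop (𝓝 q) :=
    hlim.comp ((tendsto_add_atTop_nat N).comp hφ.tendsto_atTop)
  have hzA : z ∈ A := ⟨hz, H.supports_of_tendsto hu (x := fun k => q + s (φ k + N) • τ)
    (y := fun k => y (φ k)) hq (fun k => (hN (φ k + N) (by omega)).2) (fun k => hy _)
    (fun k => hsup _) hxlim hlimy hz⟩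
  have hle : ∀ k, inner ℝ p τ ≤ inner ℝ (P (q + s (φ k + N) • τ) (y (φ k))) τ := by
    intro k
    set j := φ k + N
    have e1 := (hN j (by omega)).1
    have e2 := hsup (φ k) q (subset_closure hq)
    have e3 := H.inner_grad_le _ (hN j (by omega)).2 q hq (y (φ k)) (hy _)
    have e4 : q - (q + s j • τ) = -(s j • τ) := by abel
    rw [e4, inner_neg_right, real_inner_smul_right] at e3
    rw [add_sub_cancel_left, real_inner_smul_right] at e1
    refine le_of_mul_le_mul_left ?_ (hspos j)
    change u (q + s j • τ) + c (q + s j • τ) (y (φ k)) - c q (y (φ k)) ≤ u q at e2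
    linarith
  have hPlim : Tendsto (fun k => P (q + s (φ k + N) • τ) (y (φ k))) atTop (𝓝 (P q z)) :=
    (H.continuousOn_grad (q, z) ⟨hq, hz⟩).tendsto.comp
      (tendsto_nhdsWithin_iff.2 ⟨hxlim.prodMk_nhds hlimy,
        Eventually.of_forall fun k => ⟨(hN (φ k + N) (by omega)).2, hy _⟩⟩)
  have hfin : inner ℝ p τ ≤ inner ℝ (P q z) τ :=
    ge_of_tendsto' (hPlim.inner tendsto_const_nhds) hle
  rw [hf, hf] at hfin
  have := hfK _ (mem_image_of_mem _ hzA)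
  linarith

end CrossConvexCost

end OptTransport

/-! ### Lagrange multipliers and mountains in the cone over a sublevel set -/

namespace OptTransport

variable {n : ℕ}

theorem continuousOn_invFunOn_of_isCompact {X Y : Type*} [TopologicalSpace X]
    [TopologicalSpace Y] [T2Space Y] [Nonempty X] {K : Set X} {f : X → Y} (hK : IsCompact K)
    (hf : ContinuousOn f K) (hi : InjOn f K) :
    ContinuousOn (Function.invFunOn f K) (f '' K) := by
  rw [continuousOn_iff_isClosed]
  intro t ht
  refine ⟨f '' (K ∩ t), ((hK.inter_right ht).image_of_continuousOn
    (hf.mono inter_subset_left)).isClosed, ?_⟩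
  ext z
  constructor
  · rintro ⟨hz, x, hx, rfl⟩
    rw [mem_preimage, hi.leftInvOn_invFunOn hx] at hz
    exact ⟨⟨x, ⟨hx, hz⟩, rfl⟩, x, hx, rfl⟩
  · rintro ⟨⟨x, ⟨hx, hxt⟩, rfl⟩, _⟩
    exact ⟨by rwa [mem_preimage, hi.leftInvOn_invFunOn hx], x, hx, rfl⟩

/-- A Lagrange multiplier for a sublevel set of a convex function. -/
theorem exists_multiplier {W : Set (Euc n)} (hW : IsOpen W) {u : Euc n → ℝ}
    (hu : ConvexOn ℝ W u) {ν q₁ q₂ : Euc n} (hν : ‖ν‖ = 1) {t : ℝ} (hq₁ : q₁ ∈ W)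
    (hq₂ : q₂ ∈ W) (hlt : u q₂ < t)
    (hmax : ∀ q ∈ W, u q ≤ t → inner ℝ ν (q - q₁) ≤ 0) :
    ∃ l : ℝ, 0 < l ∧ ∀ q ∈ W, t + l * inner ℝ ν (q - q₁) ≤ u q := by
  have hcont := hu.continuousOn hW
  have hstep : ∀ q, Tendsto (fun s : ℝ => q + s • ν) (𝓝[>] 0) (𝓝 q) := by
    intro q
    have : Continuous (fun s : ℝ => q + s • ν) := by fun_prop
    simpa using (this.tendsto 0).mono_left nhdsWithin_le_nhds
  have hadd : ∀ (q : Euc n) (s : ℝ), inner ℝ ν (q + s • ν - q₁) = inner ℝ ν (q - q₁) + s := by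
    intro q s
    rw [add_sub_right_comm, inner_add_right, real_inner_smul_right,
      real_inner_self_eq_norm_sq, hν]
    ring
  -- A point of the hyperplane with u < t could be pushed slightly along ν without leaving the
  -- sublevel set, against maximality.
  have hzero : ∀ q ∈ W, inner ℝ ν (q - q₁) = 0 → t ≤ u q := by
    intro q hq h0
    by_contra hlt'
    push Not at hlt'
    have h1 := (hcont.continuousAt (hW.mem_nhds hq)).eventually (gt_mem_nhds hlt')
    obtain ⟨s, ⟨hs1, hs2⟩, hs⟩ := (((hstep q).eventually h1).and
      ((hstep q).eventually (hW.mem_nhds hq)) |>.and self_mem_nhdsWithin).exists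
    have := hmax _ hs2 hs1.le
    rw [hadd, h0] at this
    have hs0 : (0 : ℝ) < s := hs
    linarith
  have hq₂neg : inner ℝ ν (q₂ - q₁) < 0 := by
    refine lt_of_le_of_ne (hmax q₂ hq₂ hlt.le) fun h => ?_
    have := hzero q₂ hq₂ h
    linarith
  -- Slopes of u - t relative to ⟨ν, · - q₁⟩ on the two sides of the hyperplane. By convexity and
  -- `hzero` those in S do not exceed those in T, and any separating number is a multiplier. It is
  -- positive because q₂ contributes a positive slope to S.
  set S : Set ℝ := {s | ∃ q ∈ W, inner ℝ ν (q - q₁) < 0 ∧ s = (u q - t) / inner ℝ ν (q - q₁)}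
  set T : Set ℝ := {s | ∃ q ∈ W, 0 < inner ℝ ν (q - q₁) ∧ s = (u q - t) / inner ℝ ν (q - q₁)}
  have hT : T.Nonempty := by
    obtain ⟨s, hs1, hs⟩ := (((hstep q₁).eventually (hW.mem_nhds hq₁)).and
      self_mem_nhdsWithin).exists
    refine ⟨_, _, hs1, ?_, rfl⟩
    rw [hadd, sub_self, inner_zero_right, zero_add]
    exact hs
  obtain ⟨l, hlS, hlT⟩ := exists_between_of_forall_le (s := S) (t := T)
    ⟨_, q₂, hq₂, hq₂neg, rfl⟩ hT (by
      rintro _ ⟨a, ha, ha0, rfl⟩ _ ⟨b, hb, hb0, rfl⟩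
      set r := inner ℝ ν (a - q₁) with hr
      set r' := inner ℝ ν (b - q₁) with hr'
      have hd : 0 < r' - r := by linarith
      have hw1 : 0 ≤ r' / (r' - r) := by positivity
      have hw2 : 0 ≤ -r / (r' - r) := div_nonneg (by linarith) hd.le
      have h1 : r' / (r' - r) + -r / (r' - r) = 1 := by
        rw [← add_div, ← sub_eq_add_neg, div_self hd.ne']
      have hz := hu.1 ha hb hw1 hw2 h1
      have hz2 := hu.2 ha hb hw1 hw2 h1
      have h0 : inner ℝ ν ((r' / (r' - r)) • a + (-r / (r' - r)) • b - q₁) = 0 := by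
        have : (r' / (r' - r)) • a + (-r / (r' - r)) • b - q₁
            = (r' / (r' - r)) • (a - q₁) + (-r / (r' - r)) • (b - q₁) := by
          calc _ = (r' / (r' - r)) • a + (-r / (r' - r)) • b
                - (r' / (r' - r) + -r / (r' - r)) • q₁ := by rw [h1, one_smul]
            _ = _ := by module
        rw [this, inner_add_right, real_inner_smul_right, real_inner_smul_right, ← hr, ← hr']
        field_simp; ring
      have h2 := (hzero _ hz h0).trans hz2
      rw [smul_eq_mul, smul_eq_mul, div_mul_eq_mul_div, div_mul_eq_mul_div, ← add_div,
        le_div_iff₀ hd] at h2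
      rw [div_le_iff_of_neg ha0, div_mul_eq_mul_div, div_le_iff₀ hb0]
      nlinarith)
  refine ⟨l, ?_, fun q hq => ?_⟩
  · have h1 := hlS ⟨q₂, hq₂, hq₂neg, rfl⟩
    exact lt_of_lt_of_le (div_pos_of_neg_of_neg (by linarith) hq₂neg) h1
  · rcases lt_trichotomy (inner ℝ ν (q - q₁)) 0 with h | h | h
    · have h1 := hlS ⟨q, hq, h, rfl⟩
      rw [div_le_iff_of_neg h] at h1
      linarith
    · rw [h, mul_zero, add_zero]; exact hzero q hq h
    · have h1 := hlT ⟨q, hq, h, rfl⟩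
      rw [le_div_iff₀ h] at h1
      linarith

namespace CrossConvexCost

variable {W Y : Set (Euc n)} {c : Euc n → Euc n → ℝ} {P : Euc n → Euc n → Euc n} {y₀ : Euc n}
  {K : ℝ} {u : Euc n → ℝ}

/-- A mountain lying below `u` on the boundary of a sublevel set of `u`, and as low as `u` at an
inner point, can be slid down to a mountain supporting `u`. -/
theorem exists_supports_of_cone (H : CrossConvexCost W Y c P y₀ K)
    (hu : IsCConvex c (closure W) Y u) {δ : ℝ} (hδ : 0 < δ)
    (hsub : {q ∈ closure W | u q ≤ -δ} ⊆ W) (hcomp : IsCompact {q ∈ closure W | u q ≤ -δ})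
    {q₀ : Euc n} (hq₀ : q₀ ∈ W) (hq₀u : u q₀ = -(2 * δ)) {y : Euc n} (hy : y ∈ Y)
    (hcone : ∀ q ∈ closure W, u q ≤ -δ → c q₀ y - c q y ≤ δ) :
    ∃ q ∈ closure W, u q ≤ -δ ∧ Supports c (closure W) u q y := by
  set Z := {q ∈ closure W | u q ≤ -δ} with hZ
  have hq₀Z : q₀ ∈ Z := ⟨subset_closure hq₀, by rw [hq₀u]; linarith⟩
  have hcontu := H.continuousOn hu
  obtain ⟨x, hx, hmax⟩ := hcomp.exists_isMaxOn ⟨q₀, hq₀Z⟩ (f := fun q => -c q y - u q)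
    (((H.continuousOn_left hy).mono fun q hq => hq.1).neg.sub (hcontu.mono hsub))
  -- The maximum can be taken off the level set u = -δ: there the cone condition makes q₀ at least
  -- as good, and u q₀ = -2δ.
  obtain ⟨x, hx, hxlt, hmax⟩ : ∃ x ∈ Z, u x < -δ ∧ ∀ q ∈ Z, -c q y - u q ≤ -c x y - u x := by
    rcases hx.2.lt_or_eq with h | h
    · exact ⟨x, hx, h, fun q hq => hmax hq⟩
    · refine ⟨q₀, hq₀Z, by rw [hq₀u]; linarith, fun q hq => (hmax hq).trans ?_⟩
      have := hcone x hx.1 hx.2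
      simp only [h, hq₀u]
      linarith
  have hxW : x ∈ W := hsub hx
  have hloc : ∀ᶠ q in 𝓝 x, u x + inner ℝ (P x y) (q - x) ≤ u q := by
    filter_upwards [H.isOpen_left.mem_nhds hxW,
      (hcontu.continuousAt (H.isOpen_left.mem_nhds hxW)).eventually (gt_mem_nhds hxlt)]
      with q hq hqu
    have h1 := hmax q ⟨subset_closure hq, hqu.le⟩
    have h2 := H.inner_grad_le x hxW q hq y hy
    linarith
  -- So far the slid mountain supports u only near x. Loeper's principle supplies a global one with
  -- the same gradient at x, and injectivity of the gradient identifies its focus as y.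
  obtain ⟨y', hy', hs, he⟩ := H.exists_supports_of_subgradient hu hxW hloc
  have := H.injOn_grad x hxW hy' hy he
  exact ⟨x, hx.1, hx.2, this ▸ hs⟩

/-- For each direction `ν` there is a mountain in the cone over a sublevel set of `u` which touches
the base of the cone at a point where `ν` is maximal. -/
theorem exists_cone_mountain (H : CrossConvexCost W Y c P y₀ K)
    (hu : IsCConvex c (closure W) Y u) {δ : ℝ} (hδ : 0 < δ)
    (hsub : {q ∈ closure W | u q ≤ -δ} ⊆ W) (hcomp : IsCompact {q ∈ closure W | u q ≤ -δ})
    {q₀ : Euc n} (hq₀ : q₀ ∈ W) (hq₀u : u q₀ = -(2 * δ)) {ν : Euc n} (hν : ‖ν‖ = 1) :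
    ∃ q₁ ∈ W, u q₁ ≤ -δ ∧ ∃ y ∈ Y, ∃ l : ℝ, 0 < l ∧ δ ≤ l * inner ℝ ν (q₁ - q₀) ∧
      P q₁ y = l • ν ∧ ∀ q ∈ closure W, u q ≤ -δ → c q₀ y - c q y ≤ δ := by
  set Z := {q ∈ closure W | u q ≤ -δ} with hZ
  have hq₀Z : q₀ ∈ Z := ⟨subset_closure hq₀, by rw [hq₀u]; linarith⟩
  obtain ⟨q₁, hq₁, hmax⟩ := hcomp.exists_isMaxOn ⟨q₀, hq₀Z⟩ (f := fun q => inner ℝ ν q)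
    (by fun_prop)
  have hq₁W := hsub hq₁
  have hcontu := H.continuousOn hu
  have hconv := (H.convexOn hu).subset subset_closure H.convex_left
  have hmax' : ∀ q ∈ W, u q ≤ -δ → inner ℝ ν (q - q₁) ≤ 0 := by
    intro q hq hqu
    have : inner ℝ ν q ≤ inner ℝ ν q₁ := hmax (show q ∈ Z from ⟨subset_closure hq, hqu⟩)
    rw [inner_sub_right]; linarith
  obtain ⟨l, hl, hlu⟩ := exists_multiplier H.isOpen_left hconv hν hq₁W hq₀
    (t := -δ) (by rw [hq₀u]; linarith) hmax'
  have hq₁u : u q₁ = -δ := by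
    have := hlu q₁ hq₁W
    rw [sub_self, inner_zero_right, mul_zero, add_zero] at this
    exact le_antisymm hq₁.2 this
  obtain ⟨y₁, hy₁, hs, hP⟩ := H.exists_supports_of_subgradient hu hq₁W (p := l • ν) (by
    filter_upwards [H.isOpen_left.mem_nhds hq₁W] with q hq
    rw [hq₁u, real_inner_smul_left]
    exact hlu q hq)
  have hmem : ∀ t ∈ Icc (0 : ℝ) 1, t • (l • ν) ∈ P q₁ '' Y := by
    intro t ht
    have := H.convex_image q₁ hq₁W (mem_image_of_mem _ H.base_mem) (mem_image_of_mem _ hy₁)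
      (a := 1 - t) (b := t) (by linarith [ht.2]) ht.1 (by ring)
    rwa [H.grad_base q₁ hq₁W, smul_zero, zero_add, hP] at this
  set γ : ℝ → Euc n := fun t => Function.invFunOn (P q₁) Y (t • (l • ν)) with hγ
  -- Along γ the gradient at q₁ keeps the direction ν while its length grows from 0 to l. The drop
  -- of the mountain from q₁ to q₀ is 0 for the focus y₀ and at least δ for y₁, so it equals δ for
  -- some t in between.
  have hγY : ∀ t ∈ Icc (0 : ℝ) 1, γ t ∈ Y := fun t ht => Function.invFunOn_mem (hmem t ht)
  have hγP : ∀ t ∈ Icc (0 : ℝ) 1, P q₁ (γ t) = t • (l • ν) := fun t ht =>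
    Function.invFunOn_eq (hmem t ht)
  have hγc : ContinuousOn γ (Icc 0 1) :=
    (continuousOn_invFunOn_of_isCompact H.isCompact_right (H.continuousOn_grad_right hq₁W)
      (H.injOn_grad q₁ hq₁W)).comp (f := fun t : ℝ => t • (l • ν)) (by fun_prop) hmem
  have h01 : (0 : ℝ) ∈ Icc (0 : ℝ) 1 := ⟨le_rfl, zero_le_one⟩
  have h11 : (1 : ℝ) ∈ Icc (0 : ℝ) 1 := ⟨zero_le_one, le_rfl⟩
  have hγ0 : γ 0 = y₀ := H.injOn_grad q₁ hq₁W (hγY 0 h01) H.base_mem (by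
    rw [hγP 0 h01, H.grad_base q₁ hq₁W, zero_smul])
  have hγ1 : γ 1 = y₁ := H.injOn_grad q₁ hq₁W (hγY 1 h11) hy₁ (by
    rw [hγP 1 h11, hP, one_smul])
  obtain ⟨t, ht, hteq⟩ : -δ ∈ (fun t => c q₁ (γ t) - c q₀ (γ t)) '' Icc 0 1 := by
    refine intermediate_value_Icc' zero_le_one
      (((H.continuousOn_right hq₁.1).comp hγc hγY).sub
        ((H.continuousOn_right (subset_closure hq₀)).comp hγc hγY)) ⟨?_, ?_⟩
    · have := hs q₀ (subset_closure hq₀)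
      change c q₁ (γ 1) - c q₀ (γ 1) ≤ -δ
      rw [hγ1]
      rw [hq₁u, hq₀u] at this
      linarith
    · change -δ ≤ c q₁ (γ 0) - c q₀ (γ 0)
      rw [hγ0, H.cost_base _ hq₁.1, H.cost_base _ (subset_closure hq₀)]
      linarith
  simp only at hteq
  have hgrad := H.inner_grad_le q₁ hq₁W q₀ hq₀ (γ t) (hγY t ht)
  rw [hγP t ht, hteq, real_inner_smul_left, real_inner_smul_left, ← neg_sub q₁ q₀,
    inner_neg_right] at hgrad
  have hδle : δ ≤ t * l * inner ℝ ν (q₁ - q₀) := by linarith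
  refine ⟨q₁, hq₁W, hq₁.2, γ t, hγY t ht, t * l, ?_, hδle, by rw [hγP t ht, smul_smul], ?_⟩
  · refine lt_of_le_of_ne (mul_nonneg ht.1 hl.le) fun h => ?_
    rw [← h, zero_mul] at hδle
    linarith
  · intro q hq hqu
    -- Normalised at q₁, the new mountain is at most t times that of y₁, hence nonpositive on the
    -- sublevel set: it is nowhere higher there than at q₁, which is δ above its value at q₀.
    have h1 := H.sub_le_of_grad_eq hq₁W hq (hγY t ht) H.base_mem hy₁ (a := 1 - t) (b := t)
      (by linarith [ht.2]) ht.1 (by ring)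
      (by rw [hγP t ht, H.grad_base q₁ hq₁W, smul_zero, zero_add, hP])
    rw [H.cost_base _ hq₁.1, H.cost_base _ hq] at h1
    have h2 := hs q hq
    have h3 : c q₁ y₁ - c q y₁ ≤ 0 := by linarith
    have h4 := mul_nonneg ht.1 (neg_nonneg.2 h3)
    linarith

end CrossConvexCost

end OptTransport

/-! ### The Alexandrov estimate for a cross-convex cost -/

namespace OptTransport

variable {n : ℕ}

open scoped Pointwise in
/-- The volume of `Z` bounds from above the product of the length of a
chord of direction `ν` with the widths of `Z` in the other directions of a suitable frame. -/
theorem exists_frame_width_le_volume [NeZero n] {Z : Set (Euc n)} (hZ : IsCompact Z)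
    (hconv : Convex ℝ Z) {q₀ : Euc n} (hq₀ : q₀ ∈ interior Z) {ν α β : Euc n} {s : ℝ}
    (hν : ‖ν‖ = 1) (hα : α ∈ Z) (hβ : β ∈ Z) (hs : 0 < s) (hαβ : β - α = s • ν) :
    ∃ (b : OrthonormalBasis (Fin n) ℝ (Euc n)) (w : Fin n → ℝ), b 0 = ν ∧ w 0 = s ∧
      (∀ i, i ≠ 0 → ∀ q ∈ Z, inner ℝ (b i) (q - q₀) ≤ w i) ∧ (∀ i, 0 ≤ w i) ∧
      ENNReal.ofReal (((n : ℝ)⁻¹) ^ n * ∏ i, w i) ≤ volume Z := by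
  have hq₀Z := interior_subset hq₀
  have h0 : (0 : Euc n) ∈ interior (Z - Z) := by
    rw [mem_interior_iff_mem_nhds]
    have h1 : Tendsto (fun z : Euc n => z + q₀) (𝓝 0) (𝓝 q₀) := by
      have : Continuous (fun z : Euc n => z + q₀) := by fun_prop
      simpa using this.tendsto 0
    filter_upwards [h1.eventually (mem_interior_iff_mem_nhds.1 hq₀)] with z hz
    exact ⟨z + q₀, hz, q₀, hq₀Z, by simp⟩
  have hcomp : IsCompact (Z - Z) := by
    rw [← Set.sub_image_prod]
    exact (hZ.prod hZ).image continuous_sub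
  obtain ⟨b, v, hb0, hv0, hv, htri⟩ := exists_adapted_frame hcomp h0 hν
  -- In slot 0 the given chord s • ν replaces the auxiliary vector ν. Being parallel to it, the
  -- chord preserves the triangular pattern.
  have hex : ∀ i, ∃ α' ∈ Z, ∃ β' ∈ Z, β' - α' = if i = 0 then s • ν else v i := by
    intro i
    by_cases hi : i = 0
    · exact ⟨α, hα, β, hβ, by simp [hi, hαβ]⟩
    · obtain ⟨β', hβ', α', hα', h⟩ := (hv i hi).1
      exact ⟨α', hα', β', hβ', by simpa [hi] using h⟩
  choose α' hα' β' hβ' hv' using hex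
  have htri' : ∀ i j, i < j → inner ℝ (b j) (β' i - α' i) = 0 := by
    intro i j hij
    rw [hv']
    split_ifs with hi
    · rw [real_inner_smul_right, ← hv0, ← hi, htri i j hij, mul_zero]
    · exact htri i j hij
  have hw0 : inner ℝ (b 0) (β' 0 - α' 0) = s := by
    rw [hv', if_pos rfl, hb0, real_inner_smul_right, real_inner_self_eq_norm_sq, hν]; ring
  have hwi : ∀ i, i ≠ 0 → ∀ q ∈ Z, inner ℝ (b i) (q - q₀) ≤ inner ℝ (b i) (β' i - α' i) := by
    intro i hi q hq
    rw [hv', if_neg hi]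
    exact (hv i hi).2 _ ⟨q, hq, q₀, hq₀Z, rfl⟩
  have hnn : ∀ i, 0 ≤ inner ℝ (b i) (β' i - α' i) := by
    intro i
    by_cases hi : i = 0
    · subst hi; rw [hw0]; exact hs.le
    · simpa using hwi i hi q₀ hq₀Z
  refine ⟨b, fun i => inner ℝ (b i) (β' i - α' i), hb0, hw0, hwi, hnn, ?_⟩
  have := ofReal_det_le_volume b hconv α' β' hα' hβ'
  rwa [det_eq_prod_of_triangular b _ htri', abs_of_nonneg (Finset.prod_nonneg fun i _ => hnn i)]
    at this

/-- The chord length s is the width of Z in slot 0, while d bounds the displacement of the cone's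
contact point in the same slot; this is the origin of the quotient d/s. In the constant, 2ⁿ comes
from halving the height, another 2 from the perturbed determinant, and n²ⁿ from the two
parallelepiped bounds. -/
theorem CrossConvexCost.alexandrov_estimate [NeZero n] {ρ : ℝ}
    (hρ : ∀ A : Matrix (Fin n) (Fin n) ℝ, (∀ i j, |A i j| ≤ ρ) → 1 / 2 ≤ (1 + A).det)
    {W Y : Set (Euc n)} {c : Euc n → Euc n → ℝ} {P : Euc n → Euc n → Euc n} {y₀ : Euc n}
    {K : ℝ} {u : Euc n → ℝ} (H : CrossConvexCost W Y c P y₀ K)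
    (hu : IsCConvex c (closure W) Y u) {Z : Set (Euc n)}
    (hZ : Z = {q ∈ closure W | u q ≤ 0}) (hfr : ∀ q ∈ frontier Z, u q = 0) {q₀ : Euc n}
    (hq₀ : q₀ ∈ interior Z) (hdiam : ∀ q ∈ Z, ∀ q' ∈ Z, K * ‖q - q'‖ ≤ ρ) {Γ : ℝ≥0∞}
    (hΓ : ∀ S ⊆ Y, IsClosed S → volume (P q₀ '' S) ≤ Γ * volume S) {ν α β : Euc n} {s d : ℝ}
    (hν : ‖ν‖ = 1) (hα : α ∈ Z) (hβ : β ∈ Z) (hs : 0 < s) (hαβ : β - α = s • ν)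
    (hd : ∀ q ∈ Z, inner ℝ ν (q - q₀) ≤ d) :
    ENNReal.ofReal (|u q₀| ^ n * s) ≤ ENNReal.ofReal (2 ^ (n + 1) * (n : ℝ) ^ (2 * n)) * Γ *
      ENNReal.ofReal d * cMongeAmpere c (closure W) Y u Z * volume Z := by
  have hn : (0 : ℝ) < n := by exact_mod_cast Nat.pos_of_ne_zero (NeZero.ne n)
  have hq₀Z : q₀ ∈ Z := interior_subset hq₀
  have hZcl : IsClosed Z := by rw [hZ]; exact H.isClosed_sublevel hu 0
  have hZsub : Z ⊆ closure W := by rw [hZ]; exact fun q hq => hq.1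
  have hu0 : u q₀ ≤ 0 := by rw [hZ] at hq₀Z; exact hq₀Z.2
  rcases hu0.eq_or_lt with hu0 | hu0
  · simp [hu0, NeZero.ne n]
  have hZint : interior Z ⊆ W := by
    have hne : (interior W).Nonempty := by
      rw [H.isOpen_left.interior_eq]
      exact closure_nonempty_iff.1 ⟨q₀, hZsub hq₀Z⟩
    refine (interior_mono hZsub).trans ?_
    rw [H.convex_left.interior_closure_eq_interior_of_nonempty_interior hne]
    exact interior_subset
  have hclW : IsCompact (closure W) := H.isBounded_left.isCompact_closure
  have hZcomp : IsCompact Z := hclW.of_isClosed_subset hZcl hZsub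
  have hZconv : Convex ℝ Z := by rw [hZ]; exact (H.convexOn hu).convex_le 0
  set δ := -u q₀ / 2 with hδdef
  have hδ : 0 < δ := by rw [hδdef]; linarith
  have hq₀u : u q₀ = -(2 * δ) := by rw [hδdef]; ring
  have hZδ : ∀ q ∈ closure W, u q ≤ -δ → q ∈ Z := fun q hq h => by
    rw [hZ]; exact ⟨hq, by linarith⟩
  -- Since u vanishes on the frontier of Z, this sublevel set is contained in the interior of Z.
  have hsub : {q ∈ closure W | u q ≤ -δ} ⊆ W := by
    rintro q ⟨hq, hqu⟩
    refine hZint ?_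
    by_contra hni
    have := hfr q ⟨subset_closure (hZδ q hq hqu), hni⟩
    linarith
  have hcomp : IsCompact {q ∈ closure W | u q ≤ -δ} :=
    hclW.of_isClosed_subset (H.isClosed_sublevel hu _) fun q hq => hq.1
  have hq₀W := hZint hq₀
  obtain ⟨b, w, hb0, hw0, hw, hwnn, hvolZ⟩ :=
    exists_frame_width_le_volume hZcomp hZconv hq₀ hν hα hβ hs hαβ
  choose q hqW hqu y hy l hl hlδ hP hcone using fun i =>
    H.exists_cone_mountain hu hδ hsub hcomp hq₀W hq₀u (b.norm_eq_one i)
  set A : Set (Euc n) := {y ∈ Y | ∀ q ∈ closure W, u q ≤ -δ → c q₀ y - c q y ≤ δ} with hA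
  have hAclosed : IsClosed A := by
    refine IsSeqClosed.isClosed fun x z hx hlim => ?_
    have hz : z ∈ Y := H.isCompact_right.isClosed.mem_of_tendsto hlim
      (Eventually.of_forall fun k => (hx k).1)
    refine ⟨hz, fun q hq hqu => ?_⟩
    have hc : ∀ r ∈ closure W, Tendsto (fun k => c r (x k)) atTop (𝓝 (c r z)) := fun r hr =>
      (H.continuousOn_right hr z hz).tendsto.comp
        (tendsto_nhdsWithin_iff.2 ⟨hlim, Eventually.of_forall fun k => (hx k).1⟩)
    exact le_of_tendsto' ((hc q₀ (subset_closure hq₀W)).sub (hc q hq))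
      fun k => (hx k).2 q hq hqu
  have hAsub : A ⊆ cSubdiffImage c (closure W) Y u Z := by
    rintro z ⟨hz, hzc⟩
    obtain ⟨x, hx, hxu, hsup⟩ := H.exists_supports_of_cone hu hδ hsub hcomp hq₀W hq₀u hz hzc
    exact hsup.mem_cSubdiffImage hx (hZδ x hx hxu) hz
  have hDconv : Convex ℝ (P q₀ '' A) := by
    rintro _ ⟨y₁, hy₁, rfl⟩ _ ⟨y₂, hy₂, rfl⟩ a b ha hb hab
    obtain ⟨y, hy, he⟩ := H.convex_image q₀ hq₀W (mem_image_of_mem _ hy₁.1)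
      (mem_image_of_mem _ hy₂.1) ha hb hab
    refine ⟨y, ⟨hy, fun q' hq' hqu' => ?_⟩, he⟩
    have h1 := H.sub_le_of_grad_eq hq₀W hq' hy hy₁.1 hy₂.1 ha hb hab he
    have h2 := mul_le_mul_of_nonneg_left (hy₁.2 q' hq' hqu') ha
    have h3 := mul_le_mul_of_nonneg_left (hy₂.2 q' hq' hqu') hb
    have h4 : (a + b) * δ = δ := by rw [hab, one_mul]
    linarith
  have hDvol := ofReal_det_le_volume b hDconv (fun _ => 0) (fun i => P q₀ (y i))
    (fun i => ⟨y₀, ⟨H.base_mem, fun q hq _ => by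
      rw [H.cost_base q hq, H.cost_base q₀ (subset_closure hq₀W)]; linarith⟩,
      H.grad_base q₀ hq₀W⟩) (fun i => ⟨y i, ⟨hy i, hcone i⟩, rfl⟩)
  simp only [sub_zero] at hDvol
  -- The only use of the diameter bound: it moves the gradient l i • b i from q i to q₀ with
  -- relative error at most ρ.
  have hdet := half_prod_le_det hρ b (fun i => P q₀ (y i)) l hl (fun i => by
    have h1 := H.norm_grad_sub_le q₀ hq₀W (q i) (hqW i) (y i) (hy i)
    rw [hP, norm_smul, b.norm_eq_one, mul_one, Real.norm_of_nonneg (hl i).le] at h1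
    exact h1.trans (mul_le_mul_of_nonneg_right (hdiam q₀ hq₀Z (q i)
      (hZδ _ (subset_closure (hqW i)) (hqu i))) (hl i).le))
  have hA' : volume (P q₀ '' A) ≤ Γ * cMongeAmpere c (closure W) Y u Z :=
    (hΓ A (fun _ h => h.1) hAclosed).trans (mul_le_mul_right (measure_mono hAsub) _)
  have hlprod : 0 < ∏ i, l i := Finset.prod_pos fun i _ => hl i
  have hmain : δ ^ n * s ≤ (∏ i, l i) * (d * ∏ i, w i) := by
    have hd0 : 0 ≤ d := by simpa using hd q₀ hq₀Z
    have h1 : δ ^ n ≤ ∏ i, l i * (if i = 0 then d else w i) := by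
      have : δ ^ n = ∏ _i : Fin n, δ := by simp
      rw [this]
      refine Finset.prod_le_prod (fun _ _ => hδ.le) fun i _ => (hlδ i).trans ?_
      have hqZ := hZδ _ (subset_closure (hqW i)) (hqu i)
      refine mul_le_mul_of_nonneg_left ?_ (hl i).le
      split_ifs with hi
      · rw [hi, hb0]; rw [hi] at hqZ; exact hd _ hqZ
      · exact hw i hi _ hqZ
    have h2 : (∏ i, (if i = 0 then d else w i)) * s = d * ∏ i, w i := by
      rw [← Finset.mul_prod_erase Finset.univ w (Finset.mem_univ 0),
        ← Finset.mul_prod_erase Finset.univ (fun i => if i = 0 then d else w i)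
          (Finset.mem_univ 0), hw0, if_pos rfl]
      rw [Finset.prod_congr rfl fun i hi => if_neg (Finset.ne_of_mem_erase hi)]
      ring
    rw [Finset.prod_mul_distrib] at h1
    calc δ ^ n * s ≤ ((∏ i, l i) * ∏ i, (if i = 0 then d else w i)) * s := by gcongr
      _ = _ := by rw [mul_assoc, h2]
  have hd0 : 0 ≤ d := by simpa using hd q₀ hq₀Z
  have hwprod : 0 ≤ ∏ i, w i := Finset.prod_nonneg fun i _ => hwnn i
  have hreal : |u q₀| ^ n * s ≤ (2 ^ (n + 1) * (n : ℝ) ^ (2 * n)) *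
      (((n : ℝ)⁻¹) ^ n * ((∏ i, l i) / 2)) * d * (((n : ℝ)⁻¹) ^ n * ∏ i, w i) := by
    have h1 : |u q₀| = 2 * δ := by rw [hq₀u, abs_neg, abs_of_pos (by linarith)]
    have h2 : (n : ℝ) ^ (2 * n) * (((n : ℝ)⁻¹) ^ n * ((n : ℝ)⁻¹) ^ n) = 1 := by
      rw [two_mul, pow_add, inv_pow]
      field_simp
    calc |u q₀| ^ n * s = 2 ^ n * (δ ^ n * s) := by rw [h1, mul_pow]; ring
      _ ≤ 2 ^ n * ((∏ i, l i) * (d * ∏ i, w i)) := by gcongr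
      _ = ((n : ℝ) ^ (2 * n) * (((n : ℝ)⁻¹) ^ n * ((n : ℝ)⁻¹) ^ n)) *
          (2 ^ n * ((∏ i, l i) * (d * ∏ i, w i))) := by rw [h2, one_mul]
      _ = _ := by ring
  refine (ENNReal.ofReal_le_ofReal hreal).trans ?_
  rw [ENNReal.ofReal_mul (by positivity), ENNReal.ofReal_mul (by positivity),
    ENNReal.ofReal_mul (by positivity)]
  have hD : ENNReal.ofReal (((n : ℝ)⁻¹) ^ n * ((∏ i, l i) / 2)) ≤
      Γ * cMongeAmpere c (closure W) Y u Z :=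
    ((ENNReal.ofReal_le_ofReal (by gcongr)).trans hDvol).trans hA'
  calc _ ≤ ENNReal.ofReal (2 ^ (n + 1) * (n : ℝ) ^ (2 * n)) *
        (Γ * cMongeAmpere c (closure W) Y u Z) * ENNReal.ofReal d * volume Z := by gcongr
    _ = _ := by ring

end OptTransport

namespace OptTransport

variable {n : ℕ}

noncomputable section

set_option maxSynthPendingDepth 5

/-! ### Derivatives of the cost -/

/-- The Riesz isomorphism as a linear map. -/
def riesz (n : ℕ) : (Euc n →L[ℝ] ℝ) →L[ℝ] Euc n :=
  LinearMap.toContinuousLinearMap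
    { toFun := fun f => (InnerProductSpace.toDual ℝ (Euc n)).symm f
      map_add' := fun f g => by simp
      map_smul' := fun a f => by simp }

theorem inner_riesz (f : Euc n →L[ℝ] ℝ) (v : Euc n) : inner ℝ (riesz n f) v = f v :=
  InnerProductSpace.toDual_symm_apply

theorem gradient_eq_riesz (f : Euc n → ℝ) (x : Euc n) : gradient f x = riesz n (fderiv ℝ f x) :=
  rfl

/-- The Riesz representative of the restriction of a functional to the first factor. -/
def rieszFst (n : ℕ) : (Euc n × Euc n →L[ℝ] ℝ) →L[ℝ] Euc n :=
  (riesz n).comp ((ContinuousLinearMap.compL ℝ (Euc n) (Euc n × Euc n) ℝ).flip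
    (ContinuousLinearMap.inl ℝ (Euc n) (Euc n)))

/-- The Riesz representative of the restriction of a functional to the second factor. -/
def rieszSnd (n : ℕ) : (Euc n × Euc n →L[ℝ] ℝ) →L[ℝ] Euc n :=
  (riesz n).comp ((ContinuousLinearMap.compL ℝ (Euc n) (Euc n × Euc n) ℝ).flip
    (ContinuousLinearMap.inr ℝ (Euc n) (Euc n)))

theorem inner_rieszFst (f : Euc n × Euc n →L[ℝ] ℝ) (v : Euc n) :
    inner ℝ (rieszFst n f) v = f (v, 0) := by
  simp [rieszFst, inner_riesz]

theorem inner_rieszSnd (f : Euc n × Euc n →L[ℝ] ℝ) (v : Euc n) :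
    inner ℝ (rieszSnd n f) v = f (0, v) := by
  simp [rieszSnd, inner_riesz]

/-- The mixed block of a bilinear form, as an operator. -/
def mixedBlock (n : ℕ) :
    (Euc n × Euc n →L[ℝ] Euc n × Euc n →L[ℝ] ℝ) →L[ℝ] (Euc n →L[ℝ] Euc n) :=
  (ContinuousLinearMap.compL ℝ (Euc n) (Euc n × Euc n →L[ℝ] ℝ) (Euc n) (rieszSnd n)).comp
    ((ContinuousLinearMap.compL ℝ (Euc n) (Euc n × Euc n) (Euc n × Euc n →L[ℝ] ℝ)).flip
      (ContinuousLinearMap.inl ℝ (Euc n) (Euc n)))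

theorem mixedBlock_eq (T : Euc n × Euc n →L[ℝ] Euc n × Euc n →L[ℝ] ℝ) :
    mixedBlock n T = (rieszSnd n).comp (T.comp (ContinuousLinearMap.inl ℝ (Euc n) (Euc n))) :=
  rfl

theorem inner_mixedBlock (T : Euc n × Euc n →L[ℝ] Euc n × Euc n →L[ℝ] ℝ) (v w : Euc n) :
    inner ℝ (mixedBlock n T v) w = T (v, 0) (0, w) := by
  simp [mixedBlock_eq, inner_rieszSnd]

/-- The derivative of the cost as a function of both variables. -/
def costDeriv (c : Euc n → Euc n → ℝ) : Euc n × Euc n → Euc n × Euc n →L[ℝ] ℝ :=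
  fderiv ℝ (fun p : Euc n × Euc n => c p.1 p.2)

/-- The second derivative of the cost as a function of both variables. -/
def costDeriv₂ (c : Euc n → Euc n → ℝ) :
    Euc n × Euc n → Euc n × Euc n →L[ℝ] Euc n × Euc n →L[ℝ] ℝ :=
  fderiv ℝ (costDeriv c)

/-- The third derivative of the cost as a function of both variables. -/
def costDeriv₃ (c : Euc n → Euc n → ℝ) :
    Euc n × Euc n → Euc n × Euc n →L[ℝ] Euc n × Euc n →L[ℝ] Euc n × Euc n →L[ℝ] ℝ :=
  fderiv ℝ (costDeriv₂ c)

end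

section Interior

set_option maxSynthPendingDepth 5

variable {c : Euc n → Euc n → ℝ} {U V : Set (Euc n)}

theorem contDiffOn_costDeriv (hU : IsOpen U) (hV : IsOpen V)
    (hc : ContDiffOn ℝ 4 (fun p : Euc n × Euc n => c p.1 p.2) (U ×ˢ V)) :
    ContDiffOn ℝ 3 (costDeriv c) (U ×ˢ V) :=
  hc.fderiv_of_isOpen (hU.prod hV) (by norm_num)

theorem contDiffOn_costDeriv₂ (hU : IsOpen U) (hV : IsOpen V)
    (hc : ContDiffOn ℝ 4 (fun p : Euc n × Euc n => c p.1 p.2) (U ×ˢ V)) :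
    ContDiffOn ℝ 2 (costDeriv₂ c) (U ×ˢ V) :=
  (contDiffOn_costDeriv hU hV hc).fderiv_of_isOpen (hU.prod hV) (by norm_num)

theorem hasFDerivAt_cost (hU : IsOpen U) (hV : IsOpen V)
    (hc : ContDiffOn ℝ 4 (fun p : Euc n × Euc n => c p.1 p.2) (U ×ˢ V)) {p : Euc n × Euc n}
    (hp : p ∈ U ×ˢ V) : HasFDerivAt (fun p : Euc n × Euc n => c p.1 p.2) (costDeriv c p) p :=
  ((hc.differentiableOn (by norm_num)).differentiableAt
    ((hU.prod hV).mem_nhds hp)).hasFDerivAt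

theorem hasFDerivAt_costDeriv (hU : IsOpen U) (hV : IsOpen V)
    (hc : ContDiffOn ℝ 4 (fun p : Euc n × Euc n => c p.1 p.2) (U ×ˢ V)) {p : Euc n × Euc n}
    (hp : p ∈ U ×ˢ V) : HasFDerivAt (costDeriv c) (costDeriv₂ c p) p :=
  (((contDiffOn_costDeriv hU hV hc).differentiableOn (by norm_num)).differentiableAt
    ((hU.prod hV).mem_nhds hp)).hasFDerivAt

theorem hasFDerivAt_costDeriv₂ (hU : IsOpen U) (hV : IsOpen V)
    (hc : ContDiffOn ℝ 4 (fun p : Euc n × Euc n => c p.1 p.2) (U ×ˢ V)) {p : Euc n × Euc n}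
    (hp : p ∈ U ×ˢ V) : HasFDerivAt (costDeriv₂ c) (costDeriv₃ c p) p :=
  (((contDiffOn_costDeriv₂ hU hV hc).differentiableOn (by norm_num)).differentiableAt
    ((hU.prod hV).mem_nhds hp)).hasFDerivAt

theorem costDeriv₂_comm (hU : IsOpen U) (hV : IsOpen V)
    (hc : ContDiffOn ℝ 4 (fun p : Euc n × Euc n => c p.1 p.2) (U ×ˢ V)) {p : Euc n × Euc n}
    (hp : p ∈ U ×ˢ V) (v w : Euc n × Euc n) : costDeriv₂ c p v w = costDeriv₂ c p w v :=
  ((hc.contDiffAt ((hU.prod hV).mem_nhds hp)).isSymmSndFDerivAt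
    (by simp [minSmoothness_of_isRCLikeNormedField]; norm_num)) v w

theorem costDeriv₃_comm (hU : IsOpen U) (hV : IsOpen V)
    (hc : ContDiffOn ℝ 4 (fun p : Euc n × Euc n => c p.1 p.2) (U ×ˢ V)) {p : Euc n × Euc n}
    (hp : p ∈ U ×ˢ V) (u v : Euc n × Euc n) : costDeriv₃ c p u v = costDeriv₃ c p v u :=
  (((contDiffOn_costDeriv hU hV hc).contDiffAt ((hU.prod hV).mem_nhds hp)).isSymmSndFDerivAt
    (by simp [minSmoothness_of_isRCLikeNormedField]; norm_num)) u v

/-- Differentiate the symmetry of the second derivative, which holds in a neighbourhood of p. -/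
theorem costDeriv₃_comm_right (hU : IsOpen U) (hV : IsOpen V)
    (hc : ContDiffOn ℝ 4 (fun p : Euc n × Euc n => c p.1 p.2) (U ×ˢ V)) {p : Euc n × Euc n}
    (hp : p ∈ U ×ˢ V) (u v w : Euc n × Euc n) :
    costDeriv₃ c p u v w = costDeriv₃ c p u w v := by
  have h := hasFDerivAt_costDeriv₂ hU hV hc hp
  have h1 : HasFDerivAt (fun p => costDeriv₂ c p v w) _ p :=
    (h.clm_apply (hasFDerivAt_const v p)).clm_apply (hasFDerivAt_const w p)
  have h2 : HasFDerivAt (fun p => costDeriv₂ c p w v) _ p :=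
    (h.clm_apply (hasFDerivAt_const w p)).clm_apply (hasFDerivAt_const v p)
  have h3 : (fun p => costDeriv₂ c p v w) =ᶠ[𝓝 p] fun p => costDeriv₂ c p w v := by
    filter_upwards [(hU.prod hV).mem_nhds hp] with r hr
    exact costDeriv₂_comm hU hV hc hr v w
  have := congrArg (fun T => T u) ((h1.congr_of_eventuallyEq h3.symm).unique h2)
  simpa using this

theorem gradient_fst_eq (hU : IsOpen U) (hV : IsOpen V)
    (hc : ContDiffOn ℝ 4 (fun p : Euc n × Euc n => c p.1 p.2) (U ×ˢ V)) {p : Euc n × Euc n}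
    (hp : p ∈ U ×ˢ V) :
    gradient (fun x' => c x' p.2) p.1 = rieszFst n (costDeriv c p) := by
  have h : HasFDerivAt (fun x' => c x' p.2) _ p.1 :=
    (hasFDerivAt_cost hU hV hc hp).comp (f := fun x' => (x', p.2)) p.1
      (hasFDerivAt_prodMk_left p.1 p.2)
  rw [gradient_eq_riesz, h.fderiv]
  rfl

theorem gradient_snd_eq (hU : IsOpen U) (hV : IsOpen V)
    (hc : ContDiffOn ℝ 4 (fun p : Euc n × Euc n => c p.1 p.2) (U ×ˢ V)) {p : Euc n × Euc n}
    (hp : p ∈ U ×ˢ V) :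
    gradient (fun y' => c p.1 y') p.2 = rieszSnd n (costDeriv c p) := by
  have h : HasFDerivAt (fun y' => c p.1 y') _ p.2 :=
    (hasFDerivAt_cost hU hV hc hp).comp (f := fun y' => (p.1, y')) p.2
      (hasFDerivAt_prodMk_right p.1 p.2)
  rw [gradient_eq_riesz, h.fderiv]
  rfl

theorem hasFDerivAt_rieszSnd_left (hU : IsOpen U) (hV : IsOpen V)
    (hc : ContDiffOn ℝ 4 (fun p : Euc n × Euc n => c p.1 p.2) (U ×ˢ V)) {p : Euc n × Euc n}
    (hp : p ∈ U ×ˢ V) :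
    HasFDerivAt (fun x' => rieszSnd n (costDeriv c (x', p.2))) (mixedBlock n (costDeriv₂ c p))
      p.1 :=
  (rieszSnd n).hasFDerivAt.comp p.1 ((hasFDerivAt_costDeriv hU hV hc hp).comp
    (f := fun x' => (x', p.2)) p.1 (hasFDerivAt_prodMk_left p.1 p.2))

/-- By symmetry of second derivatives, D_y D_x c is the transpose of D_x D_y c; one operator thus
governs both twist maps. -/
theorem hasFDerivAt_rieszFst_right (hU : IsOpen U) (hV : IsOpen V)
    (hc : ContDiffOn ℝ 4 (fun p : Euc n × Euc n => c p.1 p.2) (U ×ˢ V)) {p : Euc n × Euc n}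
    (hp : p ∈ U ×ˢ V) :
    HasFDerivAt (fun y' => rieszFst n (costDeriv c (p.1, y')))
      (ContinuousLinearMap.adjoint (mixedBlock n (costDeriv₂ c p))) p.2 := by
  have h : HasFDerivAt (fun y' => rieszFst n (costDeriv c (p.1, y'))) _ p.2 :=
    (rieszFst n).hasFDerivAt.comp p.2 ((hasFDerivAt_costDeriv hU hV hc hp).comp
      (f := fun y' => (p.1, y')) p.2 (hasFDerivAt_prodMk_right p.1 p.2))
  refine h.congr_fderiv ?_
  ext1 v
  refine ext_inner_right ℝ fun w => ?_
  symm
  rw [ContinuousLinearMap.adjoint_inner_left, real_inner_comm, inner_mixedBlock]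
  simp only [ContinuousLinearMap.comp_apply, ContinuousLinearMap.inr_apply]
  rw [inner_rieszFst]
  exact costDeriv₂_comm hU hV hc hp _ _

theorem mixedHess_eq (hU : IsOpen U) (hV : IsOpen V)
    (hc : ContDiffOn ℝ 4 (fun p : Euc n × Euc n => c p.1 p.2) (U ×ˢ V)) {p : Euc n × Euc n}
    (hp : p ∈ U ×ˢ V) : mixedHess c p.1 p.2 = mixedBlock n (costDeriv₂ c p) := by
  have h : (fun x' => gradient (fun y' => c x' y') p.2)
      =ᶠ[𝓝 p.1] fun x' => rieszSnd n (costDeriv c (x', p.2)) := by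
    filter_upwards [hU.mem_nhds hp.1] with x' hx'
    exact gradient_snd_eq hU hV hc (p := (x', p.2)) ⟨hx', hp.2⟩
  rw [mixedHess, h.fderiv_eq, (hasFDerivAt_rieszSnd_left hU hV hc hp).fderiv]

theorem hasFDerivAt_mixedHess (hU : IsOpen U) (hV : IsOpen V)
    (hc : ContDiffOn ℝ 4 (fun p : Euc n × Euc n => c p.1 p.2) (U ×ˢ V)) {p : Euc n × Euc n}
    (hp : p ∈ U ×ˢ V) : HasFDerivAt (fun x' => mixedHess c x' p.2)
      ((mixedBlock n).comp ((costDeriv₃ c p).comp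
        (ContinuousLinearMap.inl ℝ (Euc n) (Euc n)))) p.1 := by
  have h : (fun x' => mixedHess c x' p.2)
      =ᶠ[𝓝 p.1] fun x' => mixedBlock n (costDeriv₂ c (x', p.2)) := by
    filter_upwards [hU.mem_nhds hp.1] with x' hx'
    exact mixedHess_eq hU hV hc (p := (x', p.2)) ⟨hx', hp.2⟩
  refine HasFDerivAt.congr_of_eventuallyEq ?_ h
  exact (mixedBlock n).hasFDerivAt.comp p.1 ((hasFDerivAt_costDeriv₂ hU hV hc hp).comp
    (f := fun x' => (x', p.2)) p.1 (hasFDerivAt_prodMk_left p.1 p.2))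

theorem thirdXXY_eq (hU : IsOpen U) (hV : IsOpen V)
    (hc : ContDiffOn ℝ 4 (fun p : Euc n × Euc n => c p.1 p.2) (U ×ˢ V)) {p : Euc n × Euc n}
    (hp : p ∈ U ×ˢ V) : thirdXXY c p.1 p.2 =
      (mixedBlock n).comp ((costDeriv₃ c p).comp (ContinuousLinearMap.inl ℝ (Euc n) (Euc n))) :=
  (hasFDerivAt_mixedHess hU hV hc hp).fderiv

theorem hasFDerivAt_mixedHess_thirdXXY (hU : IsOpen U) (hV : IsOpen V)
    (hc : ContDiffOn ℝ 4 (fun p : Euc n × Euc n => c p.1 p.2) (U ×ˢ V)) {p : Euc n × Euc n}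
    (hp : p ∈ U ×ˢ V) :
    HasFDerivAt (fun x' => mixedHess c x' p.2) (thirdXXY c p.1 p.2) p.1 := by
  rw [thirdXXY_eq hU hV hc hp]
  exact hasFDerivAt_mixedHess hU hV hc hp

end Interior

/-! ### Extension of the derivatives to the closure -/

/-- Currying on the right identifies the derivatives of f' with those of f of one order more.
Repeated, it turns the boundary limits in `ContDiffUpTo` into limits of `costDeriv` and its
successors. -/
theorem exists_tendsto_iteratedFDeriv_fderiv {E F : Type*} [NormedAddCommGroup E]
    [NormedSpace ℝ E] [NormedAddCommGroup F] [NormedSpace ℝ F] {f : E → F} {m : ℕ} {l : Filter E}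
    (h : ∃ L, Tendsto (iteratedFDeriv ℝ (m + 1) f) l (𝓝 L)) :
    ∃ L, Tendsto (iteratedFDeriv ℝ m (fderiv ℝ f)) l (𝓝 L) := by
  obtain ⟨L, hL⟩ := h
  refine ⟨continuousMultilinearCurryRightEquiv' ℝ m E F L, ?_⟩
  have := ((continuousMultilinearCurryRightEquiv' ℝ m E F).continuous.tendsto L).comp hL
  refine this.congr fun x => ?_
  simp [iteratedFDeriv_succ_eq_comp_right]

theorem exists_tendsto_of_iteratedFDeriv_zero {E F : Type*} [NormedAddCommGroup E]
    [NormedSpace ℝ E] [NormedAddCommGroup F] [NormedSpace ℝ F] {f : E → F} {l : Filter E}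
    (h : ∃ L, Tendsto (iteratedFDeriv ℝ 0 f) l (𝓝 L)) : ∃ L, Tendsto f l (𝓝 L) := by
  obtain ⟨L, hL⟩ := h
  refine ⟨continuousMultilinearCurryFin0 ℝ E F L, ?_⟩
  refine (((continuousMultilinearCurryFin0 ℝ E F).continuous.tendsto L).comp hL).congr
    fun x => ?_
  simp

theorem extendFrom_spec {X Y : Type*} [TopologicalSpace X] [TopologicalSpace Y] [T3Space Y]
    {f g : X → Y} {A : Set X} (hfg : EqOn f g A) (hg : ContinuousOn g A)
    (h : ∀ x ∈ closure A, ∃ L, Tendsto g (𝓝[A] x) (𝓝 L)) :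
    ContinuousOn (extendFrom A f) (closure A) ∧ EqOn (extendFrom A f) g A := by
  have h' : ∀ x ∈ closure A, ∃ L, Tendsto f (𝓝[A] x) (𝓝 L) := fun x hx => by
    obtain ⟨L, hL⟩ := h x hx
    exact ⟨L, hL.congr' (eventually_mem_nhdsWithin.mono fun y hy => (hfg hy).symm)⟩
  refine ⟨continuousOn_extendFrom subset_rfl h', fun x hx => ?_⟩
  refine extendFrom_eq (subset_closure hx) ?_
  exact (hg x hx).tendsto.congr' (eventually_mem_nhdsWithin.mono fun y hy => (hfg hy).symm)

section Closure

set_option maxSynthPendingDepth 5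

variable {c : Euc n → Euc n → ℝ} {U V : Set (Euc n)}

theorem B0.contDiffOn (h : B0 c U V) :
    ContDiffOn ℝ 4 (fun p : Euc n × Euc n => c p.1 p.2) (U ×ˢ V) := h.2.2.2.2.2.1

theorem B0.exists_tendsto_costDeriv (h : B0 c U V) {p : Euc n × Euc n}
    (hp : p ∈ closure (U ×ˢ V)) : ∃ L, Tendsto (costDeriv c) (𝓝[U ×ˢ V] p) (𝓝 L) :=
  exists_tendsto_of_iteratedFDeriv_zero (exists_tendsto_iteratedFDeriv_fderiv
    (h.2.2.2.2.2.2 1 (by norm_num) p hp))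

theorem B0.exists_tendsto_costDeriv₂ (h : B0 c U V) {p : Euc n × Euc n}
    (hp : p ∈ closure (U ×ˢ V)) : ∃ L, Tendsto (costDeriv₂ c) (𝓝[U ×ˢ V] p) (𝓝 L) :=
  exists_tendsto_of_iteratedFDeriv_zero (exists_tendsto_iteratedFDeriv_fderiv
    (exists_tendsto_iteratedFDeriv_fderiv (h.2.2.2.2.2.2 2 (by norm_num) p hp)))

theorem B0.exists_tendsto_costDeriv₃ (h : B0 c U V) {p : Euc n × Euc n}
    (hp : p ∈ closure (U ×ˢ V)) : ∃ L, Tendsto (costDeriv₃ c) (𝓝[U ×ˢ V] p) (𝓝 L) :=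
  exists_tendsto_of_iteratedFDeriv_zero (exists_tendsto_iteratedFDeriv_fderiv
    (exists_tendsto_iteratedFDeriv_fderiv (exists_tendsto_iteratedFDeriv_fderiv
      (h.2.2.2.2.2.2 3 (by norm_num) p hp))))

theorem B0.gradX_spec (h : B0 c U V) :
    ContinuousOn (fun p : Euc n × Euc n => gradX c U V p.1 p.2) (closure (U ×ˢ V)) ∧
      ∀ p ∈ U ×ˢ V, gradX c U V p.1 p.2 = rieszFst n (costDeriv c p) :=
  extendFrom_spec (fun _ hp => gradient_fst_eq h.1 h.2.1 h.contDiffOn hp)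
    ((rieszFst n).continuous.comp_continuousOn
      (contDiffOn_costDeriv h.1 h.2.1 h.contDiffOn).continuousOn) fun _ hp => by
    obtain ⟨L, hL⟩ := h.exists_tendsto_costDeriv hp
    exact ⟨_, ((rieszFst n).continuous.tendsto L).comp hL⟩

theorem B0.gradY_spec (h : B0 c U V) :
    ContinuousOn (fun p : Euc n × Euc n => gradY c U V p.1 p.2) (closure (U ×ˢ V)) ∧
      ∀ p ∈ U ×ˢ V, gradY c U V p.1 p.2 = rieszSnd n (costDeriv c p) :=
  extendFrom_spec (fun _ hp => gradient_snd_eq h.1 h.2.1 h.contDiffOn hp)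
    ((rieszSnd n).continuous.comp_continuousOn
      (contDiffOn_costDeriv h.1 h.2.1 h.contDiffOn).continuousOn) fun _ hp => by
    obtain ⟨L, hL⟩ := h.exists_tendsto_costDeriv hp
    exact ⟨_, ((rieszSnd n).continuous.tendsto L).comp hL⟩

theorem B0.mixedHessBar_spec (h : B0 c U V) :
    ContinuousOn (fun p : Euc n × Euc n => mixedHessBar c U V p.1 p.2) (closure (U ×ˢ V)) ∧
      ∀ p ∈ U ×ˢ V, mixedHessBar c U V p.1 p.2 = mixedBlock n (costDeriv₂ c p) :=
  extendFrom_spec (fun _ hp => mixedHess_eq h.1 h.2.1 h.contDiffOn hp)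
    ((mixedBlock n).continuous.comp_continuousOn
      (contDiffOn_costDeriv₂ h.1 h.2.1 h.contDiffOn).continuousOn) fun _ hp => by
    obtain ⟨L, hL⟩ := h.exists_tendsto_costDeriv₂ hp
    exact ⟨_, ((mixedBlock n).continuous.tendsto L).comp hL⟩

theorem B0.mixedHessBar_eq (h : B0 c U V) {p : Euc n × Euc n} (hp : p ∈ U ×ˢ V) :
    mixedHessBar c U V p.1 p.2 = mixedHess c p.1 p.2 := by
  rw [h.mixedHessBar_spec.2 p hp, mixedHess_eq h.1 h.2.1 h.contDiffOn hp]

end Closure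

end OptTransport

namespace OptTransport

variable {n : ℕ}

/-! ### Calculus along curves -/

theorem iteratedDeriv_two_eq {g g₁ : ℝ → ℝ} {a g₂ : ℝ}
    (h : ∀ᶠ s in 𝓝 a, HasDerivAt g (g₁ s) s) (h' : HasDerivAt g₁ g₂ a) :
    iteratedDeriv 2 g a = g₂ := by
  rw [iteratedDeriv_succ, iteratedDeriv_one]
  have : deriv g =ᶠ[𝓝 a] g₁ := h.mono fun s hs => hs.deriv
  rw [this.deriv_eq, h'.deriv]

theorem hasDerivAt_deriv_of_contDiffOn {E : Type*} [NormedAddCommGroup E] [NormedSpace ℝ E]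
    {g : ℝ → E} {T : Set ℝ} (hT : IsOpen T) (hg : ContDiffOn ℝ 2 g T) {t : ℝ} (ht : t ∈ T) :
    HasDerivAt g (deriv g t) t ∧ HasDerivAt (deriv g) (deriv (deriv g) t) t := by
  have h1 : ContDiffOn ℝ 1 (deriv g) T := hg.deriv_of_isOpen hT (by norm_num)
  exact ⟨((hg.differentiableOn (by norm_num)).differentiableAt (hT.mem_nhds ht)).hasDerivAt,
    ((h1.differentiableOn (by norm_num)).differentiableAt (hT.mem_nhds ht)).hasDerivAt⟩

/-- A `C²` function with non-positive second derivative lies below its tangent. -/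
theorem sub_le_deriv_of_iteratedDeriv_nonpos {k : ℝ → ℝ} {S : Set ℝ} (hS : IsOpen S)
    (hsub : Icc 0 1 ⊆ S) (hk : ContDiffOn ℝ 2 k S)
    (h : ∀ s ∈ Icc (0 : ℝ) 1, iteratedDeriv 2 k s ≤ 0) : k 1 - k 0 ≤ deriv k 0 := by
  have hd := fun s (hs : s ∈ Icc (0 : ℝ) 1) => hasDerivAt_deriv_of_contDiffOn hS hk (hsub hs)
  obtain ⟨z, hz, he⟩ := exists_hasDerivAt_eq_slope k (deriv k) zero_lt_one
    (fun s hs => (hd s hs).1.continuousAt.continuousWithinAt)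
    (fun s hs => (hd s (Ioo_subset_Icc_self hs)).1)
  have hanti : AntitoneOn (deriv k) (Icc 0 1) := by
    refine antitoneOn_of_deriv_nonpos (convex_Icc 0 1)
      (fun s hs => (hd s hs).2.continuousAt.continuousWithinAt)
      (fun s hs => (hd s (interior_subset hs)).2.differentiableAt.differentiableWithinAt)
      fun s hs => ?_
    have := h s (interior_subset hs)
    rwa [iteratedDeriv_succ, iteratedDeriv_one] at this
  rw [sub_zero, div_one] at he
  rw [← he]
  exact hanti ⟨le_rfl, zero_le_one⟩ (Ioo_subset_Icc_self hz) hz.1.le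

/-- Kept general in Ψ because it is applied both to the cost and to a directional x-derivative of
the cost. -/
theorem iteratedDeriv_two_comp_prodMk {E : Type*} [NormedAddCommGroup E] [NormedSpace ℝ E]
    {Ψ : E × E → ℝ} {Ψ' : E × E → E × E →L[ℝ] ℝ} {Ψ'' : E × E →L[ℝ] E × E →L[ℝ] ℝ}
    {η : ℝ → E} {T : Set ℝ} (hT : IsOpen T) (hη : ContDiffOn ℝ 2 η T) {t : ℝ} (ht : t ∈ T) {x : E}
    (hΨ : ∀ᶠ p in 𝓝 (x, η t), HasFDerivAt Ψ (Ψ' p) p) (hΨ' : HasFDerivAt Ψ' Ψ'' (x, η t)) :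
    iteratedDeriv 2 (fun s => Ψ (x, η s)) t =
      Ψ'' (0, deriv η t) (0, deriv η t) + Ψ' (x, η t) (0, deriv (deriv η) t) := by
  have hd := hasDerivAt_deriv_of_contDiffOn hT hη ht
  have hpair : ∀ s ∈ T, HasDerivAt (fun s => (x, η s)) (0, deriv η s) s := fun s hs =>
    (hasDerivAt_const s x).prodMk (hasDerivAt_deriv_of_contDiffOn hT hη hs).1
  refine iteratedDeriv_two_eq (g₁ := fun s => Ψ' (x, η s) (0, deriv η s)) ?_ ?_
  · filter_upwards [hT.mem_nhds ht, (hpair t ht).continuousAt.eventually hΨ] with s hs hs'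
    exact hs'.comp_hasDerivAt s (hpair s hs)
  · have h1 : HasDerivAt (fun s => Ψ' (x, η s)) (Ψ'' (0, deriv η t)) t :=
      hΨ'.comp_hasDerivAt t (hpair t ht)
    have h2 : HasDerivAt (fun s => ((0 : E), deriv η s)) (0, deriv (deriv η) t) t :=
      (hasDerivAt_const t 0).prodMk hd.2
    exact h1.clm_apply h2

/-! ### Inverse functions and segments in the coordinates they define -/

/-- Injectivity forces the global inverse to agree near φ x with the local inverse of the inverse
function theorem, whose smoothness it inherits. -/
theorem contDiffOn_invFunOn {E : Type*} [NormedAddCommGroup E] [NormedSpace ℝ E]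
    [CompleteSpace E] {φ : E → E} {Ω : Set E} {k : WithTop ℕ∞} (hΩ : IsOpen Ω) (hk : k ≠ 0)
    (hφ : ContDiffOn ℝ k φ Ω) (hinj : InjOn φ Ω)
    (hinv : ∀ x ∈ Ω, ∃ e : E ≃L[ℝ] E, HasFDerivAt φ (e : E →L[ℝ] E) x) :
    IsOpen (φ '' Ω) ∧ ContDiffOn ℝ k (Function.invFunOn φ Ω) (φ '' Ω) := by
  have key : ∀ x ∈ Ω, φ '' Ω ∈ 𝓝 (φ x) ∧ ContDiffAt ℝ k (Function.invFunOn φ Ω) (φ x) := by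
    intro x hx
    obtain ⟨e, he⟩ := hinv x hx
    have hca := hφ.contDiffAt (hΩ.mem_nhds hx)
    have hs := hca.hasStrictFDerivAt' he hk
    have hmap := hs.map_nhds_eq_of_equiv
    refine ⟨by rw [← hmap]; exact image_mem_map (hΩ.mem_nhds hx), ?_⟩
    refine (hca.to_localInverse he hk).congr_of_eventuallyEq ?_
    have h1 : ∀ᶠ z in 𝓝 (φ x), hca.localInverse he hk z ∈ Ω := by
      have hc : ContinuousAt (hca.localInverse he hk) (φ x) :=
        (hca.to_localInverse he hk).continuousAt
      refine hc.eventually ?_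
      rw [show hca.localInverse he hk (φ x) = x from hca.localInverse_apply_image he hk]
      exact hΩ.mem_nhds hx
    filter_upwards [h1, hs.eventually_right_inverse] with z hz1 hz2
    have hz2' : φ (hca.localInverse he hk z) = z := hz2
    conv_lhs => rw [← hz2']
    exact hinj.leftInvOn_invFunOn hz1
  refine ⟨isOpen_iff_mem_nhds.2 ?_, ?_⟩
  · rintro _ ⟨x, hx, rfl⟩; exact (key x hx).1
  · rintro _ ⟨x, hx, rfl⟩; exact (key x hx).2.contDiffWithinAt

/-- The curve which in the coordinate `φ` is the line `t ↦ a + t ω`. -/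
noncomputable def coordCurve {E : Type*} [NormedAddCommGroup E] [NormedSpace ℝ E] (φ : E → E)
    (Ω : Set E) (a ω : E) (t : ℝ) : E := Function.invFunOn φ Ω (a + t • ω)

section coordCurve

variable {E : Type*} [NormedAddCommGroup E] [NormedSpace ℝ E] {φ : E → E} {Ω : Set E} {a ω : E}

theorem coordCurve_mem {t : ℝ} (ht : a + t • ω ∈ φ '' Ω) : coordCurve φ Ω a ω t ∈ Ω :=
  Function.invFunOn_mem ht

theorem map_coordCurve {t : ℝ} (ht : a + t • ω ∈ φ '' Ω) :
    φ (coordCurve φ Ω a ω t) = a + t • ω :=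
  Function.invFunOn_eq ht

theorem coordCurve_eq (hinj : InjOn φ Ω) {t : ℝ} {x : E} (hx : x ∈ Ω) (h : φ x = a + t • ω) :
    coordCurve φ Ω a ω t = x := by
  rw [coordCurve, ← h]
  exact hinj.leftInvOn_invFunOn hx

theorem isOpen_coordCurve_domain (h : IsOpen (φ '' Ω)) :
    IsOpen {t : ℝ | a + t • ω ∈ φ '' Ω} :=
  h.preimage (f := fun t : ℝ => a + t • ω) (by fun_prop)

theorem contDiffOn_coordCurve {k : WithTop ℕ∞}
    (h : ContDiffOn ℝ k (Function.invFunOn φ Ω) (φ '' Ω)) :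
    ContDiffOn ℝ k (coordCurve φ Ω a ω) {t : ℝ | a + t • ω ∈ φ '' Ω} :=
  h.comp (f := fun t : ℝ => a + t • ω) (by fun_prop) fun _ ht => ht

theorem hasFDerivAt_apply_deriv_coordCurve (hopen : IsOpen (φ '' Ω))
    (h : ContDiffOn ℝ 2 (Function.invFunOn φ Ω) (φ '' Ω)) {t : ℝ} (ht : a + t • ω ∈ φ '' Ω)
    {φ' : E →L[ℝ] E} (hφ' : HasFDerivAt φ φ' (coordCurve φ Ω a ω t)) :
    φ' (deriv (coordCurve φ Ω a ω) t) = ω := by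
  have hT := isOpen_coordCurve_domain (a := a) (ω := ω) hopen
  have h1 := hφ'.comp_hasDerivAt t
    (hasDerivAt_deriv_of_contDiffOn hT (contDiffOn_coordCurve h) ht).1
  have h2 : HasDerivAt (fun t : ℝ => a + t • ω) ω t := by
    simpa using ((hasDerivAt_id t).smul_const ω).const_add a
  refine h1.unique (h2.congr_of_eventuallyEq ?_)
  filter_upwards [hT.mem_nhds ht] with s hs
  exact map_coordCurve hs

end coordCurve

/-! ### The mixed Hessian as the derivative of the gradients -/

section Interior

set_option maxSynthPendingDepth 5

variable {c : Euc n → Euc n → ℝ} {U V : Set (Euc n)} {x y : Euc n}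

theorem B0.costDeriv_snd (h : B0 c U V) (hx : x ∈ U) (hy : y ∈ V) (w : Euc n) :
    costDeriv c (x, y) (0, w) = inner ℝ (gradY c U V x y) w := by
  rw [h.gradY_spec.2 (x, y) ⟨hx, hy⟩, inner_rieszSnd]

theorem B0.costDeriv_fst (h : B0 c U V) (hx : x ∈ U) (hy : y ∈ V) (w : Euc n) :
    costDeriv c (x, y) (w, 0) = inner ℝ (gradX c U V x y) w := by
  rw [h.gradX_spec.2 (x, y) ⟨hx, hy⟩, inner_rieszFst]

theorem B0.costDeriv₂_mixed (h : B0 c U V) (hx : x ∈ U) (hy : y ∈ V) (v w : Euc n) :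
    costDeriv₂ c (x, y) (v, 0) (0, w) = inner ℝ (mixedHessBar c U V x y v) w := by
  rw [h.mixedHessBar_spec.2 (x, y) ⟨hx, hy⟩, inner_mixedBlock]

theorem B0.hasFDerivAt_gradY (h : B0 c U V) (hx : x ∈ U) (hy : y ∈ V) :
    HasFDerivAt (fun x' => gradY c U V x' y) (mixedHessBar c U V x y) x := by
  rw [h.mixedHessBar_spec.2 (x, y) ⟨hx, hy⟩]
  refine (hasFDerivAt_rieszSnd_left h.1 h.2.1 h.contDiffOn
    (p := (x, y)) ⟨hx, hy⟩).congr_of_eventuallyEq ?_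
  filter_upwards [h.1.mem_nhds hx] with x' hx'
  exact h.gradY_spec.2 (x', y) ⟨hx', hy⟩

theorem B0.hasFDerivAt_gradX (h : B0 c U V) (hx : x ∈ U) (hy : y ∈ V) :
    HasFDerivAt (fun y' => gradX c U V x y')
      (ContinuousLinearMap.adjoint (mixedHessBar c U V x y)) y := by
  rw [h.mixedHessBar_spec.2 (x, y) ⟨hx, hy⟩]
  refine (hasFDerivAt_rieszFst_right h.1 h.2.1 h.contDiffOn
    (p := (x, y)) ⟨hx, hy⟩).congr_of_eventuallyEq ?_
  filter_upwards [h.2.1.mem_nhds hy] with y' hy'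
  exact h.gradX_spec.2 (x, y') ⟨hx, hy'⟩

theorem B0.contDiffOn_gradY (h : B0 c U V) (hy : y ∈ V) :
    ContDiffOn ℝ 3 (fun x' => gradY c U V x' y) U := by
  have h1 : ContDiffOn ℝ 3 (fun x' => rieszSnd n (costDeriv c (x', y))) U :=
    (rieszSnd n).contDiff.comp_contDiffOn ((contDiffOn_costDeriv h.1 h.2.1 h.contDiffOn).comp
      (f := fun x' => (x', y)) (by fun_prop) fun x' hx' => ⟨hx', hy⟩)
  exact h1.congr fun x' hx' => h.gradY_spec.2 (x', y) ⟨hx', hy⟩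

theorem B0.contDiffOn_gradX (h : B0 c U V) (hx : x ∈ U) :
    ContDiffOn ℝ 3 (fun y' => gradX c U V x y') V := by
  have h1 : ContDiffOn ℝ 3 (fun y' => rieszFst n (costDeriv c (x, y'))) V :=
    (rieszFst n).contDiff.comp_contDiffOn ((contDiffOn_costDeriv h.1 h.2.1 h.contDiffOn).comp
      (f := fun y' => (x, y')) (by fun_prop) fun y' hy' => ⟨hx, hy'⟩)
  exact h1.congr fun y' hy' => h.gradX_spec.2 (x, y') ⟨hx, hy'⟩

theorem isInvertible_adjoint {M : Euc n →L[ℝ] Euc n} (h : M.IsInvertible) :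
    (ContinuousLinearMap.adjoint M).IsInvertible := by
  obtain ⟨e, rfl⟩ := h
  refine ContinuousLinearMap.IsInvertible.of_inverse
    (g := ContinuousLinearMap.adjoint (e.symm : Euc n →L[ℝ] Euc n)) ?_ ?_
  · rw [← ContinuousLinearMap.adjoint_comp, ContinuousLinearEquiv.coe_symm_comp_coe]
    exact star_one (Euc n →L[ℝ] Euc n)
  · rw [← ContinuousLinearMap.adjoint_comp, ContinuousLinearEquiv.coe_comp_coe_symm]
    exact star_one (Euc n →L[ℝ] Euc n)

theorem coordX_spec (h : B0 c U V) (h1 : B1 c U V) (hy : y ∈ V) :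
    IsOpen ((fun x => -gradY c U V x y) '' U) ∧
      ContDiffOn ℝ 3 (Function.invFunOn (fun x => -gradY c U V x y) U)
        ((fun x => -gradY c U V x y) '' U) := by
  refine contDiffOn_invFunOn h.1 (by norm_num) (h.contDiffOn_gradY hy).neg
    ((h1.1 y (subset_closure hy)).mono subset_closure) fun x hx => ?_
  obtain ⟨e, he⟩ := h1.2.2 x (subset_closure hx) y (subset_closure hy)
  refine ⟨(ContinuousLinearEquiv.neg ℝ).trans e, ?_⟩
  refine (h.hasFDerivAt_gradY hx hy).neg.congr_fderiv ?_
  rw [← he]; ext1 v; simp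

theorem coordY_spec (h : B0 c U V) (h1 : B1 c U V) (hx : x ∈ U) :
    IsOpen ((fun y => -gradX c U V x y) '' V) ∧
      ContDiffOn ℝ 3 (Function.invFunOn (fun y => -gradX c U V x y) V)
        ((fun y => -gradX c U V x y) '' V) := by
  refine contDiffOn_invFunOn h.2.1 (by norm_num) (h.contDiffOn_gradX hx).neg
    ((h1.2.1 x (subset_closure hx)).mono subset_closure) fun y hy => ?_
  obtain ⟨e, he⟩ := isInvertible_adjoint (h1.2.2 x (subset_closure hx) y (subset_closure hy))
  refine ⟨(ContinuousLinearEquiv.neg ℝ).trans e, ?_⟩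
  refine (h.hasFDerivAt_gradX hx hy).neg.congr_fderiv ?_
  rw [← he]; ext1 v; simp

end Interior

end OptTransport

namespace OptTransport

variable {n : ℕ}

/-! ### The cross-difference inequality -/

theorem iteratedDeriv_two_rescale {φ : ℝ → ℝ} {T : Set ℝ} (hT : IsOpen T) (h0 : (0 : ℝ) ∈ T)
    (hφ : ContDiffOn ℝ 2 φ T) (A B D ε : ℝ) :
    iteratedDeriv 2 (fun s => A * φ (ε * s) + (B + s * D)) 0 =
      A * (ε ^ 2 * iteratedDeriv 2 φ 0) := by
  have hcont : Tendsto (fun s : ℝ => ε * s) (𝓝 0) (𝓝 0) := by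
    have : Continuous fun s : ℝ => ε * s := by fun_prop
    simpa using this.tendsto 0
  have hlin : ∀ s : ℝ, HasDerivAt (fun s => ε * s) ε s := fun s => by
    simpa using (hasDerivAt_id s).const_mul ε
  refine iteratedDeriv_two_eq (g₁ := fun s => A * (deriv φ (ε * s) * ε) + D) ?_ ?_
  · filter_upwards [hcont.eventually (hT.mem_nhds h0)] with s hs
    have h1 := (hasDerivAt_deriv_of_contDiffOn hT hφ hs).1.comp s (hlin s)
    have h2 : HasDerivAt (fun s => B + s * D) D s := by
      simpa using ((hasDerivAt_id s).mul_const D).const_add B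
    exact (h1.const_mul A).add h2
  · have h1 : HasDerivAt (deriv φ) (deriv (deriv φ) 0) (ε * 0) := by
      rw [mul_zero]; exact (hasDerivAt_deriv_of_contDiffOn hT hφ h0).2
    have h2 := (((h1.comp 0 (hlin 0)).mul_const ε).const_mul A).add_const D
    rw [iteratedDeriv_succ, iteratedDeriv_one]
    exact h2.congr_deriv (by ring)

theorem exists_pos_forall_smul_mem {E : Type*} [NormedAddCommGroup E] [NormedSpace ℝ E]
    {S : Set E} (hS : IsOpen S) {a : E} (ha : a ∈ S) (ω : E) :
    ∀ᶠ ε : ℝ in 𝓝[>] 0, ∀ t ∈ Icc (-1 : ℝ) 1, a + (t * ε) • ω ∈ S := by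
  obtain ⟨r, hr, hball⟩ := Metric.isOpen_iff.1 hS a ha
  have h1 : Tendsto (fun ε : ℝ => ε * ‖ω‖) (𝓝[>] 0) (𝓝 0) := by
    have : Continuous fun ε : ℝ => ε * ‖ω‖ := by fun_prop
    simpa using (this.tendsto 0).mono_left nhdsWithin_le_nhds
  filter_upwards [h1.eventually (gt_mem_nhds hr), self_mem_nhdsWithin] with ε hε hpos t ht
  refine hball ?_
  rw [mem_ball_iff_norm, add_sub_cancel_left, norm_smul, norm_mul, Real.norm_eq_abs,
    Real.norm_of_nonneg (le_of_lt hpos)]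
  refine lt_of_le_of_lt ?_ hε
  have : |t| ≤ 1 := abs_le.2 ht
  have h0 : (0 : ℝ) < ε := hpos
  calc |t| * ε * ‖ω‖ ≤ 1 * ε * ‖ω‖ := by gcongr
    _ = ε * ‖ω‖ := by ring

section Interior

set_option maxSynthPendingDepth 5

variable {c : Euc n → Euc n → ℝ} {U V : Set (Euc n)} {x y : Euc n}

theorem B0.iteratedDeriv_two_cost (h : B0 c U V) (hx : x ∈ U) {η : ℝ → Euc n} {T : Set ℝ}
    (hT : IsOpen T) (hη : ContDiffOn ℝ 2 η T) {t : ℝ} (ht : t ∈ T) (hy : η t ∈ V) :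
    iteratedDeriv 2 (fun s => c x (η s)) t =
      costDeriv₂ c (x, η t) (0, deriv η t) (0, deriv η t) +
        inner ℝ (gradY c U V x (η t)) (deriv (deriv η) t) := by
  have hp : (x, η t) ∈ U ×ˢ V := ⟨hx, hy⟩
  rw [← h.costDeriv_snd hx hy]
  refine iteratedDeriv_two_comp_prodMk (Ψ := fun p : Euc n × Euc n => c p.1 p.2)
    hT hη ht ?_ (hasFDerivAt_costDeriv h.1 h.2.1 h.contDiffOn hp)
  filter_upwards [(h.1.prod h.2.1).mem_nhds hp] with p hp'
  exact hasFDerivAt_cost h.1 h.2.1 h.contDiffOn hp'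

theorem contDiffOn_costDeriv₂_coordCurve (h : B0 c U V) (h1 : B1 c U V) (hy : y ∈ V)
    (a ω η : Euc n) :
    ContDiffOn ℝ 2 (fun s => costDeriv₂ c
      (coordCurve (fun x => -gradY c U V x y) U a ω s, y) (0, η) (0, η))
      {t : ℝ | a + t • ω ∈ (fun x => -gradY c U V x y) '' U} := by
  have hcurve : ContDiffOn ℝ 2 (coordCurve (fun x => -gradY c U V x y) U a ω)
      {t : ℝ | a + t • ω ∈ (fun x => -gradY c U V x y) '' U} :=
    contDiffOn_coordCurve ((coordX_spec h h1 hy).2.of_le (by norm_num))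
  have hD : ContDiffOn ℝ 2 (fun s => costDeriv₂ c
      (coordCurve (fun x => -gradY c U V x y) U a ω s, y))
      {t : ℝ | a + t • ω ∈ (fun x => -gradY c U V x y) '' U} :=
    (contDiffOn_costDeriv₂ h.1 h.2.1 h.contDiffOn).comp (hcurve.prodMk contDiffOn_const)
      fun t ht => ⟨coordCurve_mem ht, hy⟩
  exact (hD.clm_apply contDiffOn_const).clm_apply contDiffOn_const

/-- Non-negative cross-curvature, as concavity of `D²_{yy} c(·, y)(η, η)` along `c`-segments. -/
theorem iteratedDeriv_costDeriv₂_coordCurve_nonpos (h : B0 c U V) (h1 : B1 c U V)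
    (h3 : B3 c U V) (hx : x ∈ U) (hy : y ∈ V) (ω η : Euc n) :
    iteratedDeriv 2 (fun s => costDeriv₂ c
      (coordCurve (fun x => -gradY c U V x y) U (-gradY c U V x y) ω s, y) (0, η) (0, η)) 0
      ≤ 0 := by
  set φ : Euc n → Euc n := fun x => -gradY c U V x y with hφ
  set ψ : Euc n → Euc n := fun y => -gradX c U V x y with hψ
  have hinjφ : InjOn φ U := (h1.1 y (subset_closure hy)).mono subset_closure
  have hinjψ : InjOn ψ V := (h1.2.1 x (subset_closure hx)).mono subset_closure
  have hφs := coordX_spec h h1 hy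
  have hψs := coordY_spec h h1 hx
  -- The derivative of ψ at y is -Mᵀ, with M the mixed derivative at (x, y), so this direction in
  -- the ψ coordinate gives the curve ζ the velocity ε • η.
  set χ : Euc n := -ContinuousLinearMap.adjoint (mixedHessBar c U V x y) η with hχ
  -- (B3) tests curves defined on all of [-1,1]. Both directions are shrunk by ε to stay in the open
  -- images, at the cost of a harmless factor ε⁴.
  obtain ⟨ε, ⟨hε1, hε2⟩, hε⟩ := ((exists_pos_forall_smul_mem hφs.1 (mem_image_of_mem φ hx) ω).and
    (exists_pos_forall_smul_mem hψs.1 (mem_image_of_mem ψ hy) χ)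
      |>.and self_mem_nhdsWithin).exists
  have hε0 : (0 : ℝ) < ε := hε
  set ξ : ℝ → Euc n := coordCurve φ U (φ x) ω with hξ
  set ζ : ℝ → Euc n := coordCurve ψ V (ψ y) (ε • χ) with hζ
  have hζ0 : ζ 0 = y := coordCurve_eq hinjψ hy (by simp)
  have hξ0 : ξ 0 = x := coordCurve_eq hinjφ hx (by simp)
  have hζdom : ∀ t ∈ Icc (-1 : ℝ) 1, ψ y + t • (ε • χ) ∈ ψ '' V := fun t ht => by
    rw [smul_smul]; exact hε2 t ht
  have h01 : (0 : ℝ) ∈ Icc (-1 : ℝ) 1 := by constructor <;> norm_num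
  have hb := h3 (fun s => ξ (ε * s)) ζ (fun t ht => ⟨subset_closure (coordCurve_mem (by
      rw [mul_comm]; exact hε1 t ht)), subset_closure (coordCurve_mem (hζdom t ht))⟩)
    ⟨(-φ x, -ψ y), (-(ε • ω), -(ε • χ)), fun t ht => by
      have e1 : φ (ξ (ε * t)) = φ x + (ε * t) • ω := map_coordCurve (by
        rw [mul_comm]; exact hε1 t ht)
      have e2 : ψ (ζ t) = ψ y + t • (ε • χ) := map_coordCurve (hζdom t ht)
      refine Prod.ext ?_ ?_
      · have : gradY c U V (ξ (ε * t)) y = -φ (ξ (ε * t)) := by simp [hφ]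
        simp only [hζ0, this, e1, Prod.smul_mk, Prod.mk_add_mk]
        module
      · have : gradX c U V x (ζ t) = -ψ (ζ t) := by simp [hψ]
        simp only [mul_zero, hξ0, this, e2, Prod.smul_mk, Prod.mk_add_mk]
        module⟩
  have hζderiv : deriv ζ 0 = ε • η := by
    have hd : HasFDerivAt ψ (-ContinuousLinearMap.adjoint (mixedHessBar c U V x y)) (ζ 0) := by
      rw [hζ0]; exact (h.hasFDerivAt_gradX hx hy).neg
    have := hasFDerivAt_apply_deriv_coordCurve hψs.1 (hψs.2.of_le (by norm_num))
      (hζdom 0 h01) hd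
    have hinj := (isInvertible_adjoint
      (h1.2.2 x (subset_closure hx) y (subset_closure hy))).injective
    apply hinj
    rw [map_smul]
    have h5 : -(ContinuousLinearMap.adjoint (mixedHessBar c U V x y)) (deriv ζ 0) = ε • χ := this
    rw [hχ, smul_neg, neg_inj] at h5
    exact h5
  have hTξ : IsOpen {t : ℝ | φ x + t • ω ∈ φ '' U} := isOpen_coordCurve_domain hφs.1
  have h0ξ : (0 : ℝ) ∈ {t : ℝ | φ x + t • ω ∈ φ '' U} := by
    simpa using mem_image_of_mem φ hx
  set k : ℝ → ℝ := fun s => costDeriv₂ c (ξ s, y) (0, η) (0, η) with hk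
  have hkc : ContDiffOn ℝ 2 k {t : ℝ | φ x + t • ω ∈ φ '' U} :=
    contDiffOn_costDeriv₂_coordCurve h h1 hy _ _ _
  -- The second t-derivative of the cost is ε²k(εs) plus D_y c paired with ζ''(0). The latter is
  -- affine in s because ξ is straight in the coordinate D_y c(·,y), so only k survives the second
  -- s-derivative.
  have hev : (fun s => iteratedDeriv 2 (fun t => c (ξ (ε * s)) (ζ t)) 0) =ᶠ[𝓝 0]
      fun s => ε ^ 2 * k (ε * s) + (-inner ℝ (φ x) (deriv (deriv ζ) 0) +
        s * (-(ε * inner ℝ ω (deriv (deriv ζ) 0)))) := by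
    have hcont : Tendsto (fun s : ℝ => ε * s) (𝓝 0) (𝓝 0) := by
      have : Continuous fun s : ℝ => ε * s := by fun_prop
      simpa using this.tendsto 0
    filter_upwards [hcont.eventually (hTξ.mem_nhds h0ξ)] with s hs
    have hζV : ζ 0 ∈ V := by rw [hζ0]; exact hy
    have e0 := h.iteratedDeriv_two_cost (x := ξ (ε * s)) (coordCurve_mem hs)
      (isOpen_coordCurve_domain hψs.1) (contDiffOn_coordCurve (hψs.2.of_le (by norm_num)))
      (hζdom 0 h01) hζV
    have e1 : φ (ξ (ε * s)) = φ x + (ε * s) • ω := map_coordCurve hs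
    have e2 : gradY c U V (ξ (ε * s)) y = -(φ x + (ε * s) • ω) := by rw [← e1]; simp [hφ]
    change iteratedDeriv 2 (fun t => c (ξ (ε * s)) (ζ t)) 0 = _
    rw [e0, ← hζ, hζ0, hζderiv, e2]
    have e3 : ((0 : Euc n), ε • η) = ε • ((0 : Euc n), η) := by simp
    rw [e3, map_smul, map_smul, _root_.smul_apply, smul_eq_mul, smul_eq_mul,
      inner_neg_left, inner_add_left, real_inner_smul_left]
    simp only [hk]
    ring
  rw [hev.iteratedDeriv_eq, iteratedDeriv_two_rescale hTξ h0ξ hkc] at hb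
  have : 0 < ε ^ 2 * ε ^ 2 := by positivity
  by_contra hcon
  push Not at hcon
  have := mul_pos this hcon
  nlinarith

end Interior

end OptTransport

namespace OptTransport

variable {n : ℕ}

section Interior

set_option maxSynthPendingDepth 5

variable {c : Euc n → Euc n → ℝ} {U V : Set (Euc n)} {x y : Euc n}

theorem add_smul_mem_of_mem_Icc {E : Type*} [AddCommGroup E] [Module ℝ E] {S : Set E}
    (hS : Convex ℝ S) {a b : E} (ha : a ∈ S) (hb : b ∈ S) {t : ℝ} (ht : t ∈ Icc (0 : ℝ) 1) :
    a + t • (b - a) ∈ S :=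
  hS.add_smul_sub_mem ha hb ht

/-- The second derivative along a `c`-segment `η` with respect to `x₀` of
`t ↦ c(x₀, η(t)) - c(x₁, η(t))` is non-negative. -/
theorem iteratedDeriv_two_cost_sub_nonneg (h : B0 c U V) (h1 : B1 c U V) (h2 : B2 c U V)
    (h3 : B3 c U V) {x₀ x₁ : Euc n} (hx₀ : x₀ ∈ U) (hx₁ : x₁ ∈ U) {η : ℝ → Euc n} {T : Set ℝ}
    (hT : IsOpen T) (hη : ContDiffOn ℝ 2 η T) (hηV : ∀ t ∈ T, η t ∈ V) {a ω : Euc n}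
    (hlin : ∀ t ∈ T, gradX c U V x₀ (η t) = a + t • ω) {t : ℝ} (ht : t ∈ T) :
    iteratedDeriv 2 (fun s => c x₁ (η s)) t - iteratedDeriv 2 (fun s => c x₀ (η s)) t ≤ 0 := by
  have hy := hηV t ht
  set y := η t with hydef
  rw [h.iteratedDeriv_two_cost hx₁ hT hη ht hy, h.iteratedDeriv_two_cost hx₀ hT hη ht hy,
    ← hydef]
  set η₁ := deriv η t with hη₁
  set η₂ := deriv (deriv η) t with hη₂
  set φ : Euc n → Euc n := fun x => -gradY c U V x y with hφ
  have hinj : InjOn φ U := (h1.1 y (subset_closure hy)).mono subset_closure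
  have hφs := coordX_spec h h1 hy
  set d : Euc n := φ x₁ - φ x₀ with hd
  set ξ : ℝ → Euc n := coordCurve φ U (φ x₀) d with hξ
  set S : Set ℝ := {s : ℝ | φ x₀ + s • d ∈ φ '' U} with hS
  have hSopen : IsOpen S := isOpen_coordCurve_domain hφs.1
  have hIcc : Icc (0 : ℝ) 1 ⊆ S := fun s hs =>
    add_smul_mem_of_mem_Icc (h2.1 y (subset_closure hy)) (mem_image_of_mem φ hx₀)
      (mem_image_of_mem φ hx₁) hs
  have h0S : (0 : ℝ) ∈ S := hIcc ⟨le_rfl, zero_le_one⟩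
  have hξ0 : ξ 0 = x₀ := coordCurve_eq hinj hx₀ (by simp)
  have hξ1 : ξ 1 = x₁ := coordCurve_eq hinj hx₁ (by simp [hd])
  set k : ℝ → ℝ := fun s => costDeriv₂ c (ξ s, y) (0, η₁) (0, η₁) with hk
  have hkc : ContDiffOn ℝ 2 k S := contDiffOn_costDeriv₂_coordCurve h h1 hy _ _ _
  -- Concavity of k on the whole segment: the infinitesimal statement is applied at each ξ s, the
  -- same curve restarted from there.
  have hconc := sub_le_deriv_of_iteratedDeriv_nonpos hSopen hIcc hkc fun s hs => by
    have hsU : ξ s ∈ U := coordCurve_mem (hIcc hs)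
    have hnp := iteratedDeriv_costDeriv₂_coordCurve_nonpos h h1 h3 hsU hy d η₁
    have e1 : -gradY c U V (ξ s) y = φ x₀ + s • d := map_coordCurve (hIcc hs)
    have e2 : (fun σ => costDeriv₂ c
        (coordCurve (fun x => -gradY c U V x y) U (-gradY c U V (ξ s) y) d σ, y) (0, η₁) (0, η₁))
        = fun σ => k (s + σ) := by
      funext σ
      have : coordCurve (fun x => -gradY c U V x y) U (-gradY c U V (ξ s) y) d σ = ξ (s + σ) := by
        rw [e1, hξ, coordCurve, coordCurve, add_assoc, ← add_smul]
      rw [this]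
    rw [e2, iteratedDeriv_comp_const_add] at hnp
    simpa using hnp
  have hξd : HasDerivAt ξ (deriv ξ 0) 0 := (hasDerivAt_deriv_of_contDiffOn hSopen
    (contDiffOn_coordCurve (hφs.2.of_le (by norm_num))) h0S).1
  set v := deriv ξ 0 with hv
  have hp : (x₀, y) ∈ U ×ˢ V := ⟨hx₀, hy⟩
  have hMv : mixedHessBar c U V x₀ y v = -d := by
    have := hasFDerivAt_apply_deriv_coordCurve hφs.1 (hφs.2.of_le (by norm_num)) h0S
      (φ' := -mixedHessBar c U V x₀ y) (by
        rw [← hξ, hξ0]; exact (h.hasFDerivAt_gradY hx₀ hy).neg)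
    rw [← this]
    simp [hv, hξ, hφ]
  have hkd : deriv k 0 = costDeriv₃ c (x₀, y) (v, 0) (0, η₁) (0, η₁) := by
    have hpair : HasDerivAt (fun s => (ξ s, y)) (v, 0) 0 := hξd.prodMk (hasDerivAt_const 0 y)
    have hD : HasFDerivAt (costDeriv₂ c) (costDeriv₃ c (x₀, y)) (ξ 0, y) := by
      rw [hξ0]; exact hasFDerivAt_costDeriv₂ h.1 h.2.1 h.contDiffOn hp
    have e1 : HasDerivAt (fun s => costDeriv₂ c (ξ s, y)) (costDeriv₃ c (x₀, y) (v, 0)) 0 :=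
      hD.comp_hasDerivAt 0 hpair
    have e2 := (e1.clm_apply (hasDerivAt_const 0 ((0 : Euc n), η₁))).clm_apply
      (hasDerivAt_const 0 ((0 : Euc n), η₁))
    have e3 : HasDerivAt k _ 0 := e2
    rw [e3.deriv]
    simp
  -- D_x c(x₀, η) is affine along η, so the second t-derivative of its pairing with v vanishes. This
  -- converts the third derivative k'(0) into ⟨d, η''⟩, which cancels the difference of the two
  -- terms containing η''.
  have hthird : costDeriv₃ c (x₀, y) (0, η₁) (0, η₁) (v, 0) +
      costDeriv₂ c (x₀, y) (0, η₂) (v, 0) = 0 := by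
    have e1 := iteratedDeriv_two_comp_prodMk (Ψ := fun p => costDeriv c p (v, 0))
      (Ψ' := fun p => (ContinuousLinearMap.apply ℝ ℝ ((v, 0) : Euc n × Euc n)).comp
        (costDeriv₂ c p))
      (Ψ'' := (ContinuousLinearMap.compL ℝ (Euc n × Euc n) (Euc n × Euc n →L[ℝ] ℝ) ℝ
        (ContinuousLinearMap.apply ℝ ℝ ((v, 0) : Euc n × Euc n))).comp (costDeriv₃ c (x₀, y)))
      hT hη ht (x := x₀) ?_ ?_
    · have e2 : (fun s => costDeriv c (x₀, η s) (v, 0)) =ᶠ[𝓝 t]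
          fun s => inner ℝ a v + s * inner ℝ ω v := by
        filter_upwards [hT.mem_nhds ht] with s hs
        rw [h.costDeriv_fst hx₀ (hηV s hs), hlin s hs, inner_add_left, real_inner_smul_left]
      rw [e2.iteratedDeriv_eq] at e1
      have e3 : iteratedDeriv 2 (fun s : ℝ => inner ℝ a v + s * inner ℝ ω v) t = 0 := by
        refine iteratedDeriv_two_eq (g₁ := fun _ => inner ℝ ω v)
          (Eventually.of_forall fun s => ?_) (hasDerivAt_const t _)
        simpa using ((hasDerivAt_id s).mul_const (inner ℝ ω v)).const_add (inner ℝ a v)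
      rw [e3] at e1
      exact e1.symm
    · filter_upwards [(h.1.prod h.2.1).mem_nhds hp] with p hp'
      exact (ContinuousLinearMap.apply ℝ ℝ ((v, 0) : Euc n × Euc n)).hasFDerivAt.comp p
        (hasFDerivAt_costDeriv h.1 h.2.1 h.contDiffOn hp')
    · exact (ContinuousLinearMap.compL ℝ (Euc n × Euc n) (Euc n × Euc n →L[ℝ] ℝ) ℝ
        (ContinuousLinearMap.apply ℝ ℝ ((v, 0) : Euc n × Euc n))).hasFDerivAt.comp (x₀, y)
        (hasFDerivAt_costDeriv₂ h.1 h.2.1 h.contDiffOn hp)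
  have hkd' : deriv k 0 = inner ℝ d η₂ := by
    rw [hkd, costDeriv₃_comm h.1 h.2.1 h.contDiffOn hp,
      costDeriv₃_comm_right h.1 h.2.1 h.contDiffOn hp]
    have e1 : costDeriv₂ c (x₀, y) (0, η₂) (v, 0) = -inner ℝ d η₂ := by
      rw [costDeriv₂_comm h.1 h.2.1 h.contDiffOn hp, h.costDeriv₂_mixed hx₀ hy, hMv,
        inner_neg_left]
    linarith
  rw [hkd'] at hconc
  simp only [hk, hξ1, hξ0] at hconc
  have e4 : inner ℝ d η₂ = -inner ℝ (gradY c U V x₁ y) η₂ + inner ℝ (gradY c U V x₀ y) η₂ := by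
    simp only [hd, hφ, inner_sub_left, inner_neg_left]
    ring
  linarith

/-- The cross-difference of the cost is dominated by its value for the bilinear cost with the same
mixed second derivative at `(x₀, y₀)`, in the coordinates given by the gradients. -/
theorem cross_difference_le_of_mem (h : B0 c U V) (h1 : B1 c U V) (h2 : B2 c U V) (h3 : B3 c U V)
    {x₀ x₁ y₀ y₁ : Euc n} (hx₀ : x₀ ∈ U) (hx₁ : x₁ ∈ U) (hy₀ : y₀ ∈ V) (hy₁ : y₁ ∈ V) :
    c x₁ y₁ - c x₀ y₁ - c x₁ y₀ + c x₀ y₀ ≤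
      inner ℝ ((mixedHessBar c U V x₀ y₀).inverse (gradY c U V x₁ y₀ - gradY c U V x₀ y₀))
        (gradX c U V x₀ y₁ - gradX c U V x₀ y₀) := by
  set ψ : Euc n → Euc n := fun y => -gradX c U V x₀ y with hψ
  have hinj : InjOn ψ V := (h1.2.1 x₀ (subset_closure hx₀)).mono subset_closure
  have hψs := coordY_spec h h1 hx₀
  set ω : Euc n := ψ y₁ - ψ y₀ with hω
  set η : ℝ → Euc n := coordCurve ψ V (ψ y₀) ω with hη
  set T : Set ℝ := {t : ℝ | ψ y₀ + t • ω ∈ ψ '' V} with hT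
  have hTopen : IsOpen T := isOpen_coordCurve_domain hψs.1
  have hIcc : Icc (0 : ℝ) 1 ⊆ T := fun s hs =>
    add_smul_mem_of_mem_Icc (h2.2 x₀ (subset_closure hx₀)) (mem_image_of_mem ψ hy₀)
      (mem_image_of_mem ψ hy₁) hs
  have h0T : (0 : ℝ) ∈ T := hIcc ⟨le_rfl, zero_le_one⟩
  have hη0 : η 0 = y₀ := coordCurve_eq hinj hy₀ (by simp)
  have hη1 : η 1 = y₁ := coordCurve_eq hinj hy₁ (by simp [hω])
  have hηc : ContDiffOn ℝ 2 η T := contDiffOn_coordCurve (hψs.2.of_le (by norm_num))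
  have hηV : ∀ t ∈ T, η t ∈ V := fun t ht => coordCurve_mem ht
  have hcc : ∀ x ∈ U, ContDiffOn ℝ 2 (fun t => c x (η t)) T := fun x hx =>
    (h.contDiffOn.of_le (by norm_num)).comp (contDiffOn_const.prodMk hηc)
      fun t ht => ⟨hx, hηV t ht⟩
  have hcd : ∀ x ∈ U, ∀ t ∈ T, HasDerivAt (fun t => c x (η t))
      (inner ℝ (gradY c U V x (η t)) (deriv η t)) t := by
    intro x hx t ht
    rw [← h.costDeriv_snd hx (hηV t ht)]
    exact (hasFDerivAt_cost h.1 h.2.1 h.contDiffOn (p := (x, η t))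
      ⟨hx, hηV t ht⟩).comp_hasDerivAt t
      ((hasDerivAt_const t x).prodMk (hasDerivAt_deriv_of_contDiffOn hTopen hηc ht).1)
  -- The difference of costs is concave along η, so its increment is at most its initial slope. That
  -- slope is expressed below through Mᵀ η'(0), which is the increment of D_x c(x₀,·).
  have hmain := sub_le_deriv_of_iteratedDeriv_nonpos hTopen hIcc
    (k := fun t => c x₁ (η t) - c x₀ (η t)) ((hcc x₁ hx₁).sub (hcc x₀ hx₀)) fun t ht => by
      have ht' := hIcc ht
      have e1 := iteratedDeriv_two_cost_sub_nonneg h h1 h2 h3 hx₀ hx₁ hTopen hηc hηV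
        (a := -ψ y₀) (ω := -ω) (fun s hs => by
          have e1 : ψ (η s) = ψ y₀ + s • ω := map_coordCurve hs
          have e2 : gradX c U V x₀ (η s) = -ψ (η s) := by simp [hψ]
          rw [e2, e1]; module) ht'
      refine le_trans (le_of_eq ?_) e1
      exact iteratedDeriv_fun_sub ((hcc x₁ hx₁).contDiffAt (hTopen.mem_nhds ht'))
        ((hcc x₀ hx₀).contDiffAt (hTopen.mem_nhds ht'))
  have hd0 : HasDerivAt (fun t => c x₁ (η t) - c x₀ (η t)) _ 0 :=
    (hcd x₁ hx₁ 0 h0T).sub (hcd x₀ hx₀ 0 h0T)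
  rw [hd0.deriv] at hmain
  simp only [hη0, hη1] at hmain
  have hMd : ContinuousLinearMap.adjoint (mixedHessBar c U V x₀ y₀) (deriv η 0) =
      gradX c U V x₀ y₁ - gradX c U V x₀ y₀ := by
    have := hasFDerivAt_apply_deriv_coordCurve hψs.1 (hψs.2.of_le (by norm_num)) h0T
      (φ' := -ContinuousLinearMap.adjoint (mixedHessBar c U V x₀ y₀)) (by
        rw [← hη, hη0]; exact (h.hasFDerivAt_gradX hx₀ hy₀).neg)
    rw [neg_apply, ← hη] at this
    rw [← neg_inj, this]
    simp only [hω, hψ]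
    module
  rw [← hMd, ContinuousLinearMap.adjoint_inner_right]
  have hself : mixedHessBar c U V x₀ y₀ ((mixedHessBar c U V x₀ y₀).inverse
      (gradY c U V x₁ y₀ - gradY c U V x₀ y₀)) = gradY c U V x₁ y₀ - gradY c U V x₀ y₀ := by
    obtain ⟨e, he⟩ := h1.2.2 x₀ (subset_closure hx₀) y₀ (subset_closure hy₀)
    rw [← he]; simp
  rw [hself, inner_sub_left]
  linarith

end Interior

end OptTransport

namespace OptTransport

variable {n : ℕ}

/-! ### Essential suprema of continuous functions -/

/-- If the value at p exceeded the essential supremum, so would the values on a nonempty open set,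
which has positive measure. No measurability of A is involved, which suits A = Z × V. -/
theorem enorm_le_eLpNorm_top {X F : Type*} [TopologicalSpace X] [MeasurableSpace X]
    [OpensMeasurableSpace X] [NormedAddCommGroup F] {μ : Measure X} [μ.IsOpenPosMeasure]
    {f g : X → F} {Ω A : Set X} (hΩ : IsOpen Ω) (hA : Ω ⊆ A) (hg : ContinuousOn g Ω)
    (hfg : EqOn f g Ω) {p : X} (hp : p ∈ Ω) :
    ‖g p‖ₑ ≤ eLpNorm f ∞ (μ.restrict A) := by
  by_contra hlt
  push Not at hlt
  have hopen : IsOpen (Ω ∩ (fun x => ‖g x‖ₑ) ⁻¹' Ioi (eLpNorm f ∞ (μ.restrict A))) :=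
    hg.enorm.isOpen_inter_preimage hΩ isOpen_Ioi
  have hpos := hopen.measure_pos μ ⟨p, hp, hlt⟩
  have hae : ∀ᵐ x ∂(μ.restrict Ω), ‖f x‖ₑ ≤ eLpNorm f ∞ (μ.restrict A) := by
    rw [eLpNorm_exponent_top]
    exact ae_mono (Measure.restrict_mono hA le_rfl) ae_le_eLpNormEssSup
  rw [ae_restrict_iff' hΩ.measurableSet, ae_iff] at hae
  refine hpos.ne' (measure_mono_null (fun x hx => ?_) hae)
  simp only [mem_ofPred_eq, Classical.not_imp, not_le]
  refine ⟨hx.1, ?_⟩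
  rw [hfg hx.1]
  exact hx.2

theorem eLpNorm_top_spec {X F : Type*} [TopologicalSpace X] [MeasurableSpace X]
    [OpensMeasurableSpace X] [NormedAddCommGroup F] {μ : Measure X} [μ.IsOpenPosMeasure]
    {f g : X → F} {Ω : Set X} (hΩ : IsOpen Ω) (hcomp : IsCompact (closure Ω))
    (hg : ContinuousOn g (closure Ω)) (hfg : EqOn f g Ω) :
    eLpNorm f ∞ (μ.restrict Ω) < ∞ ∧
      ∀ p ∈ Ω, ‖g p‖ ≤ (eLpNorm f ∞ (μ.restrict Ω)).toReal := by
  obtain ⟨B, hB⟩ := hcomp.exists_bound_of_continuousOn hg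
  have hfin : eLpNorm f ∞ (μ.restrict Ω) < ∞ := by
    rw [eLpNorm_exponent_top]
    refine eLpNormEssSup_lt_top_of_ae_bound (C := B) ?_
    filter_upwards [ae_restrict_mem hΩ.measurableSet] with p hp
    rw [hfg hp]
    exact hB p (subset_closure hp)
  refine ⟨hfin, fun p hp => ?_⟩
  have := enorm_le_eLpNorm_top (μ := μ) hΩ subset_rfl (hg.mono subset_closure) hfg hp
  rw [← toReal_enorm]
  exact ENNReal.toReal_mono hfin.ne this

/-! ### Cost-exponential coordinates up to the boundary -/

noncomputable section

/-- The inverse of the mixed second derivative, on the closure of `U × V`. -/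
def invHess (c : Euc n → Euc n → ℝ) (U V : Set (Euc n)) (x y : Euc n) : Euc n →L[ℝ] Euc n :=
  (mixedHessBar c U V x y).inverse

/-- The gradient `-D_q c̃(q, y)` of the modified cost, at `q = q(x)`. -/
def coordGrad (c : Euc n → Euc n → ℝ) (U V : Set (Euc n)) (y₀ x y : Euc n) : Euc n :=
  ContinuousLinearMap.adjoint (invHess c U V x y₀) (gradX c U V x y - gradX c U V x y₀)

/-- `ε_c⁻¹` as a real number. -/
def costScale (c : Euc n → Euc n → ℝ) (U V : Set (Euc n)) : ℝ := ((epsCost c U V)⁻¹).toReal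

end

variable {c : Euc n → Euc n → ℝ} {U V : Set (Euc n)} {x y : Euc n}

section Closure

theorem B0.continuousOn_gradX (h : B0 c U V) :
    ContinuousOn (fun p : Euc n × Euc n => gradX c U V p.1 p.2) (closure U ×ˢ closure V) := by
  rw [← closure_prod_eq]; exact h.gradX_spec.1

theorem B0.continuousOn_gradY (h : B0 c U V) :
    ContinuousOn (fun p : Euc n × Euc n => gradY c U V p.1 p.2) (closure U ×ˢ closure V) := by
  rw [← closure_prod_eq]; exact h.gradY_spec.1

theorem B0.continuousOn_mixedHessBar (h : B0 c U V) :
    ContinuousOn (fun p : Euc n × Euc n => mixedHessBar c U V p.1 p.2)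
      (closure U ×ˢ closure V) := by
  rw [← closure_prod_eq]; exact h.mixedHessBar_spec.1

theorem B0.continuousOn_cost (h : B0 c U V) :
    ContinuousOn (fun p : Euc n × Euc n => c p.1 p.2) (closure U ×ˢ closure V) := by
  rw [← closure_prod_eq]; exact h.2.2.2.2.1

theorem B0.isCompact_left (h : B0 c U V) : IsCompact (closure U) := h.2.2.1.isCompact_closure

theorem B0.isCompact_right (h : B0 c U V) : IsCompact (closure V) :=
  h.2.2.2.1.isCompact_closure

theorem B0.continuousOn_invHess (h : B0 c U V) (h1 : B1 c U V) :
    ContinuousOn (fun p : Euc n × Euc n => invHess c U V p.1 p.2) (closure U ×ˢ closure V) := by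
  intro p hp
  have h2 : ContinuousAt ContinuousLinearMap.inverse (mixedHessBar c U V p.1 p.2) :=
    ((h1.2.2 p.1 hp.1 p.2 hp.2).contDiffAt_map_inverse (n := 0)).continuousAt
  exact h2.comp_continuousWithinAt (f := fun p : Euc n × Euc n => mixedHessBar c U V p.1 p.2)
    (h.continuousOn_mixedHessBar p hp)

theorem invHess_apply_mixedHessBar (h1 : B1 c U V) (hx : x ∈ closure U) (hy : y ∈ closure V)
    (v : Euc n) : invHess c U V x y (mixedHessBar c U V x y v) = v :=
  (h1.2.2 x hx y hy).inverse_apply_self v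

theorem mixedHessBar_apply_invHess (h1 : B1 c U V) (hx : x ∈ closure U) (hy : y ∈ closure V)
    (v : Euc n) : mixedHessBar c U V x y (invHess c U V x y v) = v :=
  (h1.2.2 x hx y hy).self_apply_inverse v

/-- Restriction of a function continuous on `closure U × closure V` to a slice, precomposed. -/
theorem continuousOn_slice {X F : Type*} [TopologicalSpace X] [TopologicalSpace F]
    {f : Euc n × Euc n → F} {A B : Set (Euc n)} (hf : ContinuousOn f (A ×ˢ B))
    {s : Set X} {g₁ g₂ : X → Euc n} (hg₁ : ContinuousOn g₁ s) (hg₂ : ContinuousOn g₂ s)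
    (h₁ : MapsTo g₁ s A) (h₂ : MapsTo g₂ s B) : ContinuousOn (fun z => f (g₁ z, g₂ z)) s :=
  hf.comp (hg₁.prodMk hg₂) fun _ hz => ⟨h₁ hz, h₂ hz⟩

/-- The focus ỹ may lie on the boundary of V, so both second arguments are passed to the closure by
continuity, while the first ones stay in U. -/
theorem cross_difference_le (h : B0 c U V) (h1 : B1 c U V) (h2 : B2 c U V) (h3 : B3 c U V)
    {x₀ x₁ y₀ y₁ : Euc n} (hx₀ : x₀ ∈ U) (hx₁ : x₁ ∈ U) (hy₀ : y₀ ∈ closure V)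
    (hy₁ : y₁ ∈ closure V) :
    c x₁ y₁ - c x₀ y₁ - c x₁ y₀ + c x₀ y₀ ≤
      inner ℝ (invHess c U V x₀ y₀ (gradY c U V x₁ y₀ - gradY c U V x₀ y₀))
        (gradX c U V x₀ y₁ - gradX c U V x₀ y₀) := by
  have hmem : (y₀, y₁) ∈ closure (V ×ˢ V) := by rw [closure_prod_eq]; exact ⟨hy₀, hy₁⟩
  have cx : ∀ x ∈ U, MapsTo (fun _ : Euc n × Euc n => x) (closure V ×ˢ closure V) (closure U) :=
    fun x hx _ _ => subset_closure hx
  have m1 : MapsTo (Prod.fst : Euc n × Euc n → Euc n) (closure V ×ˢ closure V) (closure V) :=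
    fun _ hz => hz.1
  have m2 : MapsTo (Prod.snd : Euc n × Euc n → Euc n) (closure V ×ˢ closure V) (closure V) :=
    fun _ hz => hz.2
  have cost1 := fun x hx => continuousOn_slice h.continuousOn_cost continuousOn_const
    continuousOn_fst (cx x hx) m1
  have cost2 := fun x hx => continuousOn_slice h.continuousOn_cost continuousOn_const
    continuousOn_snd (cx x hx) m2
  have gX1 := continuousOn_slice h.continuousOn_gradX continuousOn_const
    continuousOn_fst (cx x₀ hx₀) m1
  have gX2 := continuousOn_slice h.continuousOn_gradX continuousOn_const
    continuousOn_snd (cx x₀ hx₀) m2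
  have gY := fun x hx => continuousOn_slice h.continuousOn_gradY continuousOn_const
    continuousOn_fst (cx x hx) m1
  have hN := continuousOn_slice (h.continuousOn_invHess h1) continuousOn_const
    continuousOn_fst (cx x₀ hx₀) m1
  refine le_on_closure (s := V ×ˢ V)
    (f := fun z : Euc n × Euc n => c x₁ z.2 - c x₀ z.2 - c x₁ z.1 + c x₀ z.1)
    (g := fun z : Euc n × Euc n =>
      inner ℝ (invHess c U V x₀ z.1 (gradY c U V x₁ z.1 - gradY c U V x₀ z.1))
        (gradX c U V x₀ z.2 - gradX c U V x₀ z.1)) ?_ ?_ ?_ hmem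
  · rintro ⟨z₀, z₁⟩ ⟨hz₀, hz₁⟩
    exact cross_difference_le_of_mem h h1 h2 h3 hx₀ hx₁ hz₀ hz₁
  · rw [closure_prod_eq]
    exact (((cost2 x₁ hx₁).sub (cost2 x₀ hx₀)).sub (cost1 x₁ hx₁)).add (cost1 x₀ hx₀)
  · rw [closure_prod_eq]
    exact (hN.clm_apply ((gY x₁ hx₁).sub (gY x₀ hx₀))).inner (gX2.sub gX1)

/-- `D_y c(·, y)` is strictly differentiable in `U`, also for `y` on the boundary of `V`. -/
theorem B0.hasStrictFDerivAt_gradY (h : B0 c U V) (hx : x ∈ U) (hy : y ∈ closure V) :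
    HasStrictFDerivAt (fun x' => gradY c U V x' y) (mixedHessBar c U V x y) x := by
  refine HasStrictFDerivAt.of_isLittleO (Asymptotics.isLittleO_iff.2 fun ε hε => ?_)
  have hcont : Tendsto (fun p : Euc n × Euc n => mixedHessBar c U V p.1 p.2)
      (𝓝 x ×ˢ 𝓝[V] y) (𝓝 (mixedHessBar c U V x y)) := by
    have h1 := h.continuousOn_mixedHessBar (x, y) ⟨subset_closure hx, hy⟩
    refine h1.tendsto.mono_left ?_
    rw [nhdsWithin_prod_eq]
    exact Filter.prod_mono (le_inf le_rfl (le_principal_iff.2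
      (mem_of_superset (h.1.mem_nhds hx) subset_closure))) (nhdsWithin_mono _ subset_closure)
  have hev := hcont.eventually (Metric.closedBall_mem_nhds _ hε)
  obtain ⟨s, hs, t, ht, hst⟩ := (Filter.eventually_prod_iff.1 hev)
  obtain ⟨r, hr, hball⟩ := Metric.mem_nhds_iff.1 (inter_mem hs (h.1.mem_nhds hx))
  have hnb : (Metric.ball x r) ×ˢ (Metric.ball x r) ∈ 𝓝 (x, x) :=
    prod_mem_nhds (Metric.ball_mem_nhds x hr) (Metric.ball_mem_nhds x hr)
  filter_upwards [hnb] with p hp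
  have hne : (𝓝[V] y).NeBot := mem_closure_iff_nhdsWithin_neBot.1 hy
  have hlim : ∀ z ∈ U, Tendsto (fun y' => gradY c U V z y') (𝓝[V] y) (𝓝 (gradY c U V z y)) := by
    intro z hz
    have := continuousOn_slice h.continuousOn_gradY (s := closure V) (g₁ := fun _ => z)
      (g₂ := id) continuousOn_const continuousOn_id (fun _ _ => subset_closure hz)
      (mapsTo_id _) y hy
    exact this.tendsto.mono_left (nhdsWithin_mono _ subset_closure)
  -- For y' in V the mean value inequality on a ball bounds the linearisation error uniformly in y';
  -- then y' tends to y.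
  refine le_of_tendsto ((((hlim p.1 (hball hp.1).2).sub (hlim p.2 (hball hp.2).2)).sub_const
    (mixedHessBar c U V x y (p.1 - p.2))).norm) ?_
  filter_upwards [ht, self_mem_nhdsWithin] with y' hy't hy'V
  refine Convex.norm_image_sub_le_of_norm_hasFDerivWithin_le'
    (f := fun z => gradY c U V z y') (f' := fun z => mixedHessBar c U V z y')
    (s := Metric.ball x r) (fun z hz =>
      (h.hasFDerivAt_gradY (hball hz).2 hy'V).hasFDerivWithinAt) (fun z hz => ?_)
    (convex_ball x r) hp.2 hp.1
  have := hst (hball hz).1 hy't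
  rwa [dist_eq_norm] at this

theorem isOpen_expDomain (h : B0 c U V) (h1 : B1 c U V) (hy : y ∈ closure V) :
    IsOpen (expDomain c U V y) := by
  refine isOpen_iff_mem_nhds.2 ?_
  rintro _ ⟨x, hx, rfl⟩
  obtain ⟨e, he⟩ := h1.2.2 x (subset_closure hx) y hy
  have hs := (h.hasStrictFDerivAt_gradY hx hy).neg
  have he' : -mixedHessBar c U V x y =
      (((ContinuousLinearEquiv.neg ℝ).trans e : Euc n ≃L[ℝ] Euc n) : Euc n →L[ℝ] Euc n) := by
    rw [← he]; ext1 v; simp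
  rw [he'] at hs
  have hmap := hs.map_nhds_eq_of_equiv
  rw [← show map (fun x' => -gradY c U V x' y) (𝓝 x) = 𝓝 (-gradY c U V x y) from hmap]
  exact image_mem_map (h.1.mem_nhds hx)

theorem B0.continuousOn_coordX (h : B0 c U V) (hy : y ∈ closure V) :
    ContinuousOn (fun x => -gradY c U V x y) (closure U) :=
  (continuousOn_slice h.continuousOn_gradY (s := closure U) (g₁ := id) (g₂ := fun _ => y)
    continuousOn_id continuousOn_const (mapsTo_id _) (fun _ _ => hy)).neg

theorem closure_expDomain (h : B0 c U V) (hy : y ∈ closure V) :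
    closure (expDomain c U V y) = (fun x => -gradY c U V x y) '' closure U := by
  refine subset_antisymm ?_ ((h.continuousOn_coordX hy).image_closure)
  exact closure_minimal (image_mono subset_closure)
    (h.isCompact_left.image_of_continuousOn (h.continuousOn_coordX hy)).isClosed

theorem continuousOn_expInv (h : B0 c U V) (h1 : B1 c U V) (hy : y ∈ closure V) :
    ContinuousOn (expInv c U V y) (closure (expDomain c U V y)) := by
  rw [closure_expDomain h hy]
  exact continuousOn_invFunOn_of_isCompact h.isCompact_left (h.continuousOn_coordX hy)
    (h1.1 y hy)

theorem expInv_mem_closure (h : B0 c U V) (hy : y ∈ closure V) {q : Euc n}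
    (hq : q ∈ closure (expDomain c U V y)) : expInv c U V y q ∈ closure U := by
  rw [closure_expDomain h hy] at hq
  exact Function.invFunOn_mem hq

theorem expInv_coordX (h1 : B1 c U V) (hy : y ∈ closure V) (hx : x ∈ closure U) :
    expInv c U V y (-gradY c U V x y) = x :=
  (h1.1 y hy).leftInvOn_invFunOn hx

theorem expInv_mem (h1 : B1 c U V) (hy : y ∈ closure V) {q : Euc n}
    (hq : q ∈ expDomain c U V y) : expInv c U V y q ∈ U := by
  obtain ⟨x, hx, rfl⟩ := hq
  rw [expInv_coordX h1 hy (subset_closure hx)]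
  exact hx

theorem gradY_expInv (h1 : B1 c U V) (hy : y ∈ closure V) {q : Euc n}
    (hq : q ∈ expDomain c U V y) : gradY c U V (expInv c U V y q) y = -q := by
  obtain ⟨x, hx, rfl⟩ := hq
  rw [expInv_coordX h1 hy (subset_closure hx), neg_neg]

theorem hasFDerivAt_expInv (h : B0 c U V) (h1 : B1 c U V) (hy : y ∈ closure V) {q : Euc n}
    (hq : q ∈ expDomain c U V y) :
    HasFDerivAt (expInv c U V y) (-invHess c U V (expInv c U V y q) y) q := by
  have hxU := expInv_mem h1 hy hq
  set x := expInv c U V y q with hx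
  obtain ⟨e, he⟩ := h1.2.2 x (subset_closure hxU) y hy
  have hopen := isOpen_expDomain h h1 hy
  have hf : HasFDerivAt (fun x' => -gradY c U V x' y)
      (((ContinuousLinearEquiv.neg ℝ).trans e : Euc n ≃L[ℝ] Euc n) : Euc n →L[ℝ] Euc n)
      (expInv c U V y q) := by
    refine (h.hasStrictFDerivAt_gradY hxU hy).hasFDerivAt.neg.congr_fderiv ?_
    rw [← he]; ext1 v; simp
  have hg : ContinuousAt (expInv c U V y) q :=
    (continuousOn_expInv h h1 hy).continuousAt
      (mem_of_superset (hopen.mem_nhds hq) subset_closure)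
  refine (HasFDerivAt.of_local_left_inverse hg hf ?_).congr_fderiv ?_
  · filter_upwards [hopen.mem_nhds hq] with q' hq'
    rw [gradY_expInv h1 hy hq', neg_neg]
  · rw [invHess, ← he]
    ext1 v
    simp

end Closure

end OptTransport

namespace OptTransport

variable {n : ℕ} {c : Euc n → Euc n → ℝ} {U V : Set (Euc n)} {x y : Euc n}

/-! ### The constants of the cost -/

section Bounds

set_option maxSynthPendingDepth 5

theorem betaPlus_spec (h : B0 c U V) : betaPlus c U V < ∞ ∧
    ∀ x ∈ U, ∀ y ∈ V, ‖mixedHessBar c U V x y‖ ≤ (betaPlus c U V).toReal := by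
  have := eLpNorm_top_spec (μ := (volume : Measure (Euc n × Euc n)))
    (f := fun p : Euc n × Euc n => mixedHess c p.1 p.2)
    (g := fun p => mixedHessBar c U V p.1 p.2) (Ω := U ×ˢ V) (h.1.prod h.2.1)
    (by rw [closure_prod_eq]; exact h.isCompact_left.prod h.isCompact_right)
    h.mixedHessBar_spec.1 (fun p hp => (h.mixedHessBar_eq hp).symm)
  exact ⟨this.1, fun x hx y hy => this.2 (x, y) ⟨hx, hy⟩⟩

theorem betaMinus_spec (h : B0 c U V) (h1 : B1 c U V) : betaMinus c U V < ∞ ∧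
    ∀ x ∈ U, ∀ y ∈ V, ‖invHess c U V x y‖ ≤ (betaMinus c U V).toReal := by
  have := eLpNorm_top_spec (μ := (volume : Measure (Euc n × Euc n)))
    (f := fun p : Euc n × Euc n => (mixedHess c p.1 p.2).inverse)
    (g := fun p => invHess c U V p.1 p.2) (Ω := U ×ˢ V) (h.1.prod h.2.1)
    (by rw [closure_prod_eq]; exact h.isCompact_left.prod h.isCompact_right)
    (by rw [closure_prod_eq]; exact h.continuousOn_invHess h1)
    (fun p hp => by simp only [invHess]; rw [h.mixedHessBar_eq hp])
  exact ⟨this.1, fun x hx y hy => this.2 (x, y) ⟨hx, hy⟩⟩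

theorem thirdXXY_spec (h : B0 c U V) :
    eLpNorm (fun p : Euc n × Euc n => thirdXXY c p.1 p.2) ∞ (volume.restrict (U ×ˢ V)) < ∞ ∧
    ∀ x ∈ U, ∀ y ∈ V, ‖thirdXXY c x y‖ ≤ (eLpNorm (fun p : Euc n × Euc n =>
      thirdXXY c p.1 p.2) ∞ (volume.restrict (U ×ˢ V))).toReal := by
  have hcont : Continuous fun D : Euc n × Euc n →L[ℝ] Euc n × Euc n →L[ℝ] Euc n × Euc n →L[ℝ] ℝ =>
      (mixedBlock n).comp (D.comp (ContinuousLinearMap.inl ℝ (Euc n) (Euc n))) :=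
    continuous_const.clm_comp (continuous_id.clm_comp continuous_const)
  have hD : ContinuousOn (costDeriv₃ c) (U ×ˢ V) :=
    ((contDiffOn_costDeriv₂ h.1 h.2.1 h.contDiffOn).fderiv_of_isOpen (m := 1) (h.1.prod h.2.1)
      (by norm_num)).continuousOn
  have hspec := extendFrom_spec (f := fun p : Euc n × Euc n => thirdXXY c p.1 p.2)
    (g := fun p => (mixedBlock n).comp
      ((costDeriv₃ c p).comp (ContinuousLinearMap.inl ℝ (Euc n) (Euc n)))) (A := U ×ˢ V)
    (fun p hp => thirdXXY_eq h.1 h.2.1 h.contDiffOn hp) (hcont.comp_continuousOn hD)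
    (fun p hp => by
      obtain ⟨L, hL⟩ := h.exists_tendsto_costDeriv₃ hp
      exact ⟨_, (hcont.tendsto L).comp hL⟩)
  have heq : EqOn (fun p : Euc n × Euc n => thirdXXY c p.1 p.2)
      (extendFrom (U ×ˢ V) fun p : Euc n × Euc n => thirdXXY c p.1 p.2) (U ×ˢ V) := fun p hp => by
    rw [hspec.2 hp]; exact thirdXXY_eq h.1 h.2.1 h.contDiffOn hp
  have := eLpNorm_top_spec (μ := (volume : Measure (Euc n × Euc n)))
    (f := fun p : Euc n × Euc n => thirdXXY c p.1 p.2)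
    (g := extendFrom (U ×ˢ V) fun p : Euc n × Euc n => thirdXXY c p.1 p.2)
    (Ω := U ×ˢ V) (h.1.prod h.2.1)
    (by rw [closure_prod_eq]; exact h.isCompact_left.prod h.isCompact_right) hspec.1 heq
  refine ⟨this.1, fun x hx y hy => ?_⟩
  have h2 := this.2 (x, y) ⟨hx, hy⟩
  rwa [← heq ⟨hx, hy⟩] at h2

theorem epsCost_pos (h : B0 c U V) (h1 : B1 c U V) : 0 < epsCost c U V := by
  rw [epsCost, ENNReal.inv_pos]
  exact ENNReal.mul_ne_top (ENNReal.mul_ne_top (ENNReal.mul_ne_top (by norm_num)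
    (ENNReal.pow_ne_top (betaPlus_spec h).1.ne)) (ENNReal.pow_ne_top (betaMinus_spec h h1).1.ne))
    (thirdXXY_spec h).1.ne

theorem costScale_eq : costScale c U V =
    2 * (betaPlus c U V).toReal ^ 4 * (betaMinus c U V).toReal ^ 6 *
      (eLpNorm (fun p : Euc n × Euc n => thirdXXY c p.1 p.2) ∞
        (volume.restrict (U ×ˢ V))).toReal := by
  simp [costScale, epsCost, ENNReal.toReal_mul, ENNReal.toReal_pow]

theorem costScale_nonneg : 0 ≤ costScale c U V := ENNReal.toReal_nonneg

end Bounds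

/-! ### Lipschitz bound for the gradient of the modified cost -/

section Lipschitz

set_option maxSynthPendingDepth 5

/-- U need not be convex, so the mean value inequality is used along the curve that is straight in
the coordinate D_y c(·,y₀), whose range is convex. Its speed is at most bm times the coordinate
distance. -/
theorem norm_mixedHessBar_sub_le (h : B0 c U V) (h1 : B1 c U V) (h2 : B2 c U V) {bm T : ℝ}
    (hbm : ∀ x ∈ U, ∀ y ∈ V, ‖invHess c U V x y‖ ≤ bm)
    (hT : ∀ x ∈ U, ∀ y ∈ V, ‖thirdXXY c x y‖ ≤ T) {x x' y₀ z : Euc n} (hx : x ∈ U) (hx' : x' ∈ U)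
    (hy₀ : y₀ ∈ V) (hz : z ∈ V) :
    ‖mixedHessBar c U V x' z - mixedHessBar c U V x z‖ ≤
      T * (bm * ‖gradY c U V x' y₀ - gradY c U V x y₀‖) := by
  set φ : Euc n → Euc n := fun x => -gradY c U V x y₀ with hφ
  have hinj : InjOn φ U := (h1.1 y₀ (subset_closure hy₀)).mono subset_closure
  have hφs := coordX_spec h h1 hy₀
  set d : Euc n := φ x' - φ x with hd
  set ξ : ℝ → Euc n := coordCurve φ U (φ x) d with hξ
  set S : Set ℝ := {s : ℝ | φ x + s • d ∈ φ '' U} with hS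
  have hSopen : IsOpen S := isOpen_coordCurve_domain hφs.1
  have hIcc : Icc (0 : ℝ) 1 ⊆ S := fun s hs =>
    add_smul_mem_of_mem_Icc (h2.1 y₀ (subset_closure hy₀)) (mem_image_of_mem φ hx)
      (mem_image_of_mem φ hx') hs
  have hξ0 : ξ 0 = x := coordCurve_eq hinj hx (by simp)
  have hξ1 : ξ 1 = x' := coordCurve_eq hinj hx' (by simp [hd])
  have hξU : ∀ s ∈ S, ξ s ∈ U := fun s hs => coordCurve_mem hs
  have hξd : ∀ s ∈ S, HasDerivAt ξ (deriv ξ s) s := fun s hs =>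
    (hasDerivAt_deriv_of_contDiffOn hSopen
      (contDiffOn_coordCurve (hφs.2.of_le (by norm_num))) hs).1
  have hξn : ∀ s ∈ S, ‖deriv ξ s‖ ≤ bm * ‖d‖ := by
    intro s hs
    have e1 : (-mixedHessBar c U V (ξ s) y₀) (deriv ξ s) = d :=
      hasFDerivAt_apply_deriv_coordCurve hφs.1 (hφs.2.of_le (by norm_num)) hs
        (h.hasFDerivAt_gradY (hξU s hs) hy₀).neg
    have e2 : deriv ξ s = -invHess c U V (ξ s) y₀ d := by
      rw [← e1, neg_apply, map_neg, neg_neg,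
        invHess_apply_mixedHessBar h1 (subset_closure (hξU s hs)) (subset_closure hy₀)]
    rw [e2, norm_neg]
    exact ((invHess c U V (ξ s) y₀).le_opNorm d).trans
      (mul_le_mul_of_nonneg_right (hbm _ (hξU s hs) _ hy₀) (norm_nonneg _))
  have hder : ∀ s ∈ Icc (0 : ℝ) 1, HasDerivWithinAt (fun s => mixedHess c (ξ s) z)
      (thirdXXY c (ξ s) z (deriv ξ s)) (Icc 0 1) s := fun s hs =>
    ((hasFDerivAt_mixedHess_thirdXXY h.1 h.2.1 h.contDiffOn (p := (ξ s, z))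
      ⟨hξU s (hIcc hs), hz⟩).comp_hasDerivAt s (hξd s (hIcc hs))).hasDerivWithinAt
  have hmain := norm_image_sub_le_of_norm_deriv_le_segment_01' hder (C := T * (bm * ‖d‖))
    fun s hs => by
      have hs' := hIcc (Ico_subset_Icc_self hs)
      refine ((thirdXXY c (ξ s) z).le_opNorm _).trans ?_
      exact mul_le_mul (hT _ (hξU s hs') _ hz) (hξn s hs') (norm_nonneg _)
        ((norm_nonneg _).trans (hT _ (hξU s hs') _ hz))
  have hnd : ‖d‖ = ‖gradY c U V x' y₀ - gradY c U V x y₀‖ := by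
    rw [← norm_neg]; congr 1; simp only [hd, hφ]; module
  rw [hξ0, hξ1, hnd] at hmain
  rwa [h.mixedHessBar_eq (p := (x', z)) ⟨hx', hz⟩, h.mixedHessBar_eq (p := (x, z)) ⟨hx, hz⟩]

theorem adjoint_invHess_apply_adjoint (h1 : B1 c U V) (hx : x ∈ closure U)
    (hy : y ∈ closure V) (v : Euc n) :
    ContinuousLinearMap.adjoint (mixedHessBar c U V x y)
      (ContinuousLinearMap.adjoint (invHess c U V x y) v) = v := by
  refine ext_inner_right ℝ fun w => ?_
  rw [ContinuousLinearMap.adjoint_inner_left, ContinuousLinearMap.adjoint_inner_left,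
    invHess_apply_mixedHessBar h1 hx hy]

theorem norm_adjoint_eq (A : Euc n →L[ℝ] Euc n) : ‖ContinuousLinearMap.adjoint A‖ = ‖A‖ :=
  LinearIsometryEquiv.norm_map _ _

/-- Both gradients vanish at the focus y₀, so integrate the derivative of their difference along the
c-segment η with respect to x' from y₀ to y. The speed of η is controlled by the gradient at x',
which makes the bound relative; the difference of the derivatives in y is controlled by D³_{xxy} c.
-/
theorem norm_coordGrad_sub_le_of_mem (h : B0 c U V) (h1 : B1 c U V) (h2 : B2 c U V)
    {bp bm T : ℝ} (hbp : ∀ x ∈ U, ∀ y ∈ V, ‖mixedHessBar c U V x y‖ ≤ bp)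
    (hbm : ∀ x ∈ U, ∀ y ∈ V, ‖invHess c U V x y‖ ≤ bm)
    (hT : ∀ x ∈ U, ∀ y ∈ V, ‖thirdXXY c x y‖ ≤ T) {x x' y₀ y : Euc n} (hx : x ∈ U) (hx' : x' ∈ U)
    (hy₀ : y₀ ∈ V) (hy : y ∈ V) :
    ‖coordGrad c U V y₀ x y - coordGrad c U V y₀ x' y‖ ≤
      T * bm ^ 3 * bp * (1 + bm * bp) * ‖gradY c U V x y₀ - gradY c U V x' y₀‖ *
        ‖coordGrad c U V y₀ x' y‖ := by
  have hbp0 : 0 ≤ bp := (norm_nonneg _).trans (hbp x hx y hy)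
  have hbm0 : 0 ≤ bm := (norm_nonneg _).trans (hbm x hx y hy)
  have hT0 : 0 ≤ T := (norm_nonneg _).trans (hT x hx y hy)
  set ψ : Euc n → Euc n := fun y => -gradX c U V x' y with hψ
  have hinj : InjOn ψ V := (h1.2.1 x' (subset_closure hx')).mono subset_closure
  have hψs := coordY_spec h h1 hx'
  set ω : Euc n := ψ y - ψ y₀ with hω
  set η : ℝ → Euc n := coordCurve ψ V (ψ y₀) ω with hη
  set S : Set ℝ := {t : ℝ | ψ y₀ + t • ω ∈ ψ '' V} with hS
  have hSopen : IsOpen S := isOpen_coordCurve_domain hψs.1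
  have hIcc : Icc (0 : ℝ) 1 ⊆ S := fun s hs =>
    add_smul_mem_of_mem_Icc (h2.2 x' (subset_closure hx')) (mem_image_of_mem ψ hy₀)
      (mem_image_of_mem ψ hy) hs
  have hη0 : η 0 = y₀ := coordCurve_eq hinj hy₀ (by simp)
  have hη1 : η 1 = y := coordCurve_eq hinj hy (by simp [hω])
  have hηV : ∀ t ∈ S, η t ∈ V := fun t ht => coordCurve_mem ht
  have hηd : ∀ s ∈ S, HasDerivAt η (deriv η s) s := fun s hs =>
    (hasDerivAt_deriv_of_contDiffOn hSopen
      (contDiffOn_coordCurve (hψs.2.of_le (by norm_num))) hs).1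
  set p' := coordGrad c U V y₀ x' y with hp'
  set D := ‖gradY c U V x y₀ - gradY c U V x' y₀‖ with hD
  have hωn : ‖ω‖ ≤ bp * ‖p'‖ := by
    have e1 : ω = -ContinuousLinearMap.adjoint (mixedHessBar c U V x' y₀) p' := by
      rw [hp', coordGrad, adjoint_invHess_apply_adjoint h1 (subset_closure hx')
        (subset_closure hy₀)]
      simp only [hω, hψ]; module
    rw [e1, norm_neg]
    refine (ContinuousLinearMap.le_opNorm _ _).trans ?_
    rw [norm_adjoint_eq]
    exact mul_le_mul_of_nonneg_right (hbp _ hx' _ hy₀) (norm_nonneg _)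
  have hηn : ∀ s ∈ S, ‖deriv η s‖ ≤ bm * (bp * ‖p'‖) := by
    intro s hs
    have e1 : (-ContinuousLinearMap.adjoint (mixedHessBar c U V x' (η s))) (deriv η s) = ω :=
      hasFDerivAt_apply_deriv_coordCurve hψs.1 (hψs.2.of_le (by norm_num)) hs
        (h.hasFDerivAt_gradX hx' (hηV s hs)).neg
    have e2 : deriv η s = -ContinuousLinearMap.adjoint (invHess c U V x' (η s)) ω := by
      refine (isInvertible_adjoint (h1.2.2 x' (subset_closure hx') (η s)
        (subset_closure (hηV s hs)))).injective ?_
      rw [map_neg, adjoint_invHess_apply_adjoint h1 (subset_closure hx')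
        (subset_closure (hηV s hs)), ← e1, neg_apply, neg_neg]
    rw [e2, norm_neg]
    refine (ContinuousLinearMap.le_opNorm _ _).trans ?_
    rw [norm_adjoint_eq]
    exact mul_le_mul (hbm _ hx' _ (hηV s hs)) hωn (norm_nonneg _) hbm0
  set L : Euc n → Euc n → Euc n →L[ℝ] Euc n := fun x z =>
    (ContinuousLinearMap.adjoint (invHess c U V x y₀)).comp
      (ContinuousLinearMap.adjoint (mixedHessBar c U V x z)) with hL
  have hLn : ∀ z ∈ V, ‖L x z - L x' z‖ ≤ T * bm ^ 2 * (1 + bm * bp) * D := by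
    intro z hz
    set N := invHess c U V x y₀ with hN
    set N' := invHess c U V x' y₀ with hN'
    set M := mixedHessBar c U V x z with hM
    set M' := mixedHessBar c U V x' z with hM'
    have hMM : ‖M - M'‖ ≤ T * (bm * D) :=
      norm_mixedHessBar_sub_le h h1 h2 hbm hT hx' hx hy₀ hz
    have hAA : ‖mixedHessBar c U V x y₀ - mixedHessBar c U V x' y₀‖ ≤ T * (bm * D) :=
      norm_mixedHessBar_sub_le h h1 h2 hbm hT hx' hx hy₀ hy₀
    -- Resolvent identity: the variation of the inverse is reduced to that of the mixed derivative
    -- at y₀.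
    have hNN : N - N' =
        -(N.comp ((mixedHessBar c U V x y₀ - mixedHessBar c U V x' y₀).comp N')) := by
      ext1 v
      simp only [ContinuousLinearMap.comp_apply, sub_apply, neg_apply, map_sub]
      rw [hN, hN', invHess_apply_mixedHessBar h1 (subset_closure hx) (subset_closure hy₀),
        mixedHessBar_apply_invHess h1 (subset_closure hx') (subset_closure hy₀)]
      abel
    have hNNn : ‖N - N'‖ ≤ bm * (T * (bm * D) * bm) := by
      rw [hNN, norm_neg]
      refine (ContinuousLinearMap.opNorm_comp_le _ _).trans ?_
      refine mul_le_mul (hbm _ hx _ hy₀) ?_ (norm_nonneg _) hbm0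
      refine (ContinuousLinearMap.opNorm_comp_le _ _).trans ?_
      exact mul_le_mul hAA (hbm _ hx' _ hy₀) (norm_nonneg _) (by positivity)
    have e1 : L x z - L x' z =
        ContinuousLinearMap.adjoint ((M - M').comp N + M'.comp (N - N')) := by
      simp only [hL]
      rw [← ContinuousLinearMap.adjoint_comp, ← ContinuousLinearMap.adjoint_comp, ← map_sub]
      congr 1
      ext1 v
      simp [hM, hM', hN, hN']
    rw [e1, norm_adjoint_eq]
    calc ‖(M - M').comp N + M'.comp (N - N')‖
        ≤ ‖M - M'‖ * ‖N‖ + ‖M'‖ * ‖N - N'‖ := (norm_add_le _ _).trans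
          (add_le_add (ContinuousLinearMap.opNorm_comp_le _ _)
            (ContinuousLinearMap.opNorm_comp_le _ _))
      _ ≤ T * (bm * D) * bm + bp * (bm * (T * (bm * D) * bm)) := by
          refine add_le_add ?_ ?_
          · exact mul_le_mul hMM (hbm _ hx _ hy₀) (norm_nonneg _) (by positivity)
          · exact mul_le_mul (hbp _ hx' _ hz) hNNn (norm_nonneg _) hbp0
      _ = T * bm ^ 2 * (1 + bm * bp) * D := by ring
  set F : ℝ → Euc n := fun s =>
    ContinuousLinearMap.adjoint (invHess c U V x y₀) (gradX c U V x (η s)) -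
      ContinuousLinearMap.adjoint (invHess c U V x' y₀) (gradX c U V x' (η s)) with hF
  have hFd : ∀ s ∈ Icc (0 : ℝ) 1, HasDerivWithinAt F
      ((L x (η s) - L x' (η s)) (deriv η s)) (Icc 0 1) s := by
    intro s hs
    have hs' := hIcc hs
    have e : ∀ z ∈ U, HasDerivAt (fun s => ContinuousLinearMap.adjoint (invHess c U V z y₀)
        (gradX c U V z (η s))) (L z (η s) (deriv η s)) s := fun z hz =>
      (ContinuousLinearMap.adjoint (invHess c U V z y₀)).hasFDerivAt.comp_hasDerivAt s
        ((h.hasFDerivAt_gradX hz (hηV s hs')).comp_hasDerivAt s (hηd s hs'))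
    exact ((e x hx).sub (e x' hx')).hasDerivWithinAt
  have hmain := norm_image_sub_le_of_norm_deriv_le_segment_01' hFd
    (C := T * bm ^ 2 * (1 + bm * bp) * D * (bm * (bp * ‖p'‖))) fun s hs => by
      have hs' := hIcc (Ico_subset_Icc_self hs)
      refine (ContinuousLinearMap.le_opNorm _ _).trans ?_
      exact mul_le_mul (hLn _ (hηV s hs')) (hηn s hs') (norm_nonneg _) (by positivity)
  have hF10 : F 1 - F 0 = coordGrad c U V y₀ x y - coordGrad c U V y₀ x' y := by
    simp only [hF, hη0, hη1, coordGrad, map_sub]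
    abel
  rw [hF10] at hmain
  refine hmain.trans (le_of_eq ?_)
  ring

theorem B0.continuousOn_coordGrad (h : B0 c U V) (h1 : B1 c U V) (hx : x ∈ U) :
    ContinuousOn (fun z : Euc n × Euc n => coordGrad c U V z.1 x z.2)
      (closure V ×ˢ closure V) := by
  have cx : MapsTo (fun _ : Euc n × Euc n => x) (closure V ×ˢ closure V) (closure U) :=
    fun _ _ => subset_closure hx
  have m1 : MapsTo (Prod.fst : Euc n × Euc n → Euc n) (closure V ×ˢ closure V) (closure V) :=
    fun _ hz => hz.1
  have m2 : MapsTo (Prod.snd : Euc n × Euc n → Euc n) (closure V ×ˢ closure V) (closure V) :=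
    fun _ hz => hz.2
  have gX1 := continuousOn_slice h.continuousOn_gradX continuousOn_const continuousOn_fst cx m1
  have gX2 := continuousOn_slice h.continuousOn_gradX continuousOn_const continuousOn_snd cx m2
  have hN := continuousOn_slice (h.continuousOn_invHess h1) continuousOn_const
    continuousOn_fst cx m1
  have hNa : ContinuousOn (fun z : Euc n × Euc n =>
      ContinuousLinearMap.adjoint (invHess c U V x z.1)) (closure V ×ˢ closure V) :=
    (LinearIsometryEquiv.continuous ContinuousLinearMap.adjoint).comp_continuousOn hN
  exact hNa.clm_apply (gX2.sub gX1)

theorem one_le_betaMinus_mul_betaPlus [NeZero n] (h : B0 c U V) (h1 : B1 c U V) (hx : x ∈ U)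
    (hy : y ∈ V) : 1 ≤ (betaMinus c U V).toReal * (betaPlus c U V).toReal := by
  have e1 : (invHess c U V x y).comp (mixedHessBar c U V x y) =
      ContinuousLinearMap.id ℝ (Euc n) := by
    ext1 v
    exact invHess_apply_mixedHessBar h1 (subset_closure hx) (subset_closure hy) v
  have e2 := ContinuousLinearMap.opNorm_comp_le (invHess c U V x y) (mixedHessBar c U V x y)
  rw [e1, ContinuousLinearMap.norm_id] at e2
  exact e2.trans (mul_le_mul ((betaMinus_spec h h1).2 _ hx _ hy) ((betaPlus_spec h).2 _ hx _ hy)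
    (norm_nonneg _) ENNReal.toReal_nonneg)

/-- The argument produces smaller powers than those in the definition of ε_c. They may be raised
because bm * bp ≥ 1. -/
theorem mul_le_of_one_le_mul {T bm bp : ℝ} (hT : 0 ≤ T) (hbm : 0 ≤ bm) (hbp : 0 ≤ bp)
    (h : 1 ≤ bm * bp) :
    T * bm ^ 3 * bp * (1 + bm * bp) ≤ 2 * bp ^ 4 * bm ^ 6 * T := by
  have e2 : 1 ≤ (bm * bp) ^ 2 := one_le_pow₀ h
  calc T * bm ^ 3 * bp * (1 + bm * bp)
      ≤ T * bm ^ 3 * bp * (2 * (bm * bp)) :=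
        mul_le_mul_of_nonneg_left (by linarith) (by positivity)
    _ = 2 * T * (bm ^ 4 * bp ^ 2 * 1) := by ring
    _ ≤ 2 * T * (bm ^ 4 * bp ^ 2 * (bm * bp) ^ 2) :=
      mul_le_mul_of_nonneg_left (mul_le_mul_of_nonneg_left e2 (by positivity)) (by positivity)
    _ = _ := by ring

end Lipschitz

end OptTransport

namespace OptTransport

variable {n : ℕ} {c : Euc n → Euc n → ℝ} {U V : Set (Euc n)} {x y : Euc n}

section LipschitzClosure

set_option maxSynthPendingDepth 5

theorem norm_sub_le_on_closure {X F G : Type*} [TopologicalSpace X] [SeminormedAddCommGroup F]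
    [SeminormedAddCommGroup G] {K : ℝ} {A : Set X} {p p' : X → F} {g g' : X → G}
    (h : ∀ w ∈ A, ‖p w - p' w‖ ≤ K * ‖g w - g' w‖ * ‖p' w‖)
    (hp : ContinuousOn p (closure A)) (hp' : ContinuousOn p' (closure A))
    (hg : ContinuousOn g (closure A)) (hg' : ContinuousOn g' (closure A)) {w : X}
    (hw : w ∈ closure A) : ‖p w - p' w‖ ≤ K * ‖g w - g' w‖ * ‖p' w‖ :=
  le_on_closure (f := fun w => ‖p w - p' w‖) (g := fun w => K * ‖g w - g' w‖ * ‖p' w‖) h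
    (hp.sub hp').norm ((continuousOn_const.mul (hg.sub hg').norm).mul hp'.norm) hw

theorem constants_le_costScale [NeZero n] (h : B0 c U V) (h1 : B1 c U V) (hx : x ∈ U)
    (hy : y ∈ V) :
    (eLpNorm (fun p : Euc n × Euc n => thirdXXY c p.1 p.2) ∞
      (volume.restrict (U ×ˢ V))).toReal * (betaMinus c U V).toReal ^ 3 *
      (betaPlus c U V).toReal * (1 + (betaMinus c U V).toReal * (betaPlus c U V).toReal) ≤
      costScale c U V := by
  rw [costScale_eq]
  exact mul_le_of_one_le_mul ENNReal.toReal_nonneg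
    ENNReal.toReal_nonneg ENNReal.toReal_nonneg (one_le_betaMinus_mul_betaPlus h h1 hx hy)

theorem norm_coordGrad_sub_le_costScale_of_mem [NeZero n] (h : B0 c U V) (h1 : B1 c U V)
    (h2 : B2 c U V) {x x' y₀ y : Euc n} (hx : x ∈ U) (hx' : x' ∈ U) (hy₀ : y₀ ∈ V) (hy : y ∈ V) :
    ‖coordGrad c U V y₀ x y - coordGrad c U V y₀ x' y‖ ≤
      costScale c U V * ‖gradY c U V x y₀ - gradY c U V x' y₀‖ *
        ‖coordGrad c U V y₀ x' y‖ := by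
  have h3 := norm_coordGrad_sub_le_of_mem h h1 h2 (betaPlus_spec h).2 (betaMinus_spec h h1).2
    (thirdXXY_spec h).2 hx hx' hy₀ hy
  have hK := constants_le_costScale h h1 hx hy
  refine h3.trans ?_
  gcongr

theorem norm_coordGrad_sub_le [NeZero n] (h : B0 c U V) (h1 : B1 c U V) (h2 : B2 c U V)
    {x x' y₀ y : Euc n} (hx : x ∈ U) (hx' : x' ∈ U) (hy₀ : y₀ ∈ closure V)
    (hy : y ∈ closure V) :
    ‖coordGrad c U V y₀ x y - coordGrad c U V y₀ x' y‖ ≤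
      costScale c U V * ‖gradY c U V x y₀ - gradY c U V x' y₀‖ *
        ‖coordGrad c U V y₀ x' y‖ := by
  have hmem : (y₀, y) ∈ closure (V ×ˢ V) := by rw [closure_prod_eq]; exact ⟨hy₀, hy⟩
  have cP : ∀ x ∈ U, ContinuousOn (fun z : Euc n × Euc n => coordGrad c U V z.1 x z.2)
      (closure (V ×ˢ V)) := fun x hx => by
    rw [closure_prod_eq]; exact h.continuousOn_coordGrad h1 hx
  have cY : ∀ x ∈ U, ContinuousOn (fun z : Euc n × Euc n => gradY c U V x z.1)
      (closure (V ×ˢ V)) := fun x hx => by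
    rw [closure_prod_eq]
    exact continuousOn_slice h.continuousOn_gradY continuousOn_const continuousOn_fst
      (fun _ _ => subset_closure hx) fun _ hz => hz.1
  have hin : ∀ w ∈ V ×ˢ V, ‖coordGrad c U V w.1 x w.2 - coordGrad c U V w.1 x' w.2‖ ≤
      costScale c U V * ‖gradY c U V x w.1 - gradY c U V x' w.1‖ *
        ‖coordGrad c U V w.1 x' w.2‖ := fun w hw =>
    norm_coordGrad_sub_le_costScale_of_mem h h1 h2 hx hx' hw.1 hw.2
  have := norm_sub_le_on_closure (A := V ×ˢ V) (K := costScale c U V)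
    (p := fun z : Euc n × Euc n => coordGrad c U V z.1 x z.2)
    (p' := fun z : Euc n × Euc n => coordGrad c U V z.1 x' z.2)
    (g := fun z : Euc n × Euc n => gradY c U V x z.1)
    (g' := fun z : Euc n × Euc n => gradY c U V x' z.1)
    hin (cP x hx) (cP x' hx') (cY x hx) (cY x' hx') hmem
  exact this

end LipschitzClosure

/-! ### The modified cost -/

section ModifiedCost

theorem modCost_sub (c : Euc n → Euc n → ℝ) (U V : Set (Euc n)) (y₀ q q' y : Euc n) :
    modCost c U V y₀ q y - modCost c U V y₀ q' y =
      -(c (expInv c U V y₀ q') y - c (expInv c U V y₀ q) y - c (expInv c U V y₀ q') y₀ +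
        c (expInv c U V y₀ q) y₀) := by
  simp only [modCost]; ring

theorem isBounded_expDomain (h : B0 c U V) (hy : y ∈ closure V) :
    Bornology.IsBounded (expDomain c U V y) := by
  have := h.isCompact_left.image_of_continuousOn (h.continuousOn_coordX hy)
  rw [← closure_expDomain h hy] at this
  exact this.isBounded.subset subset_closure

theorem continuousOn_modCost (h : B0 c U V) (h1 : B1 c U V) {y₀ : Euc n} (hy₀ : y₀ ∈ closure V) :
    ContinuousOn (fun p : Euc n × Euc n => modCost c U V y₀ p.1 p.2)
      (closure (expDomain c U V y₀) ×ˢ closure V) := by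
  have hx : ContinuousOn (fun p : Euc n × Euc n => expInv c U V y₀ p.1)
      (closure (expDomain c U V y₀) ×ˢ closure V) :=
    (continuousOn_expInv h h1 hy₀).comp continuousOn_fst fun _ hp => hp.1
  have hm : MapsTo (fun p : Euc n × Euc n => expInv c U V y₀ p.1)
      (closure (expDomain c U V y₀) ×ˢ closure V) (closure U) :=
    fun _ hp => expInv_mem_closure h hy₀ hp.1
  exact (continuousOn_slice h.continuousOn_cost hx continuousOn_snd hm fun _ hp => hp.2).sub
    (continuousOn_slice h.continuousOn_cost hx continuousOn_const hm fun _ _ => hy₀)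

theorem continuousOn_coordGrad_expInv (h : B0 c U V) (h1 : B1 c U V) {y₀ : Euc n}
    (hy₀ : y₀ ∈ closure V) :
    ContinuousOn (fun p : Euc n × Euc n => coordGrad c U V y₀ (expInv c U V y₀ p.1) p.2)
      (expDomain c U V y₀ ×ˢ closure V) := by
  have hx : ContinuousOn (fun p : Euc n × Euc n => expInv c U V y₀ p.1)
      (expDomain c U V y₀ ×ˢ closure V) :=
    (continuousOn_expInv h h1 hy₀).comp continuousOn_fst fun _ hp => subset_closure hp.1
  have hm : MapsTo (fun p : Euc n × Euc n => expInv c U V y₀ p.1)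
      (expDomain c U V y₀ ×ˢ closure V) (closure U) :=
    fun _ hp => expInv_mem_closure h hy₀ (subset_closure hp.1)
  have hN := continuousOn_slice (h.continuousOn_invHess h1) hx continuousOn_const hm
    fun _ _ => hy₀
  have hNa : ContinuousOn (fun p : Euc n × Euc n =>
      ContinuousLinearMap.adjoint (invHess c U V (expInv c U V y₀ p.1) y₀))
      (expDomain c U V y₀ ×ˢ closure V) :=
    (LinearIsometryEquiv.continuous ContinuousLinearMap.adjoint).comp_continuousOn hN
  exact hNa.clm_apply
    ((continuousOn_slice h.continuousOn_gradX hx continuousOn_snd hm fun _ hp => hp.2).sub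
      (continuousOn_slice h.continuousOn_gradX hx continuousOn_const hm fun _ _ => hy₀))

theorem injOn_coordGrad (h1 : B1 c U V) {y₀ : Euc n} (hx : x ∈ closure U)
    (hy₀ : y₀ ∈ closure V) : InjOn (coordGrad c U V y₀ x) (closure V) := by
  intro y hy y' hy' he
  have := congrArg (ContinuousLinearMap.adjoint (mixedHessBar c U V x y₀)) he
  simp only [coordGrad, adjoint_invHess_apply_adjoint h1 hx hy₀] at this
  refine h1.2.1 x hx hy hy' ?_
  simpa using this

theorem coordGrad_image (c : Euc n → Euc n → ℝ) (U V : Set (Euc n)) (y₀ x : Euc n)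
    (S : Set (Euc n)) : coordGrad c U V y₀ x '' S =
      (fun v => (-ContinuousLinearMap.adjoint (invHess c U V x y₀)) v -
        ContinuousLinearMap.adjoint (invHess c U V x y₀) (gradX c U V x y₀)) ''
        ((fun y => -gradX c U V x y) '' S) := by
  rw [image_image]
  refine image_congr fun y _ => ?_
  simp [coordGrad]

theorem convex_coordGrad_image {y₀ : Euc n} {S : Set (Euc n)}
    (hS : Convex ℝ ((fun y => -gradX c U V x y) '' S)) :
    Convex ℝ (coordGrad c U V y₀ x '' S) := by
  rw [coordGrad_image]
  set A := -ContinuousLinearMap.adjoint (invHess c U V x y₀)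
  set b := ContinuousLinearMap.adjoint (invHess c U V x y₀) (gradX c U V x y₀)
  have := (hS.linear_image A.toLinearMap).translate (-b)
  rw [image_image] at this
  refine (congrArg (Convex ℝ) (image_congr fun v _ => ?_)).mpr this
  exact sub_eq_neg_add (A v) b

theorem continuousOn_gradX_right (h : B0 c U V) (hx : x ∈ closure U) :
    ContinuousOn (fun y => -gradX c U V x y) (closure V) :=
  (continuousOn_slice h.continuousOn_gradX (s := closure V) (g₁ := fun _ => x) (g₂ := id)
    continuousOn_const continuousOn_id (fun _ _ => hx) (mapsTo_id _)).neg

theorem closure_image_of_continuousOn {X F : Type*} [TopologicalSpace X] [TopologicalSpace F]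
    [T2Space F] {f : X → F} {A : Set X} (hA : IsCompact (closure A))
    (hf : ContinuousOn f (closure A)) : closure (f '' A) = f '' closure A :=
  subset_antisymm (closure_minimal (image_mono subset_closure)
    (hA.image_of_continuousOn hf).isClosed) hf.image_closure

theorem continuousOn_coordGrad_right (h : B0 c U V) {y₀ : Euc n} (hx : x ∈ closure U) :
    ContinuousOn (coordGrad c U V y₀ x) (closure V) := by
  have := (continuousOn_gradX_right h hx).neg.congr (g := gradX c U V x) fun y _ => by
    simp
  exact (ContinuousLinearMap.adjoint (invHess c U V x y₀)).continuous.comp_continuousOn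
    (this.sub continuousOn_const)

/-- `inner_grad_le` is the cross-difference inequality based at (x, y₀), and `exists_dual` the one
based at (x, y). Convexity of the image is (B2) seen through an affine map. -/
theorem crossConvexCost_modCost [NeZero n] (h : B0 c U V) (h1 : B1 c U V) (h2 : B2 c U V)
    (h3 : B3 c U V) {y₀ : Euc n} (hy₀ : y₀ ∈ closure V) :
    CrossConvexCost (expDomain c U V y₀) (closure V) (modCost c U V y₀)
      (fun q y => coordGrad c U V y₀ (expInv c U V y₀ q) y) y₀ (costScale c U V) where
  isOpen_left := isOpen_expDomain h h1 hy₀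
  convex_left := h2.1 y₀ hy₀
  isBounded_left := isBounded_expDomain h hy₀
  isCompact_right := h.isCompact_right
  base_mem := hy₀
  continuousOn_cost := continuousOn_modCost h h1 hy₀
  cost_base := fun q _ => sub_self _
  continuousOn_grad := continuousOn_coordGrad_expInv h h1 hy₀
  grad_base := fun q _ => by simp [coordGrad]
  injOn_grad := fun q hq => injOn_coordGrad h1 (subset_closure (expInv_mem h1 hy₀ hq)) hy₀
  convex_image := fun q hq => by
    have hx := subset_closure (expInv_mem h1 hy₀ hq)
    refine convex_coordGrad_image ?_
    rw [← closure_image_of_continuousOn h.isCompact_right (continuousOn_gradX_right h hx)]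
    exact (h2.2 _ hx).closure
  inner_grad_le := fun q hq q' hq' y hy => by
    have := cross_difference_le h h1 h2 h3 (expInv_mem h1 hy₀ hq) (expInv_mem h1 hy₀ hq') hy₀ hy
    rw [modCost_sub, le_neg, coordGrad, ContinuousLinearMap.adjoint_inner_left]
    refine this.trans (le_of_eq ?_)
    rw [gradY_expInv h1 hy₀ hq, gradY_expInv h1 hy₀ hq', ← inner_neg_right, ← map_neg,
      real_inner_comm]
    congr 2
    abel
  exists_dual := fun q hq q' hq' y hy => by
    have hx := expInv_mem h1 hy₀ hq
    have hx' := expInv_mem h1 hy₀ hq'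
    set x := expInv c U V y₀ q with hxd
    set x' := expInv c U V y₀ q' with hxd'
    -- The mixed derivative at y₀ cancels the adjoint inverse contained in the gradient, leaving, up
    -- to sign, the right side of the cross-difference inequality at (x, y).
    refine ⟨-mixedHessBar c U V x y₀ (invHess c U V x y (gradY c U V x' y - gradY c U V x y)),
      fun y' hy' => ?_⟩
    have := cross_difference_le h h1 h2 h3 hx hx' hy hy'
    have e : coordGrad c U V y₀ x y' - coordGrad c U V y₀ x y =
        ContinuousLinearMap.adjoint (invHess c U V x y₀)
          (gradX c U V x y' - gradX c U V x y) := by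
      simp only [coordGrad, ← map_sub]; congr 1; abel
    rw [e, inner_neg_left, ContinuousLinearMap.adjoint_inner_right,
      invHess_apply_mixedHessBar h1 (subset_closure hx) hy₀, modCost_sub, modCost_sub]
    simp only [← hxd, ← hxd']
    linarith
  norm_grad_sub_le := fun q hq q' hq' y hy => by
    refine (norm_coordGrad_sub_le h h1 h2 (expInv_mem h1 hy₀ hq) (expInv_mem h1 hy₀ hq')
      hy₀ hy).trans (le_of_eq ?_)
    rw [gradY_expInv h1 hy₀ hq, gradY_expInv h1 hy₀ hq', ← norm_neg (q - q')]
    congr 3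
    abel

end ModifiedCost

end OptTransport

namespace OptTransport

variable {n : ℕ} {c : Euc n → Euc n → ℝ} {U V : Set (Euc n)} {x y : Euc n}

/-! ### The Jacobian of the gradient of the modified cost -/

section Jacobian

theorem det_adjoint_eq (A : Euc n →L[ℝ] Euc n) : (ContinuousLinearMap.adjoint A).det = A.det := by
  have b := (stdOrthonormalBasis ℝ (Euc n))
  have h1 : (LinearMap.adjoint (A : Euc n →ₗ[ℝ] Euc n)) =
      (ContinuousLinearMap.adjoint A : Euc n →ₗ[ℝ] Euc n) := by
    refine (LinearMap.eq_adjoint_iff _ _).2 (fun v w => ?_) |>.symm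
    exact ContinuousLinearMap.adjoint_inner_left A w v
  rw [ContinuousLinearMap.det, ContinuousLinearMap.det, ← h1,
    ← LinearMap.det_toMatrix b.toBasis, ← LinearMap.det_toMatrix b.toBasis,
    LinearMap.toMatrix_adjoint, Matrix.det_conjTranspose, star_trivial]

theorem gradient_modCost (h : B0 c U V) {y₀ q : Euc n} (hx : expInv c U V y₀ q ∈ U)
    (hy : y ∈ V) :
    gradient (fun y' => modCost c U V y₀ q y') y = gradY c U V (expInv c U V y₀ q) y := by
  rw [h.gradY_spec.2 (expInv c U V y₀ q, y) ⟨hx, hy⟩,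
    ← gradient_snd_eq h.1 h.2.1 h.contDiffOn (p := (expInv c U V y₀ q, y)) ⟨hx, hy⟩]
  simp only [gradient, modCost, fderiv_sub_const]

theorem mixedHess_modCost (h : B0 c U V) (h1 : B1 c U V) {y₀ q : Euc n} (hy₀ : y₀ ∈ closure V)
    (hq : q ∈ expDomain c U V y₀) (hy : y ∈ V) :
    mixedHess (modCost c U V y₀) q y =
      (mixedHessBar c U V (expInv c U V y₀ q) y).comp
        (-invHess c U V (expInv c U V y₀ q) y₀) := by
  refine HasFDerivAt.fderiv ?_
  have h2 := (h.hasFDerivAt_gradY (expInv_mem h1 hy₀ hq) hy).comp q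
    (hasFDerivAt_expInv h h1 hy₀ hq)
  refine h2.congr_of_eventuallyEq ?_
  filter_upwards [(isOpen_expDomain h h1 hy₀).mem_nhds hq] with q' hq'
  exact gradient_modCost h (expInv_mem h1 hy₀ hq') hy

theorem hasFDerivAt_coordGrad (h : B0 c U V) {y₀ : Euc n} (hx : x ∈ U) (hy : y ∈ V) :
    HasFDerivAt (coordGrad c U V y₀ x) (ContinuousLinearMap.adjoint
      ((mixedHessBar c U V x y).comp (invHess c U V x y₀))) y := by
  rw [ContinuousLinearMap.adjoint_comp]
  exact (ContinuousLinearMap.adjoint (invHess c U V x y₀)).hasFDerivAt.comp y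
    ((h.hasFDerivAt_gradX hx hy).sub_const _)

/-- The y-derivative of the gradient is minus the transpose of the mixed derivative of the modified
cost, so the determinants agree up to sign. As q is interior to Z, a pointwise value is bounded by
the essential supremum. -/
theorem enorm_det_le_gammaPlus (h : B0 c U V) (h1 : B1 c U V) {y₀ : Euc n}
    (hy₀ : y₀ ∈ closure V) {Z : Set (Euc n)} {q : Euc n} (hq : q ∈ interior Z)
    (hqW : q ∈ expDomain c U V y₀) (hy : y ∈ V) :
    ENNReal.ofReal |(ContinuousLinearMap.adjoint ((mixedHessBar c U V (expInv c U V y₀ q) y).comp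
      (invHess c U V (expInv c U V y₀ q) y₀))).det| ≤ gammaPlus (modCost c U V y₀) Z V := by
  set Ω : Set (Euc n × Euc n) := (interior Z ∩ expDomain c U V y₀) ×ˢ V with hΩ
  have hW := isOpen_expDomain h h1 hy₀
  have hΩo : IsOpen Ω := (isOpen_interior.inter hW).prod h.2.1
  have hx : ContinuousOn (fun p : Euc n × Euc n => expInv c U V y₀ p.1) Ω :=
    (continuousOn_expInv h h1 hy₀).comp continuousOn_fst fun _ hp => subset_closure hp.1.2
  have hm : MapsTo (fun p : Euc n × Euc n => expInv c U V y₀ p.1) Ω (closure U) :=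
    fun _ hp => expInv_mem_closure h hy₀ (subset_closure hp.1.2)
  have hN := continuousOn_slice (h.continuousOn_invHess h1) hx continuousOn_const hm
    fun _ _ => hy₀
  have hM := continuousOn_slice h.continuousOn_mixedHessBar hx continuousOn_snd hm
    fun _ hp => subset_closure hp.2
  have hdet : Continuous fun A : Euc n →L[ℝ] Euc n => A.det := ContinuousLinearMap.continuous_det
  have hcont : ContinuousOn (fun p : Euc n × Euc n =>
      ((mixedHessBar c U V (expInv c U V y₀ p.1) p.2).comp
        (-invHess c U V (expInv c U V y₀ p.1) y₀)).det) Ω :=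
    hdet.comp_continuousOn (hM.clm_comp hN.neg)
  have := enorm_le_eLpNorm_top (μ := (volume : Measure (Euc n × Euc n))) hΩo
    (A := Z ×ˢ V) (fun p hp => ⟨interior_subset hp.1.1, hp.2⟩) hcont
    (f := fun p => (mixedHess (modCost c U V y₀) p.1 p.2).det)
    (fun p hp => by simp only; rw [mixedHess_modCost h h1 hy₀ hp.1.2 hp.2]) (p := (q, y))
    ⟨⟨hq, hqW⟩, hy⟩
  refine le_trans (le_of_eq ?_) this
  have hneg : (mixedHessBar c U V (expInv c U V y₀ q) y).comp
      (-invHess c U V (expInv c U V y₀ q) y₀) = (-1 : ℝ) • ((mixedHessBar c U V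
        (expInv c U V y₀ q) y).comp (invHess c U V (expInv c U V y₀ q) y₀)) := by
    ext1 v; simp
  rw [det_adjoint_eq, ← Real.norm_eq_abs, ofReal_norm, hneg]
  simp only [ContinuousLinearMap.det, ContinuousLinearMap.toLinearMap_smul, LinearMap.det_smul]
  rw [enorm_mul, enorm_pow, enorm_neg, enorm_one, one_pow, one_mul]

/-- Change of variables on S ∩ V. The rest of S lies on the boundary of V, and injectivity sends it
into the frontier of the convex image of V, a null set; the boundary of V itself is not assumed
null. -/
theorem volume_coordGrad_image_le (h : B0 c U V) (h1 : B1 c U V) (h2 : B2 c U V) {y₀ : Euc n}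
    (hy₀ : y₀ ∈ closure V) {Z : Set (Euc n)} {q : Euc n} (hq : q ∈ interior Z)
    (hqW : q ∈ expDomain c U V y₀) {S : Set (Euc n)} (hS : S ⊆ closure V) (hSc : IsClosed S) :
    volume (coordGrad c U V y₀ (expInv c U V y₀ q) '' S) ≤
      gammaPlus (modCost c U V y₀) Z V * volume S := by
  set x := expInv c U V y₀ q with hx
  have hxU : x ∈ U := expInv_mem h1 hy₀ hqW
  set P := coordGrad c U V y₀ x with hP
  have hinj : InjOn P (closure V) := injOn_coordGrad h1 (subset_closure hxU) hy₀
  have hsplit : P '' S ⊆ P '' (S ∩ V) ∪ frontier (P '' V) := by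
    rintro _ ⟨z, hz, rfl⟩
    by_cases hzV : z ∈ V
    · exact Or.inl (mem_image_of_mem P ⟨hz, hzV⟩)
    refine Or.inr ⟨(continuousOn_coordGrad_right h (subset_closure hxU)).image_closure
      (mem_image_of_mem P (hS hz)), fun hint => hzV ?_⟩
    obtain ⟨v, hv, hvz⟩ := interior_subset hint
    rwa [← hinj (subset_closure hv) (hS hz) hvz]
  have hfr : volume (frontier (P '' V)) = 0 :=
    (convex_coordGrad_image (h2.2 x (subset_closure hxU))).addHaar_frontier volume
  have hmeas : MeasurableSet (S ∩ V) := hSc.measurableSet.inter h.2.1.measurableSet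
  calc volume (P '' S) ≤ volume (P '' (S ∩ V)) + volume (frontier (P '' V)) :=
        (measure_mono hsplit).trans (measure_union_le _ _)
    _ = ∫⁻ y in S ∩ V, ENNReal.ofReal |(ContinuousLinearMap.adjoint
          ((mixedHessBar c U V x y).comp (invHess c U V x y₀))).det| := by
        rw [hfr, add_zero]
        exact (lintegral_abs_det_fderiv_eq_addHaar_image volume hmeas
          (fun y hy => (hasFDerivAt_coordGrad h hxU hy.2).hasFDerivWithinAt)
          (hinj.mono fun y hy => hS hy.1)).symm
    _ ≤ ∫⁻ _ in S ∩ V, gammaPlus (modCost c U V y₀) Z V :=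
        setLIntegral_mono measurable_const fun y hy =>
          enorm_det_le_gammaPlus h h1 hy₀ hq hqW hy.2
    _ = gammaPlus (modCost c U V y₀) Z V * volume (S ∩ V) := setLIntegral_const _ _
    _ ≤ _ := by gcongr; exact inter_subset_left

end Jacobian

/-! ### Hyperplanes and chords -/

section Hyperplanes

theorem ofReal_sub_le_infEDist_hyperplane {ν : Euc n} (hν : ‖ν‖ = 1) (a : ℝ) (q : Euc n) :
    ENNReal.ofReal |a - inner ℝ ν q| ≤ Metric.infEDist q (hyperplane ν a) := by
  refine Metric.le_infEDist.2 fun z hz => ?_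
  rw [edist_comm, edist_eq_enorm_sub, ← ofReal_norm]
  refine ENNReal.ofReal_le_ofReal ?_
  rw [← show inner ℝ ν z = a from hz, ← inner_sub_right]
  simpa [hν] using abs_real_inner_le_norm ν (z - q)

end Hyperplanes

end OptTransport

namespace OptTransport

variable {n : ℕ} {c : Euc n → Euc n → ℝ} {U V : Set (Euc n)}

section Chords

theorem maxChord_ne_zero {ν q : Euc n} (hν : ‖ν‖ = 1) {Z : Set (Euc n)} (hq : q ∈ interior Z) :
    maxChord ν Z ≠ 0 := by
  obtain ⟨r, hr, hball⟩ := Metric.isOpen_iff.1 isOpen_interior q hq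
  have hmem : q + (r / 2) • ν ∈ Z := by
    refine interior_subset (hball ?_)
    rw [Metric.mem_ball, dist_self_add_left, norm_smul, hν, mul_one,
      Real.norm_of_nonneg (by positivity)]
    linarith
  have h1 : edist q (q + (r / 2) • ν) ≤ maxChord ν Z :=
    (Metric.edist_le_ediam_of_mem (s := Z ∩ range fun t : ℝ => q + t • ν)
      ⟨interior_subset hq, 0, by simp⟩ ⟨hmem, r / 2, rfl⟩).trans
      (le_iSup (fun p : Euc n => Metric.ediam (Z ∩ range fun t : ℝ => p + t • ν)) q)
  intro h0
  rw [h0, nonpos_iff_eq_zero, edist_eq_zero, left_eq_add, smul_eq_zero] at h1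
  rcases h1 with h1 | h1
  · linarith
  · simp [h1] at hν

theorem maxChord_ne_top {ν : Euc n} {Z : Set (Euc n)} (hZ : Bornology.IsBounded Z) :
    maxChord ν Z ≠ ∞ :=
  ((iSup_le fun _ => Metric.ediam_mono inter_subset_left).trans_lt hZ.ediam_ne_top.lt_top).ne

/-- The supremum runs over pairs of points on a line; each pair is ordered so that s > 0, and a
degenerate pair contributes zero. -/
theorem mul_maxChord_le {ν : Euc n} {Z : Set (Euc n)} {a B : ℝ≥0∞} (hν : ‖ν‖ = 1)
    (h : ∀ α ∈ Z, ∀ β ∈ Z, ∀ s : ℝ, 0 < s → β - α = s • ν → a * ENNReal.ofReal s ≤ B) :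
    a * maxChord ν Z ≤ B := by
  rw [maxChord, ENNReal.mul_iSup]
  refine iSup_le fun p => ?_
  rw [Metric.ediam]
  simp only [ENNReal.mul_iSup]
  refine iSup₂_le fun α hα => iSup₂_le fun β hβ => ?_
  obtain ⟨hαZ, s, rfl⟩ := hα
  obtain ⟨hβZ, t, rfl⟩ := hβ
  have hd : ∀ s t : ℝ, p + t • ν - (p + s • ν) = (t - s) • ν := fun s t => by module
  have he : edist (p + s • ν) (p + t • ν) = ENNReal.ofReal |t - s| := by
    rw [edist_comm, edist_eq_enorm_sub, hd, ← ofReal_norm, norm_smul, hν, mul_one,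
      Real.norm_eq_abs]
  simp only [he]
  rcases lt_trichotomy s t with hst | rfl | hst
  · rw [abs_of_pos (sub_pos.2 hst)]
    exact h _ hαZ _ hβZ _ (sub_pos.2 hst) (hd s t)
  · simp
  · rw [abs_sub_comm, abs_of_pos (sub_pos.2 hst)]
    exact h _ hβZ _ hαZ _ (sub_pos.2 hst) (hd t s)

end Chords

/-! ### Assembly of the estimate -/

theorem costScale_mul_norm_sub_le (heps : 0 < epsCost c U V) {ρ : ℝ} (hρ : 0 < ρ)
    {Z : Set (Euc n)} (hZ : Metric.ediam Z ≤ epsCost c U V / ENNReal.ofReal ρ⁻¹) :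
    ∀ q ∈ Z, ∀ q' ∈ Z, costScale c U V * ‖q - q'‖ ≤ ρ := by
  intro q hq q' hq'
  have h1 : ‖q - q'‖ₑ ≤ epsCost c U V * ENNReal.ofReal ρ := by
    rw [← edist_eq_enorm_sub]
    refine (Metric.edist_le_ediam_of_mem hq hq').trans (hZ.trans (le_of_eq ?_))
    rw [div_eq_mul_inv, ← ENNReal.ofReal_inv_of_pos (inv_pos.2 hρ), inv_inv]
  rw [← ENNReal.ofReal_le_ofReal_iff hρ.le, ENNReal.ofReal_mul costScale_nonneg, costScale,
    ENNReal.ofReal_toReal (ENNReal.inv_ne_top.2 heps.ne'), ofReal_norm]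
  calc (epsCost c U V)⁻¹ * ‖q - q'‖ₑ
      ≤ (epsCost c U V)⁻¹ * (epsCost c U V * ENNReal.ofReal ρ) := by gcongr
    _ = (epsCost c U V)⁻¹ * epsCost c U V * ENNReal.ofReal ρ := (mul_assoc _ _ _).symm
    -- Only an inequality, since the product with the inverse is 0 when ε_c is infinite.
    _ ≤ 1 * ENNReal.ofReal ρ := by gcongr; exact ENNReal.inv_mul_le_one _
    _ = ENNReal.ofReal ρ := one_mul _

theorem alexandrov_modCost [NeZero n] {ρ : ℝ} (hρ0 : 0 < ρ)
    (hρ : ∀ A : Matrix (Fin n) (Fin n) ℝ, (∀ i j, |A i j| ≤ ρ) → 1 / 2 ≤ (1 + A).det)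
    (h : B0 c U V) (h1 : B1 c U V) (h2 : B2 c U V) (h3 : B3 c U V) {y₀ : Euc n}
    (hy₀ : y₀ ∈ closure V) {u : Euc n → ℝ}
    (hu : IsCConvex (modCost c U V y₀) (closure (expDomain c U V y₀)) (closure V) u)
    {Z : Set (Euc n)} (hZ : Z = {q ∈ closure (expDomain c U V y₀) | u q ≤ 0})
    (hfr : ∀ q ∈ frontier Z, u q = 0) {q₀ : Euc n} (hq₀ : q₀ ∈ interior Z) {ν : Euc n} {a b : ℝ}
    (hν : ‖ν‖ = 1) (hsupp : SupportFromOppositeSides ν a b Z)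
    (hdiam : Metric.ediam Z ≤ epsCost c U V / ENNReal.ofReal ρ⁻¹) :
    ENNReal.ofReal (|u q₀| ^ n) ≤
      ENNReal.ofReal (2 ^ (n + 1) * (n : ℝ) ^ (2 * n)) * gammaPlus (modCost c U V y₀) Z V *
        (min (Metric.infEDist q₀ (hyperplane ν a)) (Metric.infEDist q₀ (hyperplane ν b)) /
          maxChord ν Z) *
        cMongeAmpere (modCost c U V y₀) (closure (expDomain c U V y₀)) (closure V) u Z *
        volume Z := by
  have H := crossConvexCost_modCost h h1 h2 h3 hy₀
  have hZsub : Z ⊆ closure (expDomain c U V y₀) := by rw [hZ]; exact fun q hq => hq.1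
  have hZb : Bornology.IsBounded Z := H.isBounded_left.closure.subset hZsub
  have hq₀W : q₀ ∈ expDomain c U V y₀ := by
    have hne : (interior (expDomain c U V y₀)).Nonempty := by
      rw [H.isOpen_left.interior_eq]
      exact closure_nonempty_iff.1 ⟨q₀, hZsub (interior_subset hq₀)⟩
    have := interior_mono hZsub hq₀
    rwa [H.convex_left.interior_closure_eq_interior_of_nonempty_interior hne,
      H.isOpen_left.interior_eq] at this
  have hq₀ab := hsupp.2.2 q₀ (interior_subset hq₀)
  have hΓ := fun S hS hSc => volume_coordGrad_image_le h h1 h2 hy₀ hq₀ hq₀W (S := S) hS hSc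
  have hdiam' := costScale_mul_norm_sub_le (epsCost_pos h h1) hρ0 hdiam
  have hda : ENNReal.ofReal (a - inner ℝ ν q₀) ≤ Metric.infEDist q₀ (hyperplane ν a) :=
    (ENNReal.ofReal_le_ofReal (le_abs_self _)).trans (ofReal_sub_le_infEDist_hyperplane hν a q₀)
  have hdb : ENNReal.ofReal (inner ℝ ν q₀ - b) ≤ Metric.infEDist q₀ (hyperplane ν b) := by
    refine (ENNReal.ofReal_le_ofReal ?_).trans (ofReal_sub_le_infEDist_hyperplane hν b q₀)
    rw [abs_sub_comm]
    exact le_abs_self _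
  set K := ENNReal.ofReal (2 ^ (n + 1) * (n : ℝ) ^ (2 * n))
  set Γ := gammaPlus (modCost c U V y₀) Z V
  set M := cMongeAmpere (modCost c U V y₀) (closure (expDomain c U V y₀)) (closure V) u Z
  set m := min (Metric.infEDist q₀ (hyperplane ν a)) (Metric.infEDist q₀ (hyperplane ν b)) with hm
  have hmain : ENNReal.ofReal (|u q₀| ^ n) * maxChord ν Z ≤ K * Γ * m * M * volume Z := by
    refine mul_maxChord_le hν fun α hα β hβ s hs hαβ => ?_
    rw [← ENNReal.ofReal_mul (by positivity)]
    have ea := H.alexandrov_estimate hρ hu hZ hfr hq₀ hdiam' hΓ (d := a - inner ℝ ν q₀) hν hα hβ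
      hs hαβ fun q hq => by
        rw [inner_sub_right]; linarith [(hsupp.2.2 q hq).2]
    -- The opposite hyperplane is handled by -ν, with the chord reversed.
    have eb := H.alexandrov_estimate hρ hu hZ hfr hq₀ hdiam' hΓ (ν := -ν)
      (d := inner ℝ ν q₀ - b) (by rwa [norm_neg]) hβ hα hs
      (by rw [smul_neg, ← hαβ, neg_sub]) fun q hq => by
        rw [inner_neg_left, inner_sub_right]; linarith [(hsupp.2.2 q hq).1]
    rcases min_choice (Metric.infEDist q₀ (hyperplane ν a))
      (Metric.infEDist q₀ (hyperplane ν b)) with hmin | hmin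
    · rw [hm, hmin]
      exact ea.trans (by gcongr)
    · rw [hm, hmin]
      exact eb.trans (by gcongr)
  rw [← ENNReal.le_div_iff_mul_le (Or.inl (maxChord_ne_zero hν hq₀))
    (Or.inl (maxChord_ne_top hZb))] at hmain
  refine hmain.trans (le_of_eq ?_)
  simp only [div_eq_mul_inv]
  ring

end OptTransport

theorem lemma6p5 (n : ℕ) :
    ∃ C₀ C : ℝ≥0, 0 < C₀ ∧ 0 < C ∧
      ∀ (U V : Set (OptTransport.Euc n)) (c : OptTransport.Euc n → OptTransport.Euc n → ℝ),
        OptTransport.B0 c U V → OptTransport.B1 c U V →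
        OptTransport.B2 c U V → OptTransport.B3 c U V →
        0 < OptTransport.epsCost c U V / C₀ ∧
        ∀ y₀ ∈ closure V, ∀ u : OptTransport.Euc n → ℝ,
          OptTransport.IsCConvex (OptTransport.modCost c U V y₀)
            (closure (OptTransport.expDomain c U V y₀)) (closure V) u →
          ∀ Z : Set (OptTransport.Euc n),
            Z = {q ∈ closure (OptTransport.expDomain c U V y₀) | u q ≤ 0} →
            (∀ q ∈ frontier Z, u q = 0) →
            ∀ q₀ ∈ interior Z, ∀ (ν : OptTransport.Euc n) (a b : ℝ), ‖ν‖ = 1 →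
              OptTransport.SupportFromOppositeSides ν a b Z →
              Metric.ediam Z ≤ OptTransport.epsCost c U V / C₀ →
              ENNReal.ofReal (|u q₀| ^ n) ≤
                C * OptTransport.gammaPlus (OptTransport.modCost c U V y₀) Z V *
                  (min (Metric.infEDist q₀ (OptTransport.hyperplane ν a))
                      (Metric.infEDist q₀ (OptTransport.hyperplane ν b)) /
                    OptTransport.maxChord ν Z) *
                  OptTransport.cMongeAmpere (OptTransport.modCost c U V y₀)
                    (closure (OptTransport.expDomain c U V y₀)) (closure V) u Z *
                  volume Z := by
  -- In dimension zero there is no unit vector, so only the positivity claim has content.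
  rcases Nat.eq_zero_or_pos n with rfl | hn
  · refine ⟨1, 1, one_pos, one_pos, fun U V c h h1 _ _ => ⟨?_, ?_⟩⟩
    · exact ENNReal.div_pos (OptTransport.epsCost_pos h h1).ne' ENNReal.coe_ne_top
    · intro y₀ _ u _ Z _ _ q₀ _ ν a b hν
      rw [Subsingleton.elim ν 0, norm_zero] at hν
      exact absurd hν zero_ne_one
  · have : NeZero n := ⟨hn.ne'⟩
    obtain ⟨ρ, hρ0, hρ⟩ := OptTransport.exists_det_lower_bound n
    -- With C₀ = ρ⁻¹ the diameter condition reads diam Z ≤ ρ ε_c.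
    refine ⟨Real.toNNReal ρ⁻¹, Real.toNNReal (2 ^ (n + 1) * (n : ℝ) ^ (2 * n)),
      Real.toNNReal_pos.2 (inv_pos.2 hρ0), Real.toNNReal_pos.2 (by positivity),
      fun U V c h h1 h2 h3 => ⟨?_, ?_⟩⟩
    · exact ENNReal.div_pos (OptTransport.epsCost_pos h h1).ne' ENNReal.coe_ne_top
    · intro y₀ hy₀ u hu Z hZ hfr q₀ hq₀ ν a b hν hsupp hdiam
      exact OptTransport.alexandrov_modCost hρ0 hρ h h1 h2 h3 hy₀ hu hZ hfr hq₀ hν hsupp hdiam
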